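/- Let $\mathsf k$ be an algebraically closed field of characteristic different from $2$, and let $J$ be a $9$-dimensional simple quadratic Jordan algebra of a cubic form over $\mathsf k$ whose bilinear trace $T$ is nondegenerate. That is, $J$ is a $9$-dimensional vector space with a cubic form $N$, a base point $\mathfrak 1$ and a quadratic map $\sharp\colon J\to J$ such that $N(\mathfrak 1)=1$, $x^{\sharp\sharp}=N(x)x$, $T(x^\sharp,y)=\partial_yN|_x$, $\mathfrak 1^\sharp=\mathfrak 1$ and $\mathfrak 1\sharp y=T(y)\mathfrak 1-y$. Here $x\sharp y:=(x+y)^\sharp-x^\sharp-y^\sharp$, $T(y):=\partial_yN|_{\mathfrak 1}$, $T(x,y):=T(x)T(y)-N(\mathfrak 1,x,y)$ with $N(\cdot,\cdot,\cdot)$ the full linearization of $N$, $S(x):=T(x^\sharp)$ and $S(x,y):=S(x+y)-S(x)-S(y)$. Put $U_xy:=T(x,y)x-x^\sharp\sharp y$ and $U_{x,y}:=U_{x+y}-U_x-U_y$; the Jordan product is $x\bullet y=\frac12U_{x,y}\mathfrak 1$, and simple means that $J$ has no ideals for $\bullet$ except $0$ and $J$. Let $\upsilon\in J$ be a primitive idempotent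 ($\upsilon\neq0$, $\upsilon\bullet\upsilon=\upsilon$, $\upsilon^\sharp=0$), put $\pi_3:=\mathfrak 1-\upsilon$, and let $J=J_{1/2}\oplus J_0\oplus J_1$ with $J_{1/2}=U_{\upsilon,\pi_3}(J)$, $J_0=U_{\pi_3}(J)$, $J_1=U_\upsilon(J)$ be the Peirce decomposition. Write $\pi_3^\perp=\{x\in J\mid T(x,\pi_3)=0\}$. **Choice of a basis.** (i) There is a basis $\pi_1,\pi_2,\pi_4$ of $J_0\cap\pi_3^\perp$ with $S(\pi_2)\ne0$ and $S(\pi_4)\neq0$. (ii) For every basis $\pi_1,\pi_2,\pi_4$ of $J_0\cap\pi_3^\perp$ there is a $2$-dimensional subspace $V\subset J_{1/2}$ with $\pi_2\sharp V\subset V$, $\pi_4\sharp V\subset V$, $\dim(\pi_1\sharp V)=2$ and $J_{1/2}=V\oplus(\pi_1\sharp V)$. (iii) For all $\pi_i$ and $V$ as in (ii) and every basis $\psi_1,\psi_2$ of $V$ there are unique $z,s_1,\dots,s_4,t_1,\dots,t_4\in\mathsf k$ with $$z=-S(\pi_1),\quad s_1=S(\pi_1,\pi_2),\quad t_1=-S(\pi_1,\pi_4),$$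 $$\pi_2\sharp\psi_1=-s_3\psi_1+s_2\psi_2,\quad \pi_2\sharp\psi_2=-s_4\psi_1+s_3\psi_2,\quad \pi_4\sharp\psi_1=t_3\psi_1-t_2\psi_2,\quad \pi_4\sharp\psi_2=t_4\psi_1-t_3\psi_2 .$$ (iv) If $S(\pi_2)\neq 0$ and $S(\pi_4)\ne0$, then $\psi_1,\psi_2$ can be chosen such that $s_2,s_3,s_4,t_2,t_3,t_4$ are all nonzero. **The formulas.** For all $\pi_i,V,\psi_1,\psi_2$ as above with $S(\pi_2),S(\pi_4),s_2,s_3,s_4,t_2,t_3,t_4$ all nonzero, one can replace $\psi_1,\psi_2$ by nonzero scalar multiples (and $z,s_i,t_i$ by the parameters of the new $\psi_1,\psi_2$; those assumed nonzero remain nonzero) such that the following holds. Put $\chi_i:=-\pi_1\sharp\psi_i$. Then $\upsilon,\pi_1,\pi_2,\pi_3,\pi_4,\psi_1,\psi_2,\chi_1,\chi_2$ is a basis of $J$, and $\upsilon$ spans $J_1$, the $\pi_i$ span $J_0$, and $\psi_1,\psi_2,\chi_1,\chi_2$ span $J_{1/2}$. For all $u,p_1,\dots,p_4,x_1,x_2,y_1,y_2\in\mathsf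 k$, with $\sigma_0=\sum_i p_i\pi_i$, $\sigma_{1/2}=x_1\chi_1+x_2\chi_2+y_1\psi_1+y_2\psi_2$ and $\sigma=u\upsilon+\sigma_0+\sigma_{1/2}$, one has $$S(\sigma_0)=u^\sharp,\qquad (\sigma_{1/2})^\sharp+u(\upsilon\sharp\sigma_0)=\sum_i p_i^\sharp\pi_i,\qquad \sigma_0\sharp\sigma_{1/2}=x_1^\sharp\chi_1+x_2^\sharp\chi_2+y_1^\sharp\psi_1+y_2^\sharp\psi_2,$$ $$\sigma^\sharp=u^\sharp\upsilon+\sum_i p_i^\sharp\pi_i+x_1^\sharp\chi_1+x_2^\sharp\chi_2+y_1^\sharp\psi_1+y_2^\sharp\psi_2,$$ where $$p_1^\sharp=-up_1-{}^t\mathbf t M_1\mathbf s,\quad p_2^\sharp=-up_2+{}^t\mathbf t\boldsymbol\Delta,\quad p_3^\sharp=up_3+{}^t\mathbf tM_3\mathbf s,\quad p_4^\sharp=-up_4+{}^t\mathbf s\boldsymbol\Delta,$$ $$x_1^\sharp=\mathrm{Pf}_5,\quad x_2^\sharp=\mathrm{Pf}_4,\quad y_1^\sharp=\mathrm{Pf}_3,\quad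 y_2^\sharp=\mathrm{Pf}_2,\quad u^\sharp=-\mathrm{Pf}_1 .$$ Here $\mathbf s={}^t(s_1,s_2,s_3,s_4)$, $\mathbf t={}^t(t_1,t_2,t_3,t_4)$, $\boldsymbol\Delta={}^t(\Delta_{12},\Delta_{13},2\Delta_{23},\Delta_{24})$ with $\Delta_{ij}$ the minor formed by the columns $i,j$ of $$\begin{pmatrix}y_1&y_2&zx_1&zx_2\\x_1&x_2&y_1&y_2\end{pmatrix};$$ $M_1$ and $M_3$ are the skew-symmetric $4\times4$ matrices with the upper triangular entries, in the positions $12,13,14,23,24,34$, $$M_1:\ -x_1^2,\ -2x_1x_2,\ -x_2^2,\ -2x_1y_1,\ -x_1y_2-x_2y_1,\ -2x_2y_2;$$ $$M_3:\ x_1y_1,\ x_1y_2+x_2y_1,\ x_2y_2,\ y_1^2+zx_1^2,\ y_1y_2+zx_1x_2,\ y_2^2+zx_2^2;$$ and $\mathrm{Pf}_k$ is the $4\times4$ Pfaffian, obtained by deleting the $k$th row and column, of the skew-symmetric $5\times5$ matrix $M=(m_{ij})$ with $m_{12}=x_1$, $m_{13}=x_2$, $m_{14}=y_1$, $m_{15}=y_2$,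 $m_{23}=-p_1$, $m_{24}=p_4t_4-p_2s_4$, $m_{25}=p_3+(p_2s_3-p_4t_3)$, $m_{34}=-p_3+(p_2s_3-p_4t_3)$, $m_{35}=p_4t_2-p_2s_2$, $m_{45}=-zp_1+p_2s_1-p_4t_1$. Moreover $N(\sigma)=N_\Upsilon$, where, with $\mathsf{ST}_{ij}:=s_it_j-s_jt_i$, $$\begin{aligned}3N_\Upsilon={}&2(2z\mathsf{ST}_{23}x_1+z\mathsf{ST}_{24}x_2+\mathsf{ST}_{12}y_1+\mathsf{ST}_{13}y_2)\,x_1^\sharp\\ &+2(z\mathsf{ST}_{24}x_1+2z\mathsf{ST}_{34}x_2+\mathsf{ST}_{13}y_1+\mathsf{ST}_{14}y_2)\,x_2^\sharp\\ &+2(\mathsf{ST}_{12}x_1+\mathsf{ST}_{13}x_2+2\mathsf{ST}_{23}y_1+\mathsf{ST}_{24}y_2)\,y_1^\sharp\\ &+2(\mathsf{ST}_{13}x_1+\mathsf{ST}_{14}x_2+\mathsf{ST}_{24}y_1+2\mathsf{ST}_{34}y_2)\,y_2^\sharp\\ &+u\,u^\sharp+(2zp_1-s_1p_2+t_1p_4)\,p_1^\sharp+2p_3\,p_3^\sharp\\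 &+\bigl(-s_1p_1+2(s_3^2-s_2s_4)p_2+(s_4t_2-2s_3t_3+s_2t_4)p_4\bigr)p_2^\sharp\\ &+\bigl(t_1p_1+(s_4t_2-2s_3t_3+s_2t_4)p_2+2(t_3^2-t_2t_4)p_4\bigr)p_4^\sharp .\end{aligned}$$ The right-hand side is $3$ times a polynomial with integer coefficients in the $18$ variables $z,s_i,t_i,u,p_i,x_i,y_i$; $N_\Upsilon$ denotes the value of that polynomial, so that the formula also holds in characteristic $3$. -/

import Mathlib

/-- A cubic form on a vector space: a map `N` together with its first directional derivative
`deriv x y = ∂_y N |_x`, which is quadratic in `x` and linear in `y`, such that `N` is homogeneous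
of degree `3` and `N (x + y) = N x + ∂_y N |_x + ∂_x N |_y + N y`. (Over a field with more than
three elements the derivative is determined by `N`.) -/
structure CubicForm (k J : Type*) [Field k] [AddCommGroup J] [Module k J] where
  toFun : J → k
  deriv : QuadraticMap k J (Module.Dual k J)
  toFun_smul : ∀ (a : k) (x : J), toFun (a • x) = a ^ 3 * toFun x
  toFun_add : ∀ x y : J, toFun (x + y) = toFun x + deriv x y + deriv y x + toFun y

/-- The bilinear trace `T(x,y) = (∂_x N |_e) (∂_y N |_e) - N(e,x,y)` of a cubic form with base point
`e`, where `N(e,x,y)` is the full linearization of `N`. -/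
noncomputable def CubicForm.bilinTrace {k J : Type*} [Field k] [AddCommGroup J] [Module k J]
    (N : CubicForm k J) (e : J) : LinearMap.BilinForm k J :=
  (N.deriv e).smulRight (N.deriv e) - N.deriv.polarBilin e

/-- A quadratic Jordan algebra of a cubic form: a cubic form `N` with base point `1` and a quadratic
map `♯` such that `N(1) = 1`, `x♯♯ = N(x) x`, `T(x♯,y) = ∂_y N |_x`, `1♯ = 1` and
`1 ♯ y = T(y) 1 - y`. (Over an infinite field these identities automatically remain valid after
every extension of scalars.) -/
structure CubicJordanAlgebra (k J : Type*) [Field k] [AddCommGroup J] [Module k J] where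
  cubic : CubicForm k J
  one : J
  sharp : QuadraticMap k J J
  cubic_one : cubic.toFun one = 1
  sharp_sharp : ∀ x, sharp (sharp x) = cubic.toFun x • x
  bilinTrace_sharp : ∀ x y, cubic.bilinTrace one (sharp x) y = cubic.deriv x y
  sharp_one : sharp one = one
  polar_sharp_one : ∀ y, QuadraticMap.polar sharp one y = cubic.deriv one y • one - y

namespace CubicJordanAlgebra

variable {k J : Type*} [Field k] [AddCommGroup J] [Module k J]

/-- The cubic form `N`. -/
def N (A : CubicJordanAlgebra k J) (x : J) : k := A.cubic.toFun x

/-- The linear trace `T(x) = ∂_x N |_1`. -/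
def tr (A : CubicJordanAlgebra k J) : Module.Dual k J := A.cubic.deriv A.one

/-- The bilinear trace `T(x,y)`. -/
noncomputable def T (A : CubicJordanAlgebra k J) : LinearMap.BilinForm k J :=
  A.cubic.bilinTrace A.one

/-- The quadratic form `S(x) = T(x♯)`. -/
def S (A : CubicJordanAlgebra k J) : QuadraticForm k J := A.tr.compQuadraticMap A.sharp

/-- The `♯`-product `x ♯ y = (x + y)♯ - x♯ - y♯`. -/
def sharpMul (A : CubicJordanAlgebra k J) : J →ₗ[k] J →ₗ[k] J := A.sharp.polarBilin

/-- `U_x y = T(x,y) x - x♯ ♯ y`. -/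
noncomputable def U (A : CubicJordanAlgebra k J) (x : J) : J →ₗ[k] J :=
  (A.T x).smulRight x - A.sharpMul (A.sharp x)

/-- `U_{x,z} = U_{x+z} - U_x - U_z`. -/
noncomputable def U₂ (A : CubicJordanAlgebra k J) (x z : J) : J →ₗ[k] J :=
  A.U (x + z) - A.U x - A.U z

/-- The Jordan product `x • y = (1/2) U_{x,y} 1` (in characteristic different from `2`). -/
noncomputable def jmul (A : CubicJordanAlgebra k J) (x y : J) : J :=
  (2 : k)⁻¹ • A.U₂ x y A.one

/-- The bilinear trace is nondegenerate. -/
def IsNondegenerate (A : CubicJordanAlgebra k J) : Prop :=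
  ∀ x, (∀ y, A.T x y = 0) → x = 0

/-- The Jordan algebra is nonzero and has no ideals except `0` and itself
(in characteristic different from `2`). -/
def IsSimple (A : CubicJordanAlgebra k J) : Prop :=
  Nontrivial J ∧
    ∀ I : Submodule k J, (∀ x ∈ I, ∀ y, A.jmul x y ∈ I) → I = ⊥ ∨ I = ⊤

/-- A primitive idempotent: `υ ≠ 0`, `υ • υ = υ` and `υ♯ = 0`. -/
def IsPrimitiveIdempotent (A : CubicJordanAlgebra k J) (υ : J) : Prop :=
  υ ≠ 0 ∧ A.jmul υ υ = υ ∧ A.sharp υ = 0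

/-- The Peirce subspace `J_{1/2} = U_{υ,1-υ}(J)`. -/
noncomputable def peirceHalf (A : CubicJordanAlgebra k J) (υ : J) : Submodule k J :=
  LinearMap.range (A.U₂ υ (A.one - υ))

/-- The Peirce subspace `J_0 = U_{1-υ}(J)`. -/
noncomputable def peirceZero (A : CubicJordanAlgebra k J) (υ : J) : Submodule k J :=
  LinearMap.range (A.U (A.one - υ))

/-- The Peirce subspace `J_1 = U_υ(J)`. -/
noncomputable def peirceOne (A : CubicJordanAlgebra k J) (υ : J) : Submodule k J :=
  LinearMap.range (A.U υ)

/-- `π^⊥ = {x | T(x,π) = 0}`. -/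
noncomputable def perp (A : CubicJordanAlgebra k J) (π : J) : Submodule k J :=
  LinearMap.ker (LinearMap.flip A.T π)

/-- `π = (π₁, π₂, π₃, π₄)` (so `π i` is `π_{i+1}`) with `π₃ = 1 - υ` and `π₁, π₂, π₄` a basis of
`J_0 ∩ π₃^⊥`. -/
structure IsZeroFrame (A : CubicJordanAlgebra k J) (υ : J) (π : Fin 4 → J) : Prop where
  pi3 : π 2 = A.one - υ
  linearIndependent : LinearIndependent k ![π 0, π 1, π 3]
  span_eq : Submodule.span k {π 0, π 1, π 3} = A.peirceZero υ ⊓ A.perp (π 2)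

/-- `V ⊆ J_{1/2}` is a plane with `π_i ♯ V ⊆ V` for `i = 2, 4`, `dim (π₁ ♯ V) = 2` and
`J_{1/2} = V ⊕ (π₁ ♯ V)`. -/
structure IsGoodPlane (A : CubicJordanAlgebra k J) (υ : J) (π : Fin 4 → J)
    (V : Submodule k J) : Prop where
  finrank_eq : Module.finrank k V = 2
  pi2_stable : V.map (A.sharpMul (π 1)) ≤ V
  pi4_stable : V.map (A.sharpMul (π 3)) ≤ V
  finrank_pi1 : Module.finrank k (V.map (A.sharpMul (π 0))) = 2
  disjoint : Disjoint V (V.map (A.sharpMul (π 0)))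
  sup_eq : V ⊔ V.map (A.sharpMul (π 0)) = A.peirceHalf υ

end CubicJordanAlgebra

/-- The nine parameters `z, s₁, …, s₄, t₁, …, t₄` (`s i` is `s_{i+1}`, `t i` is `t_{i+1}`). -/
@[ext]
structure UpsilonParam (R : Type*) where
  z : R
  s : Fin 4 → R
  t : Fin 4 → R

/-- The nine coordinates `u, p₁, …, p₄, x₁, x₂, y₁, y₂` (`p i` is `p_{i+1}`, and so on). -/
@[ext]
structure UpsilonPoint (R : Type*) where
  u : R
  p : Fin 4 → R
  x : Fin 2 → R
  y : Fin 2 → R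

/-- `s₂, s₃, s₄, t₂, t₃, t₄` are all nonzero. -/
def UpsilonParam.AllNonzero {R : Type*} [Zero R] (c : UpsilonParam R) : Prop :=
  (∀ i, i ≠ 0 → c.s i ≠ 0) ∧ (∀ i, i ≠ 0 → c.t i ≠ 0)

namespace Upsilon

variable {R : Type*} [CommRing R]

/-- The `2 × 4` matrix with rows `(y₁, y₂, z x₁, z x₂)` and `(x₁, x₂, y₁, y₂)`. -/
def minorMatrix (c : UpsilonParam R) (v : UpsilonPoint R) : Matrix (Fin 2) (Fin 4) R :=
  !![v.y 0, v.y 1, c.z * v.x 0, c.z * v.x 1;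
     v.x 0, v.x 1, v.y 0, v.y 1]

/-- The minor `Δ_{i+1,j+1}`, formed by the columns `i` and `j` (counted from `0`). -/
def minor (c : UpsilonParam R) (v : UpsilonPoint R) (i j : Fin 4) : R :=
  minorMatrix c v 0 i * minorMatrix c v 1 j - minorMatrix c v 0 j * minorMatrix c v 1 i

/-- The column `(Δ₁₂, Δ₁₃, 2 Δ₂₃, Δ₂₄)`. -/
def deltaVec (c : UpsilonParam R) (v : UpsilonPoint R) : Fin 4 → R :=
  ![minor c v 0 1, minor c v 0 2, 2 * minor c v 1 2, minor c v 1 3]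

/-- The upper triangular part of the skew-symmetric matrix `M₁`. -/
def upperM₁ (v : UpsilonPoint R) : Matrix (Fin 4) (Fin 4) R :=
  !![0, -(v.x 0) ^ 2, -2 * v.x 0 * v.x 1, -(v.x 1) ^ 2;
     0, 0, -2 * v.x 0 * v.y 0, -(v.x 0 * v.y 1) - v.x 1 * v.y 0;
     0, 0, 0, -2 * v.x 1 * v.y 1;
     0, 0, 0, 0]

/-- The `4 × 4` skew-symmetric matrix `M₁`. -/
def M₁ (v : UpsilonPoint R) : Matrix (Fin 4) (Fin 4) R :=
  upperM₁ v - (upperM₁ v).transpose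

/-- The upper triangular part of the skew-symmetric matrix `M₃`. -/
def upperM₃ (c : UpsilonParam R) (v : UpsilonPoint R) : Matrix (Fin 4) (Fin 4) R :=
  !![0, v.x 0 * v.y 0, v.x 0 * v.y 1 + v.x 1 * v.y 0, v.x 1 * v.y 1;
     0, 0, (v.y 0) ^ 2 + c.z * (v.x 0) ^ 2, v.y 0 * v.y 1 + c.z * v.x 0 * v.x 1;
     0, 0, 0, (v.y 1) ^ 2 + c.z * (v.x 1) ^ 2;
     0, 0, 0, 0]

/-- The `4 × 4` skew-symmetric matrix `M₃`. -/
def M₃ (c : UpsilonParam R) (v : UpsilonPoint R) : Matrix (Fin 4) (Fin 4) R :=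
  upperM₃ c v - (upperM₃ c v).transpose

/-- The upper triangular part of the `5 × 5` skew-symmetric matrix `M`. -/
def upperM (c : UpsilonParam R) (v : UpsilonPoint R) : Matrix (Fin 5) (Fin 5) R :=
  !![0, v.x 0, v.x 1, v.y 0, v.y 1;
     0, 0, -v.p 0, v.p 3 * c.t 3 - v.p 1 * c.s 3, v.p 2 + (v.p 1 * c.s 2 - v.p 3 * c.t 2);
     0, 0, 0, -v.p 2 + (v.p 1 * c.s 2 - v.p 3 * c.t 2), v.p 3 * c.t 1 - v.p 1 * c.s 1;
     0, 0, 0, 0, -(c.z * v.p 0) + v.p 1 * c.s 0 - v.p 3 * c.t 0;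
     0, 0, 0, 0, 0]

/-- The `5 × 5` skew-symmetric matrix `M`. -/
def M (c : UpsilonParam R) (v : UpsilonPoint R) : Matrix (Fin 5) (Fin 5) R :=
  upperM c v - (upperM c v).transpose

/-- The Pfaffian of a `4 × 4` skew-symmetric matrix. -/
def pfaffian₄ (B : Matrix (Fin 4) (Fin 4) R) : R :=
  B 0 1 * B 2 3 - B 0 2 * B 1 3 + B 0 3 * B 1 2

/-- `Pf i` is the Pfaffian of the submatrix of `M` without the row and the column `i`
(counted from `0`, so that it is `Pf_{i+1}` in the usual numbering). -/
def Pf (c : UpsilonParam R) (v : UpsilonPoint R) (i : Fin 5) : R :=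
  pfaffian₄ ((M c v).submatrix i.succAbove i.succAbove)

open Matrix in
/-- The explicit quadratic formulas for the nine coordinates of `σ♯`. -/
def sharp (c : UpsilonParam R) (v : UpsilonPoint R) : UpsilonPoint R where
  u := -Pf c v 0
  p := ![-(v.u * v.p 0) - c.t ⬝ᵥ (M₁ v *ᵥ c.s),
         -(v.u * v.p 1) + c.t ⬝ᵥ deltaVec c v,
         v.u * v.p 2 + c.t ⬝ᵥ (M₃ c v *ᵥ c.s),
         -(v.u * v.p 3) + c.s ⬝ᵥ deltaVec c v]
  x := ![Pf c v 4, Pf c v 3]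
  y := ![Pf c v 2, Pf c v 1]

/-- `ST_{i+1,j+1} = s_{i+1} t_{j+1} - s_{j+1} t_{i+1}`. -/
def ST (c : UpsilonParam R) (i j : Fin 4) : R := c.s i * c.t j - c.s j * c.t i

/-- Three times the explicit cubic form `N_Υ`. -/
def threeN (c : UpsilonParam R) (v : UpsilonPoint R) : R :=
  2 * (2 * c.z * ST c 1 2 * v.x 0 + c.z * ST c 1 3 * v.x 1 + ST c 0 1 * v.y 0 + ST c 0 2 * v.y 1)
      * (sharp c v).x 0
  + 2 * (c.z * ST c 1 3 * v.x 0 + 2 * c.z * ST c 2 3 * v.x 1 + ST c 0 2 * v.y 0 + ST c 0 3 * v.y 1)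
      * (sharp c v).x 1
  + 2 * (ST c 0 1 * v.x 0 + ST c 0 2 * v.x 1 + 2 * ST c 1 2 * v.y 0 + ST c 1 3 * v.y 1)
      * (sharp c v).y 0
  + 2 * (ST c 0 2 * v.x 0 + ST c 0 3 * v.x 1 + ST c 1 3 * v.y 0 + 2 * ST c 2 3 * v.y 1)
      * (sharp c v).y 1
  + v.u * (sharp c v).u
  + (2 * c.z * v.p 0 - c.s 0 * v.p 1 + c.t 0 * v.p 3) * (sharp c v).p 0
  + 2 * v.p 2 * (sharp c v).p 2
  + (-(c.s 0 * v.p 0) + 2 * (c.s 2 ^ 2 - c.s 1 * c.s 3) * v.p 1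
      + (c.s 3 * c.t 1 - 2 * c.s 2 * c.t 2 + c.s 1 * c.t 3) * v.p 3) * (sharp c v).p 1
  + (c.t 0 * v.p 0 + (c.s 3 * c.t 1 - 2 * c.s 2 * c.t 2 + c.s 1 * c.t 3) * v.p 1
      + 2 * (c.t 2 ^ 2 - c.t 1 * c.t 3) * v.p 3) * (sharp c v).p 3

/-- The eighteen indeterminates. -/
inductive Var : Type
  | z : Var
  | s (i : Fin 4) : Var
  | t (i : Fin 4) : Var
  | u : Var
  | p (i : Fin 4) : Var
  | x (i : Fin 2) : Var
  | y (i : Fin 2) : Var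

/-- The parameters as indeterminates over `ℤ`. -/
noncomputable def genericParam : UpsilonParam (MvPolynomial Var ℤ) where
  z := MvPolynomial.X Var.z
  s i := MvPolynomial.X (Var.s i)
  t i := MvPolynomial.X (Var.t i)

/-- The coordinates as indeterminates over `ℤ`. -/
noncomputable def genericPoint : UpsilonPoint (MvPolynomial Var ℤ) where
  u := MvPolynomial.X Var.u
  p i := MvPolynomial.X (Var.p i)
  x i := MvPolynomial.X (Var.x i)
  y i := MvPolynomial.X (Var.y i)

/-- The values of the indeterminates at given parameters and coordinates. -/
def assign (c : UpsilonParam R) (v : UpsilonPoint R) : Var → R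
  | Var.z => c.z
  | Var.s i => c.s i
  | Var.t i => c.t i
  | Var.u => v.u
  | Var.p i => v.p i
  | Var.x i => v.x i
  | Var.y i => v.y i

end Upsilon

namespace CubicJordanAlgebra

variable {k J : Type*} [Field k] [AddCommGroup J] [Module k J]

/-- `c` is the system of parameters of `π` and `ψ = (ψ₁, ψ₂)`: `s₁ = S(π₁,π₂)`, `t₁ = -S(π₁,π₄)`,
`z = -S(π₁)`, and the remaining ones are read off from `π₂ ♯ ψ_i` and `π₄ ♯ ψ_i`. -/
structure IsParameters (A : CubicJordanAlgebra k J) (π : Fin 4 → J) (ψ : Fin 2 → J)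
    (c : UpsilonParam k) : Prop where
  s1 : c.s 0 = QuadraticMap.polar A.S (π 0) (π 1)
  t1 : c.t 0 = -QuadraticMap.polar A.S (π 0) (π 3)
  z : c.z = -A.S (π 0)
  pi2_psi1 : A.sharpMul (π 1) (ψ 0) = -c.s 2 • ψ 0 + c.s 1 • ψ 1
  pi2_psi2 : A.sharpMul (π 1) (ψ 1) = -c.s 3 • ψ 0 + c.s 2 • ψ 1
  pi4_psi1 : A.sharpMul (π 3) (ψ 0) = c.t 2 • ψ 0 - c.t 1 • ψ 1
  pi4_psi2 : A.sharpMul (π 3) (ψ 1) = c.t 3 • ψ 0 - c.t 2 • ψ 1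

/-- `χ_i = -π₁ ♯ ψ_i`. -/
def chi (A : CubicJordanAlgebra k J) (π : Fin 4 → J) (ψ : Fin 2 → J) (i : Fin 2) : J :=
  -A.sharpMul (π 0) (ψ i)

/-- `υ, π₁, …, π₄, ψ₁, ψ₂, χ₁, χ₂` is a basis of `J` that is adapted to the Peirce decomposition:
`υ` spans `J_1`, the `π_i` span `J_0`, the `ψ_i` and `χ_i` span `J_{1/2}`. -/
structure IsAdaptedBasis (A : CubicJordanAlgebra k J) (υ : J) (π : Fin 4 → J)
    (ψ : Fin 2 → J) : Prop where
  linearIndependent : LinearIndependent k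
    ![υ, π 0, π 1, π 2, π 3, ψ 0, ψ 1, A.chi π ψ 0, A.chi π ψ 1]
  span_eq_top : Submodule.span k
    (Set.range ![υ, π 0, π 1, π 2, π 3, ψ 0, ψ 1, A.chi π ψ 0, A.chi π ψ 1]) = ⊤
  span_one : Submodule.span k {υ} = A.peirceOne υ
  span_zero : Submodule.span k (Set.range π) = A.peirceZero υ
  span_half : Submodule.span k (Set.range ψ ∪ Set.range (A.chi π ψ)) = A.peirceHalf υ

/-- `p₁ π₁ + p₂ π₂ + p₃ π₃ + p₄ π₄`, the component in `J_0`. -/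
def zeroPart (π : Fin 4 → J) (v : UpsilonPoint k) : J := ∑ i, v.p i • π i

/-- `x₁ χ₁ + x₂ χ₂ + y₁ ψ₁ + y₂ ψ₂`, the component in `J_{1/2}`. -/
def halfPart (A : CubicJordanAlgebra k J) (π : Fin 4 → J) (ψ : Fin 2 → J)
    (v : UpsilonPoint k) : J :=
  ∑ i, v.x i • A.chi π ψ i + ∑ i, v.y i • ψ i

/-- The element of `J` with coordinates `v`. -/
def element (A : CubicJordanAlgebra k J) (υ : J) (π : Fin 4 → J) (ψ : Fin 2 → J)
    (v : UpsilonPoint k) : J :=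
  v.u • υ + zeroPart π v + A.halfPart π ψ v

end CubicJordanAlgebra

/-! Write W for `tracelessZero`, the traceless part of J_0, and H for J_{1/2}. The source of all
relations is the full linearization of x♯♯ = N(x)x (`sharpMul_sharpMul_sharpMul`) and its
specialization at the unit (`sharpMul_cyclic`). It makes W the (−1)-eigenspace of υ♯, and gives
a♯(b♯x) + b♯(a♯x) = −S(a,b)x for a, b in W and x in H (`clifford`). So H is a Clifford module for −S
on W, and W acts on it by T-self-adjoint operators. The Peirce pieces are T-orthogonal, so T stays
nondegenerate on each.

Dimensions: an a in W with S(a) = −1 acts on H as an involution. Simplicity makes both eigenspaces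
nonzero, and an anisotropic vector of one identifies the other with the complement a^⊥ of a in W
(`finrank_halfFixed_neg`). If d = dim a^⊥, then 9 = 2 + (1 + d) + 2d, so d = 2, dim W = 3, dim H =
4.

Planes: let n ≠ 0 in W be orthogonal to π₂ and π₄. If n is isotropic, V is its kernel in H.
Otherwise π₂, π₄ span a nondegenerate plane with Clifford algebra M₂(k), H is a sum of two simple
modules over it, and V is a simple submodule not stable under n (`exists_plane_of_nonisotropic`).
The matrices of π₂ and π₄ on V are traceless (`trace_eq_zero`), which gives the shape of the
parameters.

Formulas: the products of J_0 with H follow from the Clifford relation. The square x♯ of x in H lies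
in J_0 and is determined by T(x♯,p) = ½T(p♯x,x), hence by the values of T on H. Self-adjointness of
π₂ and π₄ says that these values form a 2-vector in ⋀²k⁴ annihilated by s∧ and t∧, so it is a
multiple κ of s∧t (`exists_normalization`). Nondegeneracy gives κ ≠ 0, and scaling both ψ_i by a
square root of κ⁻¹ removes κ without changing the parameters. Finally N(σ) = u S(σ_0) + T(σ_{1/2}♯,
σ_0), which has integer coefficients; the expression for 3N is Euler's T(σ♯,σ) = 3N(σ). -/

namespace CubicJordanAlgebra

variable {k J : Type*} [Field k] [AddCommGroup J] [Module k J]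

/-! ### Linearized identities of a cubic Jordan algebra -/

section Identities

variable (A : CubicJordanAlgebra k J)

lemma sharp_add (x y : J) : A.sharp (x + y) = A.sharp x + A.sharp y + A.sharpMul x y := by
  simp [sharpMul, QuadraticMap.polar]

lemma sharp_smul (a : k) (x : J) : A.sharp (a • x) = (a * a) • A.sharp x :=
  A.sharp.map_smul a x

lemma sharpMul_comm (x y : J) : A.sharpMul x y = A.sharpMul y x := by
  simp [sharpMul, QuadraticMap.polar_comm]

lemma sharpMul_self (x : J) : A.sharpMul x x = (2 : k) • A.sharp x := by
  simp [sharpMul, QuadraticMap.polar_self, two_smul]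

lemma T_sharp (x y : J) : A.T (A.sharp x) y = A.cubic.deriv x y := A.bilinTrace_sharp x y

lemma T_sharpMul (x y z : J) :
    A.T (A.sharpMul x y) z = QuadraticMap.polar A.cubic.deriv x y z := by
  simp [sharpMul, QuadraticMap.polar, T_sharp]

lemma N_add (x y : J) :
    A.N (x + y) = A.N x + A.T (A.sharp x) y + A.T (A.sharp y) x + A.N y := by
  rw [T_sharp, T_sharp]; exact A.cubic.toFun_add x y

lemma N_smul (a : k) (x : J) : A.N (a • x) = a ^ 3 * A.N x := A.cubic.toFun_smul a x

lemma sharp_sharp' (x : J) : A.sharp (A.sharp x) = A.N x • x := A.sharp_sharp x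

/-- Expand N(x + y + z) with both bracketings and compare. -/
lemma T_sharpMul_rotate (x y z : J) : A.T (A.sharpMul x y) z = A.T (A.sharpMul y z) x := by
  have h := A.N_add x (y + z)
  rw [← add_assoc] at h
  simp only [N_add, sharp_add, map_add, LinearMap.add_apply] at h
  linear_combination h

lemma T_one_sharpMul (x y : J) : A.T x y = A.tr x * A.tr y - A.T (A.sharpMul A.one x) y := by
  rw [T_sharpMul]
  simp [T, CubicForm.bilinTrace, tr]

lemma T_comm (x y : J) : A.T x y = A.T y x := by
  rw [T_one_sharpMul, T_one_sharpMul A y x, T_sharpMul_rotate, T_sharpMul_rotate, A.sharpMul_comm y]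
  ring

lemma T_sharpMul_right (x y z : J) : A.T (A.sharpMul x y) z = A.T y (A.sharpMul x z) := by
  rw [A.sharpMul_comm x y, T_sharpMul_rotate, T_comm]

/-- The full linearization of `x♯♯ = N(x) x`. -/
lemma sharpMul_sharpMul_sharpMul (x y z w : J) :
    A.sharpMul (A.sharpMul x y) (A.sharpMul z w) + A.sharpMul (A.sharpMul x z) (A.sharpMul y w)
      + A.sharpMul (A.sharpMul x w) (A.sharpMul y z) =
    A.T (A.sharpMul x y) z • w + A.T (A.sharpMul x y) w • z + A.T (A.sharpMul x z) w • y
      + A.T (A.sharpMul y z) w • x := by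
  -- Three successive differences, in (x,y), then (y,z), then (x,w), polarize the quartic identity
  -- completely. Only differences are taken, so no homogeneous components need to be separated and
  -- the size of k plays no role.
  have h1 : ∀ x y : J, A.sharpMul (A.sharp x) (A.sharp y)
      + A.sharpMul (A.sharp x) (A.sharpMul x y) + A.sharpMul (A.sharp y) (A.sharpMul x y)
      + A.sharp (A.sharpMul x y) = A.N x • y + A.N y • x
        + (A.T (A.sharp x) y + A.T (A.sharp y) x) • (x + y) := by
    intro x y
    have h := A.sharp_sharp' (x + y)
    simp only [sharp_add, N_add, sharp_sharp', map_add, LinearMap.add_apply] at h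
    linear_combination (norm := module) h
  have h2 : ∀ x y z : J, A.sharpMul (A.sharp x) (A.sharpMul y z)
      + A.sharpMul (A.sharpMul y z) (A.sharpMul x y + A.sharpMul x z)
      + A.sharpMul (A.sharp y) (A.sharpMul x z) + A.sharpMul (A.sharp z) (A.sharpMul x y)
      + A.sharpMul (A.sharpMul x y) (A.sharpMul x z) =
      (A.T (A.sharp y) z + A.T (A.sharp z) y + A.T (A.sharpMul y z) x) • x
        + A.T (A.sharpMul y z) x • (y + z)
        + (A.T (A.sharp x) z + A.T (A.sharp z) x) • y
        + (A.T (A.sharp x) y + A.T (A.sharp y) x) • z := by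
    intro x y z
    have h := h1 x (y + z)
    have hy := h1 x y
    have hz := h1 x z
    simp only [sharp_add, N_add, map_add, LinearMap.add_apply] at h hy hz ⊢
    linear_combination (norm := module) h - hy - hz
  have h := h2 (x + w) y z
  have hx := h2 x y z
  have hw := h2 w y z
  simp only [sharp_add, map_add, LinearMap.add_apply] at h hx hw ⊢
  rw [A.sharpMul_comm w y, A.sharpMul_comm w z] at *
  linear_combination (norm := skip) h - hx - hw
  rw [A.sharpMul_comm (A.sharpMul x z) (A.sharpMul y w), A.T_sharpMul_rotate x y z,
    A.sharpMul_comm x y, A.T_sharpMul_rotate y x w, A.sharpMul_comm x z, A.T_sharpMul_rotate z x w]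
  module

lemma sharpMul_one (y : J) : A.sharpMul A.one y = A.tr y • A.one - y := A.polar_sharp_one y

/-- Evaluate 1♯1 as twice the square of 1 and by the unit axiom. The unit is nonzero since N(0) = 0.
-/
lemma tr_one : A.tr A.one = 3 := by
  have h := A.sharpMul_self A.one
  rw [sharpMul_one, A.sharp_one, sub_eq_iff_eq_add, ← sub_eq_zero] at h
  have h1 : (A.tr A.one - 3) • A.one = 0 := by
    rw [← h]; module
  rcases smul_eq_zero.1 h1 with h1 | h1
  · exact sub_eq_zero.1 h1
  · have h2 := A.cubic_one
    have h3 := A.cubic.toFun_smul 0 0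
    rw [h1] at h2
    simp [h2] at h3

lemma T_one (x : J) : A.T x A.one = A.tr x := by
  rw [T_comm]
  nth_rw 1 [← A.sharp_one]
  rw [T_sharp]; rfl

lemma T_eq (x y : J) : A.T x y = A.tr x * A.tr y - A.tr (A.sharpMul x y) := by
  rw [T_one_sharpMul, T_sharpMul_rotate, T_one]

lemma polar_S (x y : J) : QuadraticMap.polar A.S x y = A.tr (A.sharpMul x y) := by
  simp [QuadraticMap.polar, S, sharpMul]

lemma S_apply (x : J) : A.S x = A.tr (A.sharp x) := rfl

lemma U_apply (x y : J) : A.U x y = A.T x y • x - A.sharpMul (A.sharp x) y := by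
  simp [U]

lemma U₂_apply (x z y : J) :
    A.U₂ x z y = A.T x y • z + A.T z y • x - A.sharpMul (A.sharpMul x z) y := by
  simp only [U₂, LinearMap.sub_apply, U_apply, sharp_add, map_add, LinearMap.add_apply]
  module

lemma jmul_apply (x y : J) : A.jmul x y =
    (2 : k)⁻¹ • (A.sharpMul x y + A.tr x • y + A.tr y • x - A.tr (A.sharpMul x y) • A.one) := by
  rw [jmul, U₂_apply, T_one, T_one, A.sharpMul_comm (A.sharpMul x y), sharpMul_one]
  module

/-- The linearized identity for products with three factors. -/
lemma sharpMul_cyclic (x y z : J) :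
    A.sharpMul (A.sharpMul x y) z + A.sharpMul (A.sharpMul x z) y + A.sharpMul (A.sharpMul y z) x =
      (A.tr z * A.tr (A.sharpMul x y) + A.tr y * A.tr (A.sharpMul x z)
        + A.tr x * A.tr (A.sharpMul y z) - A.T (A.sharpMul x y) z) • A.one
      - A.tr z • A.sharpMul x y - A.tr y • A.sharpMul x z - A.tr x • A.sharpMul y z
      - A.tr (A.sharpMul x y) • z - A.tr (A.sharpMul x z) • y - A.tr (A.sharpMul y z) • x := by
  have h := A.sharpMul_sharpMul_sharpMul x y z A.one
  simp only [T_one, A.sharpMul_comm _ A.one, sharpMul_one, map_sub, map_smul] at h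
  simp only [LinearMap.sub_apply, LinearMap.smul_apply, sharpMul_one] at h
  rw [A.sharpMul_comm x (A.sharpMul y z)] at h
  linear_combination (norm := module) -h

end Identities
end CubicJordanAlgebra

namespace CubicJordanAlgebra

variable {k J : Type*} [Field k] [AddCommGroup J] [Module k J]

/-! ### Peirce spaces through the operator υ♯ -/

section Peirce

/-- The elements of the Peirce space `J_0` which are orthogonal to its unit `1 - υ`. -/
noncomputable def tracelessZero (A : CubicJordanAlgebra k J) (υ : J) : Submodule k J :=
  A.peirceZero υ ⊓ A.perp (A.one - υ)

variable {A : CubicJordanAlgebra k J} {υ : J}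

lemma T_compl (A : CubicJordanAlgebra k J) (υ y : J) : A.T (A.one - υ) y = A.tr y - A.T υ y := by
  rw [map_sub, LinearMap.sub_apply, A.T_comm A.one, T_one]

lemma sharpMul_compl (A : CubicJordanAlgebra k J) (υ y : J) : A.sharpMul (A.one - υ) y = A.tr y • A.one - y - A.sharpMul υ y := by
  rw [map_sub, LinearMap.sub_apply, sharpMul_one]

lemma IsPrimitiveIdempotent.sharp_eq (hυ : A.IsPrimitiveIdempotent υ) : A.sharp υ = 0 := hυ.2.2

lemma IsPrimitiveIdempotent.sharpMul_self (hυ : A.IsPrimitiveIdempotent υ) :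
    A.sharpMul υ υ = 0 := by
  rw [A.sharpMul_self, hυ.sharp_eq, smul_zero]

lemma IsPrimitiveIdempotent.tr_eq (h2 : (2 : k) ≠ 0) (hυ : A.IsPrimitiveIdempotent υ) :
    A.tr υ = 1 := by
  have h := hυ.2.1
  rw [jmul_apply, hυ.sharpMul_self, map_zero] at h
  have h1 : (A.tr υ - 1) • υ = 0 := by
    rw [sub_smul, one_smul]
    nth_rw 3 [← h]
    match_scalars <;> field_simp <;> ring
  rcases smul_eq_zero.1 h1 with h1 | h1
  · exact sub_eq_zero.1 h1
  · exact absurd h1 hυ.1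

variable (h2 : (2 : k) ≠ 0) (hυ : A.IsPrimitiveIdempotent υ)
include hυ

lemma T_idem_sharpMul (y : J) : A.T υ (A.sharpMul υ y) = 0 := by
  rw [← T_sharpMul_right, hυ.sharpMul_self, map_zero, LinearMap.zero_apply]

lemma U_idem (y : J) : A.U υ y = A.T υ y • υ := by
  rw [U_apply, hυ.sharp_eq]; simp

include h2

lemma T_idem_self : A.T υ υ = 1 := by
  rw [T_eq, hυ.sharpMul_self, hυ.tr_eq h2, map_zero]; ring

lemma tr_idem_sharpMul (y : J) : A.tr (A.sharpMul υ y) = A.tr y - A.T υ y := by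
  rw [T_eq, hυ.tr_eq h2]; ring

lemma tr_compl : A.tr (A.one - υ) = 2 := by
  rw [map_sub, tr_one, hυ.tr_eq h2]; ring

lemma T_compl_self : A.T (A.one - υ) (A.one - υ) = 2 := by
  rw [T_compl, tr_compl h2 hυ, map_sub, T_one, T_idem_self h2 hυ, hυ.tr_eq h2]; ring

lemma T_idem_compl : A.T υ (A.one - υ) = 0 := by
  rw [map_sub, T_one, T_idem_self h2 hυ, hυ.tr_eq h2]; ring

lemma sharpMul_idem_compl : A.sharpMul υ (A.one - υ) = A.one - υ := by
  rw [map_sub, hυ.sharpMul_self, A.sharpMul_comm, sharpMul_one, hυ.tr_eq h2]; module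

lemma sharp_compl : A.sharp (A.one - υ) = υ := by
  have h : A.sharp (A.one - υ) = A.sharp (A.one + (-1 : k) • υ) := by congr 1; module
  rw [h, sharp_add, sharp_smul, map_smul, sharpMul_one, A.sharp_one, hυ.sharp_eq, hυ.tr_eq h2]
  module

/-- The case x = y = υ of `sharpMul_cyclic`, divided by 2. It is the relation that makes the Peirce
operators below act as projections. -/
lemma sharpMul_idem_idem (z : J) : A.sharpMul υ (A.sharpMul υ z) =
    (A.tr z - A.T υ z) • (A.one - υ) - A.sharpMul υ z := by
  have h := A.sharpMul_cyclic υ υ z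
  rw [hυ.sharpMul_self, A.sharpMul_comm _ υ, hυ.tr_eq h2, tr_idem_sharpMul h2 hυ] at h
  simp only [map_zero, LinearMap.zero_apply] at h
  have h' : (2 : k) • (A.sharpMul υ (A.sharpMul υ z) -
    ((A.tr z - A.T υ z) • (A.one - υ) - A.sharpMul υ z)) = 0 := by
    linear_combination (norm := module) h
  exact sub_eq_zero.1 ((smul_eq_zero.1 h').resolve_left h2)

lemma U₂_idem_compl (y : J) : A.U₂ υ (A.one - υ) y =
    y - A.T υ y • υ - (A.tr y - A.T υ y) • (A.one - υ) + A.sharpMul υ y := by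
  rw [U₂_apply, sharpMul_idem_compl h2 hυ, sharpMul_compl, T_compl]
  module

lemma U_compl (y : J) : A.U (A.one - υ) y =
    (A.tr y - A.T υ y) • (A.one - υ) - A.sharpMul υ y := by
  rw [U_apply, sharp_compl h2 hυ, T_compl]

lemma peirceOne_eq : A.peirceOne υ = Submodule.span k {υ} := by
  ext x
  rw [Submodule.mem_span_singleton, peirceOne, LinearMap.mem_range]
  constructor
  · rintro ⟨y, rfl⟩; exact ⟨_, (U_idem hυ y).symm⟩
  · rintro ⟨a, rfl⟩
    exact ⟨a • υ, by rw [U_idem hυ, map_smul, T_idem_self h2 hυ]; simp⟩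

lemma mem_peirceHalf {x : J} :
    x ∈ A.peirceHalf υ ↔ A.sharpMul υ x = 0 ∧ A.T υ x = 0 ∧ A.tr x = 0 := by
  rw [peirceHalf, LinearMap.mem_range]
  constructor
  · rintro ⟨y, rfl⟩
    rw [U₂_idem_compl h2 hυ]
    simp only [map_add, map_sub, map_smul, hυ.sharpMul_self, sharpMul_idem_idem h2 hυ,
      sharpMul_idem_compl h2 hυ, T_idem_self h2 hυ, hυ.tr_eq h2, T_idem_sharpMul hυ,
      tr_idem_sharpMul h2 hυ, T_one, tr_one, smul_eq_mul]
    refine ⟨by module, by ring, by ring⟩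
  · rintro ⟨h, h', h''⟩
    exact ⟨x, by rw [U₂_idem_compl h2 hυ, h, h', h'']; simp⟩

lemma mem_peirceZero {x : J} :
    x ∈ A.peirceZero υ ↔ A.sharpMul υ x = A.tr x • (A.one - υ) - x := by
  rw [peirceZero, LinearMap.mem_range]
  constructor
  · rintro ⟨y, rfl⟩
    rw [U_compl h2 hυ]
    simp only [map_sub, map_smul, sharpMul_idem_idem h2 hυ, sharpMul_idem_compl h2 hυ,
      hυ.tr_eq h2, tr_idem_sharpMul h2 hυ, tr_one, smul_eq_mul]
    module
  · intro h
    have h' : A.T υ x = 0 := by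
      have := T_idem_sharpMul hυ x
      rwa [h, map_sub, map_smul, T_idem_compl h2 hυ, smul_zero, zero_sub, neg_eq_zero] at this
    exact ⟨x, by rw [U_compl h2 hυ, h, h']; module⟩

/-- The working description of W. The trace conditions come for free: T(υ, υ♯x) = 0 forces T(υ,x) =
0, and then tr(υ♯x) = tr x − T(υ,x) forces 2 tr x = 0. -/
lemma mem_tracelessZero {x : J} :
    x ∈ A.tracelessZero υ ↔ A.sharpMul υ x = -x := by
  rw [tracelessZero, Submodule.mem_inf, mem_peirceZero h2 hυ, perp, LinearMap.mem_ker,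
    LinearMap.flip_apply, A.T_comm, T_compl]
  constructor
  · rintro ⟨h, h'⟩
    have := T_idem_sharpMul hυ x
    rw [h, map_sub, map_smul, T_idem_compl h2 hυ, smul_zero, zero_sub, neg_eq_zero] at this
    rw [this, sub_zero] at h'
    rw [h, h']; simp
  · intro h
    have h1 := T_idem_sharpMul hυ x
    rw [h, map_neg, neg_eq_zero] at h1
    have h3 := tr_idem_sharpMul h2 hυ x
    rw [h, h1, map_neg] at h3
    have h4 : A.tr x = 0 := by
      have : 2 * A.tr x = 0 := by linear_combination -h3
      exact (mul_eq_zero.1 this).resolve_left h2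
    rw [h, h1, h4]; simp

lemma T_idem_tracelessZero {x : J} (hx : x ∈ A.tracelessZero υ) : A.T υ x = 0 := by
  have h1 := T_idem_sharpMul hυ x
  rwa [(mem_tracelessZero h2 hυ).1 hx, map_neg, neg_eq_zero] at h1

lemma tr_tracelessZero {x : J} (hx : x ∈ A.tracelessZero υ) : A.tr x = 0 := by
  have h := T_idem_tracelessZero h2 hυ hx
  rw [tracelessZero, Submodule.mem_inf, perp, LinearMap.mem_ker, LinearMap.flip_apply, A.T_comm,
    T_compl, h, sub_zero] at hx
  exact hx.2

lemma compl_mem_peirceZero : A.one - υ ∈ A.peirceZero υ := by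
  rw [mem_peirceZero h2 hυ, sharpMul_idem_compl h2 hυ, tr_compl h2 hυ]; module

/-- `J_0` is spanned by its unit and its traceless elements. -/
lemma peirceZero_eq : A.peirceZero υ = Submodule.span k {A.one - υ} ⊔ A.tracelessZero υ := by
  apply le_antisymm
  · intro x hx
    have hx' := (mem_peirceZero h2 hυ).1 hx
    refine Submodule.mem_sup.2 ⟨(A.tr x / 2) • (A.one - υ),
      Submodule.smul_mem _ _ (Submodule.mem_span_singleton_self _),
      x - (A.tr x / 2) • (A.one - υ), ?_, by abel⟩
    rw [mem_tracelessZero h2 hυ, map_sub, map_smul, sharpMul_idem_compl h2 hυ, hx']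
    match_scalars <;> field_simp <;> ring
  · refine sup_le ?_ inf_le_left
    rw [Submodule.span_singleton_le_iff_mem]
    exact compl_mem_peirceZero h2 hυ

/-- The Peirce decomposition of an element, with `J_0` split further. -/
lemma exists_peirce (x : J) : ∃ a b : k, ∃ w ∈ A.tracelessZero υ, ∃ y ∈ A.peirceHalf υ,
    x = a • υ + b • (A.one - υ) + w + y := by
  have h0 : A.U (A.one - υ) x ∈ A.peirceZero υ := ⟨x, rfl⟩
  rw [peirceZero_eq h2 hυ] at h0
  obtain ⟨e, he, w, hw, h⟩ := Submodule.mem_sup.1 h0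
  obtain ⟨b, rfl⟩ := Submodule.mem_span_singleton.1 he
  refine ⟨A.T υ x, b, w, hw, A.U₂ υ (A.one - υ) x, ⟨x, rfl⟩, ?_⟩
  rw [add_assoc (A.T υ x • υ), h, U₂_idem_compl h2 hυ, U_compl h2 hυ]
  module

end Peirce
end CubicJordanAlgebra

namespace CubicJordanAlgebra

variable {k J : Type*} [Field k] [AddCommGroup J] [Module k J]

/-! ### Products of Peirce components and the Clifford action on J_{1/2} -/

section PeirceProducts

variable {A : CubicJordanAlgebra k J} {υ : J}
variable (h2 : (2 : k) ≠ 0) (hυ : A.IsPrimitiveIdempotent υ)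
include h2 hυ

lemma T_traceless {a : J} (ha : a ∈ A.tracelessZero υ) (b : J) :
    A.T a b = -QuadraticMap.polar A.S a b := by
  rw [T_eq, tr_tracelessZero h2 hυ ha, polar_S]; ring

/-- Put υ, υ, a, b into the quartic identity: υ♯υ = 0 and υ♯ = −1 on W leave 2 a♯b on the left. -/
lemma sharpMul_traceless {a b : J} (ha : a ∈ A.tracelessZero υ) (hb : b ∈ A.tracelessZero υ) :
    A.sharpMul a b = QuadraticMap.polar A.S a b • υ := by
  have h := A.sharpMul_sharpMul_sharpMul υ υ a b
  rw [hυ.sharpMul_self, (mem_tracelessZero h2 hυ).1 ha, (mem_tracelessZero h2 hυ).1 hb,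
    A.sharpMul_comm (-b)] at h
  simp only [map_neg, map_zero, LinearMap.neg_apply, LinearMap.zero_apply, neg_neg,
    T_traceless h2 hυ ha] at h
  have h' : (2 : k) • (A.sharpMul a b - QuadraticMap.polar A.S a b • υ) = 0 := by
    linear_combination (norm := module) h
  exact sub_eq_zero.1 ((smul_eq_zero.1 h').resolve_left h2)

lemma sharp_traceless {a : J} (ha : a ∈ A.tracelessZero υ) : A.sharp a = A.S a • υ := by
  have h := sharpMul_traceless h2 hυ ha ha
  rw [A.sharpMul_self, QuadraticMap.polar_self] at h
  have h' : (2 : k) • (A.sharp a - A.S a • υ) = 0 := by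
    rw [smul_sub, h]; simp [two_smul, add_smul]
  exact sub_eq_zero.1 ((smul_eq_zero.1 h').resolve_left h2)

lemma sharpMul_compl_traceless {a : J} (ha : a ∈ A.tracelessZero υ) :
    A.sharpMul (A.one - υ) a = 0 := by
  rw [sharpMul_compl, (mem_tracelessZero h2 hυ).1 ha, tr_tracelessZero h2 hυ ha]; simp

lemma sharpMul_compl_half {x : J} (hx : x ∈ A.peirceHalf υ) :
    A.sharpMul (A.one - υ) x = -x := by
  obtain ⟨h, -, h'⟩ := (mem_peirceHalf h2 hυ).1 hx
  rw [sharpMul_compl, h, h']; simp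

lemma T_traceless_half {a x : J} (ha : a ∈ A.tracelessZero υ) (hx : x ∈ A.peirceHalf υ) :
    A.T a x = 0 := by
  have h := A.T_sharpMul_right υ a x
  rw [((mem_peirceHalf h2 hυ).1 hx).1, (mem_tracelessZero h2 hυ).1 ha] at h
  simpa using h

lemma T_compl_half {x : J} (hx : x ∈ A.peirceHalf υ) : A.T (A.one - υ) x = 0 := by
  obtain ⟨h, h', h''⟩ := (mem_peirceHalf h2 hυ).1 hx
  rw [T_compl, h', h'', sub_zero]

lemma T_compl_traceless {a : J} (ha : a ∈ A.tracelessZero υ) : A.T (A.one - υ) a = 0 := by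
  rw [T_compl, tr_tracelessZero h2 hυ ha, T_idem_tracelessZero h2 hυ ha, sub_zero]

lemma sharpMul_mem_half {a x : J} (ha : a ∈ A.tracelessZero υ) (hx : x ∈ A.peirceHalf υ) :
    A.sharpMul a x ∈ A.peirceHalf υ := by
  obtain ⟨h, h', h''⟩ := (mem_peirceHalf h2 hυ).1 hx
  have ha' := (mem_tracelessZero h2 hυ).1 ha
  have hT := tr_tracelessZero h2 hυ ha
  have hS : A.tr (A.sharpMul a x) = 0 := by
    have := A.T_eq a x
    rw [T_traceless_half h2 hυ ha hx, hT] at this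
    linear_combination this
  have hυa : A.T υ (A.sharpMul a x) = 0 := by
    rw [← T_sharpMul_right, A.sharpMul_comm a, ha', map_neg, LinearMap.neg_apply,
      T_traceless_half h2 hυ ha hx, neg_zero]
  refine (mem_peirceHalf h2 hυ).2 ⟨?_, hυa, hS⟩
  have := A.sharpMul_cyclic υ a x
  rw [ha', h, A.sharpMul_comm _ υ, h'', hT, hS, hυ.tr_eq h2] at this
  simp only [map_neg, map_zero, LinearMap.neg_apply, LinearMap.zero_apply, hT,
    T_traceless_half h2 hυ ha hx] at this
  linear_combination (norm := module) this

/-- In `sharpMul_cyclic` every trace except tr(a♯b) = S(a,b) vanishes, and a♯b is a multiple of υ,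
which kills x. -/
lemma clifford {a b x : J} (ha : a ∈ A.tracelessZero υ) (hb : b ∈ A.tracelessZero υ)
    (hx : x ∈ A.peirceHalf υ) :
    A.sharpMul a (A.sharpMul b x) + A.sharpMul b (A.sharpMul a x) =
      -(QuadraticMap.polar A.S a b) • x := by
  obtain ⟨h, h', h''⟩ := (mem_peirceHalf h2 hυ).1 hx
  obtain ⟨-, -, h4⟩ := (mem_peirceHalf h2 hυ).1 (sharpMul_mem_half h2 hυ ha hx)
  obtain ⟨-, -, h5⟩ := (mem_peirceHalf h2 hυ).1 (sharpMul_mem_half h2 hυ hb hx)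
  have := A.sharpMul_cyclic a b x
  rw [A.sharpMul_comm (A.sharpMul a x) b, A.sharpMul_comm (A.sharpMul b x) a, h4, h5, h'', tr_tracelessZero h2 hυ ha,
    tr_tracelessZero h2 hυ hb, ← polar_S, sharpMul_traceless h2 hυ ha hb] at this
  simp only [map_smul, LinearMap.smul_apply, h, h'] at this
  linear_combination (norm := module) this

lemma clifford_sq {a x : J} (ha : a ∈ A.tracelessZero υ) (hx : x ∈ A.peirceHalf υ) :
    A.sharpMul a (A.sharpMul a x) = -A.S a • x := by
  have h := clifford h2 hυ ha ha hx
  rw [QuadraticMap.polar_self] at h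
  have h' : (2 : k) • (A.sharpMul a (A.sharpMul a x) + A.S a • x) = 0 := by
    rw [← sub_eq_zero] at h; rw [← h]
    simp only [two_smul]; module
  rw [neg_smul]
  exact eq_neg_of_add_eq_zero_left ((smul_eq_zero.1 h').resolve_left h2)

lemma tr_sharpMul_half {x y : J} (hx : x ∈ A.peirceHalf υ) :
    A.tr (A.sharpMul x y) = -A.T x y := by
  rw [T_eq, ((mem_peirceHalf h2 hυ).1 hx).2.2]; ring

lemma sharpMul_half_mem {x y : J} (hx : x ∈ A.peirceHalf υ) (hy : y ∈ A.peirceHalf υ) :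
    A.sharpMul x y ∈ A.peirceZero υ := by
  obtain ⟨h, h', h''⟩ := (mem_peirceHalf h2 hυ).1 hx
  obtain ⟨h3, h4, h5⟩ := (mem_peirceHalf h2 hυ).1 hy
  rw [mem_peirceZero h2 hυ]
  have := A.sharpMul_cyclic υ x y
  rw [h, h3, A.sharpMul_comm _ υ, h'', h5, hυ.tr_eq h2] at this
  simp only [map_zero, LinearMap.zero_apply] at this
  linear_combination (norm := module) this

lemma sharp_half_mem {x : J} (hx : x ∈ A.peirceHalf υ) : A.sharp x ∈ A.peirceZero υ := by
  have h := sharpMul_half_mem h2 hυ hx hx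
  rw [A.sharpMul_self] at h
  exact (Submodule.smul_mem_iff _ h2).1 h

lemma T_idem_peirceZero {p : J} (hp : p ∈ A.peirceZero υ) : A.T υ p = 0 := by
  rw [peirceZero_eq h2 hυ] at hp
  obtain ⟨e, he, w, hw, rfl⟩ := Submodule.mem_sup.1 hp
  obtain ⟨b, rfl⟩ := Submodule.mem_span_singleton.1 he
  rw [map_add, map_smul, T_idem_compl h2 hυ, T_idem_tracelessZero h2 hυ hw]; simp

lemma T_peirceZero_half {p x : J} (hp : p ∈ A.peirceZero υ) (hx : x ∈ A.peirceHalf υ) :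
    A.T p x = 0 := by
  rw [peirceZero_eq h2 hυ] at hp
  obtain ⟨e, he, w, hw, rfl⟩ := Submodule.mem_sup.1 hp
  obtain ⟨b, rfl⟩ := Submodule.mem_span_singleton.1 he
  simp [-map_sub, T_compl_half h2 hυ hx, T_traceless_half h2 hυ hw hx]

/-- The Peirce pieces are T-orthogonal, so nondegeneracy restricts to each of them. -/
lemma eq_zero_of_mem_half (hA : A.IsNondegenerate) {x : J} (hx : x ∈ A.peirceHalf υ)
    (h : ∀ y ∈ A.peirceHalf υ, A.T x y = 0) : x = 0 := by
  apply hA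
  intro y
  obtain ⟨a, b, w, hw, z, hz, rfl⟩ := exists_peirce h2 hυ y
  simp only [map_add, map_smul, h z hz, A.T_comm x w, T_traceless_half h2 hυ hw hx,
    A.T_comm x (A.one - υ), T_compl_half h2 hυ hx, A.T_comm x υ,
    ((mem_peirceHalf h2 hυ).1 hx).2.1, smul_zero, add_zero]

lemma eq_zero_of_mem_zero (hA : A.IsNondegenerate) {p : J} (hp : p ∈ A.peirceZero υ)
    (he : A.T p (A.one - υ) = 0) (h : ∀ y ∈ A.tracelessZero υ, A.T p y = 0) : p = 0 := by
  apply hA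
  intro y
  obtain ⟨a, b, w, hw, z, hz, rfl⟩ := exists_peirce h2 hυ y
  simp only [map_add, map_smul, h w hw, he, A.T_comm p υ, T_idem_peirceZero h2 hυ hp,
    T_peirceZero_half h2 hυ hp hz, smul_zero, add_zero]

lemma eq_zero_of_mem_traceless (hA : A.IsNondegenerate) {a : J} (ha : a ∈ A.tracelessZero υ)
    (h : ∀ b ∈ A.tracelessZero υ, QuadraticMap.polar A.S a b = 0) : a = 0 := by
  apply eq_zero_of_mem_zero h2 hυ hA ha.1
  · rw [A.T_comm, T_compl_traceless h2 hυ ha]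
  · intro b hb; rw [T_traceless h2 hυ ha, h b hb, neg_zero]

end PeirceProducts
end CubicJordanAlgebra

namespace CubicJordanAlgebra

variable {k J : Type*} [Field k] [AddCommGroup J] [Module k J]

/-! ### Dimensions of the Peirce pieces -/

section Dimension

/-- The elements of `J_{1/2}` which are fixed by the `♯`-product with `a`. -/
noncomputable def halfFixed (A : CubicJordanAlgebra k J) (υ a : J) : Submodule k J :=
  A.peirceHalf υ ⊓ LinearMap.ker (A.sharpMul a - LinearMap.id)

/-- The traceless elements of `J_0` which are orthogonal to `a`. -/
noncomputable def tracelessPerp (A : CubicJordanAlgebra k J) (υ a : J) : Submodule k J :=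
  A.tracelessZero υ ⊓ LinearMap.ker (A.T a)

variable {A : CubicJordanAlgebra k J} {υ : J}

lemma mem_halfFixed {a x : J} :
    x ∈ A.halfFixed υ a ↔ x ∈ A.peirceHalf υ ∧ A.sharpMul a x = x := by
  simp [halfFixed, sub_eq_zero]

lemma mem_halfFixed_neg {a x : J} :
    x ∈ A.halfFixed υ (-a) ↔ x ∈ A.peirceHalf υ ∧ A.sharpMul a x = -x := by
  rw [mem_halfFixed, map_neg, LinearMap.neg_apply, neg_eq_iff_eq_neg]

lemma finrank_le_of_leftInv [FiniteDimensional k J] (f : J →ₗ[k] J) {p q : Submodule k J}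
    (g : J →ₗ[k] J) {c : k} (hc : c ≠ 0) (hf : ∀ x ∈ p, f x ∈ q) (hg : ∀ x ∈ p, g (f x) = c • x) :
    Module.finrank k p ≤ Module.finrank k q := by
  refine LinearMap.finrank_le_finrank_of_injective (f := f.restrict hf) ?_
  rw [← LinearMap.ker_eq_bot, LinearMap.ker_eq_bot']
  rintro ⟨x, hx⟩ h
  have h' : f x = 0 := congrArg Subtype.val h
  have := hg x hx
  rw [h', map_zero] at this
  exact Subtype.ext ((smul_eq_zero.1 this.symm).resolve_left hc)

variable (h2 : (2 : k) ≠ 0) (hυ : A.IsPrimitiveIdempotent υ)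

include h2 in
lemma exists_T_self_ne_zero {p : Submodule k J} {x y : J} (hx : x ∈ p) (hy : y ∈ p)
    (h : A.T x y ≠ 0) : ∃ z ∈ p, A.T z z ≠ 0 := by
  by_contra! H
  have h1 := H (x + y) (p.add_mem hx hy)
  simp only [map_add, LinearMap.add_apply, H x hx, H y hy, A.T_comm y x] at h1
  have h3 : 2 * A.T x y = 0 := by linear_combination h1
  exact h ((mul_eq_zero.1 h3).resolve_left h2)

lemma IsSimple.jmul_not_mem_span (hsimple : A.IsSimple) (hdim : 1 < Module.finrank k J) {x : J}
    (hx : x ≠ 0) (h : ∀ y, A.jmul x y ∈ Submodule.span k {x}) : False := by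
  have hI : ∀ z ∈ Submodule.span k {x}, ∀ y, A.jmul z y ∈ Submodule.span k {x} := by
    intro z hz y
    obtain ⟨c, rfl⟩ := Submodule.mem_span_singleton.1 hz
    have : A.jmul (c • x) y = c • A.jmul x y := by
      simp only [jmul_apply, map_smul, LinearMap.smul_apply, smul_eq_mul]; module
    rw [this]
    exact Submodule.smul_mem _ _ (h y)
  rcases hsimple.2 (Submodule.span k {x}) hI with h1 | h1
  · exact hx (Submodule.span_singleton_eq_bot.1 h1)
  · have h3 := finrank_span_singleton (K := k) hx
    rw [h1, finrank_top] at h3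
    omega

include h2

lemma T_sharp_left (a x : J) : A.T (A.sharp x) a = 2⁻¹ * A.T (A.sharpMul a x) x := by
  have h := A.T_sharpMul_rotate x x a
  rw [A.sharpMul_self, map_smul, LinearMap.smul_apply, smul_eq_mul, A.sharpMul_comm x a] at h
  rw [← h]; field_simp

lemma T_halfFixed {a x y : J} (hx : x ∈ A.halfFixed υ a) (hy : y ∈ A.halfFixed υ (-a)) :
    A.T x y = 0 := by
  have h := A.T_sharpMul_right a x y
  rw [(mem_halfFixed.1 hx).2, (mem_halfFixed_neg.1 hy).2, map_neg] at h
  have h3 : 2 * A.T x y = 0 := by linear_combination h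
  exact (mul_eq_zero.1 h3).resolve_left h2

include hυ

/-- Otherwise υ spans an ideal. -/
lemma peirceHalf_ne_bot (hdim : 1 < Module.finrank k J) (hsimple : A.IsSimple) :
    A.peirceHalf υ ≠ ⊥ := by
  intro h
  refine hsimple.jmul_not_mem_span hdim hυ.1 fun y => ?_
  obtain ⟨a, b, w, hw, z, hz, rfl⟩ := exists_peirce h2 hυ y
  rw [h, Submodule.mem_bot] at hz
  refine Submodule.mem_span_singleton.2 ⟨a, ?_⟩
  rw [hz, jmul_apply]
  simp only [map_add, map_smul, hυ.sharpMul_self, sharpMul_idem_compl h2 hυ,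
    (mem_tracelessZero h2 hυ).1 hw, tr_tracelessZero h2 hυ hw, hυ.tr_eq h2, tr_compl h2 hυ,
    map_neg, smul_eq_mul, map_zero]
  match_scalars <;> field_simp <;> ring

/-- Here x♯ = b(1 − υ), so x♯♯ = b²υ must equal N(x)x in H. Hence b = 0 and T(x,x) = −2T(x♯, 1 − υ)
= 0 throughout H, against nondegeneracy unless H = 0. -/
lemma eq_zero_of_tracelessZero_eq_bot (hA : A.IsNondegenerate) (h : A.tracelessZero υ = ⊥) {x : J}
    (hx : x ∈ A.peirceHalf υ) : x = 0 := by
  have h0 : ∀ x ∈ A.peirceHalf υ, A.T x x = 0 := by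
    intro x hx
    have h1 := sharp_half_mem h2 hυ hx
    rw [peirceZero_eq h2 hυ, h, sup_bot_eq] at h1
    obtain ⟨b, hb⟩ := Submodule.mem_span_singleton.1 h1
    have h3 := congrArg (A.T υ) (A.sharp_sharp' x)
    rw [← hb, sharp_smul, sharp_compl h2 hυ, map_smul, map_smul, T_idem_self h2 hυ,
      ((mem_peirceHalf h2 hυ).1 hx).2.1] at h3
    have h4 : b = 0 := by simpa using h3
    have h5 := T_sharp_left h2 (A := A) (A.one - υ) x
    rw [← hb, h4, sharpMul_compl_half h2 hυ hx, zero_smul, map_zero, LinearMap.zero_apply] at h5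
    simpa [h2] using h5
  apply eq_zero_of_mem_half h2 hυ hA hx
  intro y hy
  by_contra h6
  obtain ⟨z, hz, hz'⟩ := exists_T_self_ne_zero h2 hx hy h6
  exact hz' (h0 z hz)

section Involution

variable {a : J} (ha : a ∈ A.tracelessZero υ) (hS : A.S a = -1)
include ha hS

lemma T_self_involution : A.T a a = 2 := by
  rw [T_traceless h2 hυ ha, QuadraticMap.polar_self, hS]; simp

lemma sharpMul_involution {x : J} (hx : x ∈ A.peirceHalf υ) :
    A.sharpMul a (A.sharpMul a x) = x := by
  rw [clifford_sq h2 hυ ha hx, hS]; simp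

lemma exists_halfFixed {x : J} (hx : x ∈ A.peirceHalf υ) :
    ∃ y ∈ A.halfFixed υ a, ∃ z ∈ A.halfFixed υ (-a), x = y + z := by
  have hax := sharpMul_mem_half h2 hυ ha hx
  refine ⟨(2 : k)⁻¹ • (x + A.sharpMul a x), ?_, (2 : k)⁻¹ • (x - A.sharpMul a x), ?_, ?_⟩
  · rw [mem_halfFixed, map_smul, map_add, sharpMul_involution h2 hυ ha hS hx, add_comm x]
    exact ⟨Submodule.smul_mem _ _ (add_mem hax hx), rfl⟩
  · rw [mem_halfFixed_neg, map_smul, map_sub, sharpMul_involution h2 hυ ha hS hx]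
    exact ⟨Submodule.smul_mem _ _ (sub_mem hx hax), by module⟩
  · match_scalars <;> field_simp <;> ring

lemma exists_tracelessPerp {w : J} (hw : w ∈ A.tracelessZero υ) :
    ∃ c : k, ∃ b ∈ A.tracelessPerp υ a, w = c • a + b := by
  refine ⟨A.T a w / 2, w - (A.T a w / 2) • a, ⟨sub_mem hw (Submodule.smul_mem _ _ ha), ?_⟩,
    by abel⟩
  rw [SetLike.mem_coe, LinearMap.mem_ker, map_sub, map_smul, T_self_involution h2 hυ ha hS, smul_eq_mul]
  field_simp; ring

lemma finrank_peirceHalf_eq [FiniteDimensional k J] : Module.finrank k (A.peirceHalf υ) =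
    Module.finrank k (A.halfFixed υ a) + Module.finrank k (A.halfFixed υ (-a)) := by
  have h := Submodule.finrank_sup_add_finrank_inf_eq (A.halfFixed υ a) (A.halfFixed υ (-a))
  have h1 : A.halfFixed υ a ⊔ A.halfFixed υ (-a) = A.peirceHalf υ := by
    apply le_antisymm (sup_le inf_le_left inf_le_left)
    intro x hx
    obtain ⟨y, hy, z, hz, rfl⟩ := exists_halfFixed h2 hυ ha hS hx
    exact Submodule.add_mem_sup hy hz
  have h3 : A.halfFixed υ a ⊓ A.halfFixed υ (-a) = ⊥ := by
    rw [eq_bot_iff]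
    rintro x ⟨hx, hx'⟩
    have h4 := (mem_halfFixed_neg.1 hx').2
    rw [(mem_halfFixed.1 hx).2] at h4
    have h5 : (2 : k) • x = 0 := by rw [two_smul]; nth_rw 1 [h4]; simp
    exact (smul_eq_zero.1 h5).resolve_left h2
  rw [h1, h3, finrank_bot] at h
  omega

lemma finrank_tracelessZero_eq [FiniteDimensional k J] : Module.finrank k (A.tracelessZero υ) =
    1 + Module.finrank k (A.tracelessPerp υ a) := by
  have h := Submodule.finrank_sup_add_finrank_inf_eq (Submodule.span k {a}) (A.tracelessPerp υ a)
  have h1 : Submodule.span k {a} ⊔ A.tracelessPerp υ a = A.tracelessZero υ := by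
    apply le_antisymm (sup_le ((Submodule.span_singleton_le_iff_mem _ _).2 ha) inf_le_left)
    intro x hx
    obtain ⟨c, z, hz, rfl⟩ := exists_tracelessPerp h2 hυ ha hS hx
    exact Submodule.add_mem_sup (Submodule.smul_mem _ _ (Submodule.mem_span_singleton_self _)) hz
  have h3 : Submodule.span k {a} ⊓ A.tracelessPerp υ a = ⊥ := by
    rw [eq_bot_iff]
    rintro x ⟨hx, hx'⟩
    obtain ⟨c, rfl⟩ := Submodule.mem_span_singleton.1 hx
    have h4 := LinearMap.mem_ker.1 hx'.2
    rw [map_smul, T_self_involution h2 hυ ha hS, smul_eq_mul] at h4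
    simp [(mul_eq_zero.1 h4).resolve_right h2]
  have ha0 : a ≠ 0 := by
    rintro rfl
    simp at hS
  rw [h1, h3, finrank_bot, finrank_span_singleton ha0] at h
  omega

omit hS in
lemma sharpMul_mem_halfFixed_neg {b x : J} (hb : b ∈ A.tracelessPerp υ a)
    (hx : x ∈ A.halfFixed υ a) : A.sharpMul b x ∈ A.halfFixed υ (-a) := by
  obtain ⟨hx1, hx2⟩ := mem_halfFixed.1 hx
  refine mem_halfFixed_neg.2 ⟨sharpMul_mem_half h2 hυ hb.1 hx1, ?_⟩
  have h := clifford h2 hυ ha hb.1 hx1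
  rw [← T_traceless h2 hυ ha, LinearMap.mem_ker.1 hb.2, hx2, zero_smul] at h
  exact eq_neg_of_add_eq_zero_left h

/-- Test both sides against 1 − υ, a and a^⊥, using T(x♯,p) = ½T(p♯x,x). Elements of a^⊥ anticommute
with a and send x into the opposite eigenspace, which is orthogonal to x. -/
lemma sharp_halfFixed (hA : A.IsNondegenerate) {x : J} (hx : x ∈ A.halfFixed υ a) :
    A.sharp x = (A.T x x / 4) • (a - (A.one - υ)) := by
  obtain ⟨hx1, hx2⟩ := mem_halfFixed.1 hx
  have he := compl_mem_peirceZero h2 hυ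
  have hex := sharpMul_compl_half h2 hυ hx1
  have hea := T_compl_traceless h2 hυ ha
  have hee := T_compl_self h2 hυ
  have heb := fun b hb => T_compl_traceless h2 hυ (a := b) hb
  rw [← sub_eq_zero]
  apply eq_zero_of_mem_zero h2 hυ hA
  · exact sub_mem (sharp_half_mem h2 hυ hx1) (Submodule.smul_mem _ _ (sub_mem ha.1 he))
  · generalize A.one - υ = e at *
    simp only [map_sub, LinearMap.sub_apply, map_smul, LinearMap.smul_apply, A.T_comm a, hea, hee,
      T_sharp_left h2, hex, map_neg, LinearMap.neg_apply, smul_eq_mul,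
      show (4 : k) = 2 * 2 by norm_num]
    field_simp; ring
  · intro w hw
    obtain ⟨c, b, hb, rfl⟩ := exists_tracelessPerp h2 hυ ha hS hw
    have hbx := sharpMul_mem_halfFixed_neg h2 hυ ha hb hx
    have heb := heb b hb.1
    have hab : A.T a b = 0 := hb.2
    have hxbx := T_halfFixed h2 hx hbx
    have haa := T_self_involution h2 hυ ha hS
    generalize A.one - υ = e at *
    simp only [map_add, map_sub, map_smul, LinearMap.sub_apply, LinearMap.smul_apply,
      T_sharp_left h2, hx2, haa, hab, heb, hea, A.T_comm _ x, hxbx, smul_eq_mul,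
      show (4 : k) = 2 * 2 by norm_num]
    field_simp; ring

/-- By `sharp_halfFixed`, x♯ is a multiple of a − (1 − υ). The last two hypotheses say that this
element annihilates z under both ♯ and T, so only the scalar term of `sharpMul_cyclic` survives.
They hold on the opposite eigenspace and on a^⊥ alike. -/
lemma sharpMul_sharpMul_halfFixed (hA : A.IsNondegenerate) {x z : J}
    (hx : x ∈ A.halfFixed υ a) (hz : A.tr z = 0) (hxz : A.T x z = 0)
    (haz : A.sharpMul a z = A.sharpMul (A.one - υ) z)
    (hez' : A.T a z = A.T (A.one - υ) z) :
    A.sharpMul x (A.sharpMul x z) = (A.T x x / 2) • z := by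
  obtain ⟨hx1, hx2⟩ := mem_halfFixed.1 hx
  have htr := tr_sharpMul_half h2 hυ (y := z) hx1
  have htr' := tr_sharpMul_half h2 hυ (y := x) hx1
  have h := A.sharpMul_cyclic x x z
  rw [htr, htr', hz, ((mem_peirceHalf h2 hυ).1 hx1).2.2, hxz,
    A.sharpMul_comm (A.sharpMul x z) x,
    A.sharpMul_self, sharp_halfFixed h2 hυ ha hS hA hx] at h
  generalize A.one - υ = e at *
  simp only [map_smul, map_sub, LinearMap.smul_apply, LinearMap.sub_apply, haz, hez', sub_self,
    smul_zero] at h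
  have h' : (2 : k) • (A.sharpMul x (A.sharpMul x z) - (A.T x x / 2) • z) = 0 := by
    have : (2 : k) • (A.T x x / 2) • z = A.T x x • z := by rw [smul_smul]; field_simp
    rw [smul_sub, this]
    linear_combination (norm := module) h
  exact sub_eq_zero.1 ((smul_eq_zero.1 h').resolve_left h2)

/-- The operator x♯ maps each of the two spaces into the other, and its square is the nonzero scalar
T(x,x)/2. -/
lemma finrank_halfFixed_neg [FiniteDimensional k J] (hA : A.IsNondegenerate) {x : J}
    (hx : x ∈ A.halfFixed υ a) (hT : A.T x x ≠ 0) :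
    Module.finrank k (A.halfFixed υ (-a)) = Module.finrank k (A.tracelessPerp υ a) := by
  obtain ⟨hx1, hx2⟩ := mem_halfFixed.1 hx
  have hc : A.T x x / 2 ≠ 0 := div_ne_zero hT h2
  apply le_antisymm
  · refine finrank_le_of_leftInv (A.sharpMul x) (A.sharpMul x) hc (fun y hy => ?_) fun y hy => ?_
    · have h0 := T_halfFixed h2 hx hy
      refine ⟨⟨sharpMul_half_mem h2 hυ hx1 hy.1, ?_⟩, ?_⟩
      · rw [SetLike.mem_coe, perp, LinearMap.mem_ker, LinearMap.flip_apply, A.T_comm,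
          ← T_sharpMul_right, A.sharpMul_comm, sharpMul_compl_half h2 hυ hx1]
        rw [map_neg, LinearMap.neg_apply, h0, neg_zero]
      · have h3 := A.T_sharpMul_right x a y
        rw [A.sharpMul_comm x a, hx2, h0] at h3
        exact h3.symm
    · obtain ⟨hy1, hy2⟩ := mem_halfFixed_neg.1 hy
      have h0 := T_halfFixed h2 hx hy
      refine sharpMul_sharpMul_halfFixed h2 hυ ha hS hA hx ((mem_peirceHalf h2 hυ).1 hy1).2.2 h0
        ?_ ?_
      · rw [hy2, sharpMul_compl_half h2 hυ hy1]
      · rw [T_traceless_half h2 hυ ha hy1, T_compl_half h2 hυ hy1]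
  · refine finrank_le_of_leftInv (A.sharpMul x) (A.sharpMul x) hc (fun b hb => ?_) fun b hb => ?_
    · rw [A.sharpMul_comm]
      exact sharpMul_mem_halfFixed_neg h2 hυ ha hb hx
    · have hab : A.T a b = 0 := hb.2
      have hab' : A.sharpMul a b = 0 := by
        rw [sharpMul_traceless h2 hυ ha hb.1, ← neg_neg (QuadraticMap.polar _ _ _),
          ← T_traceless h2 hυ ha, hab]; simp
      refine sharpMul_sharpMul_halfFixed h2 hυ ha hS hA hx (tr_tracelessZero h2 hυ hb.1) ?_
        ?_ ?_
      · rw [A.T_comm, T_traceless_half h2 hυ hb.1 hx1]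
      · rw [hab', sharpMul_compl_traceless h2 hυ hb.1]
      · rw [hab, T_compl_traceless h2 hυ hb.1]

/-- If `a` acts on `J_{1/2}` as the identity, then `1 - υ - a` spans an ideal. -/
lemma halfFixed_neg_ne_bot (hA : A.IsNondegenerate) (hsimple : A.IsSimple)
    (hdim : 1 < Module.finrank k J) : A.halfFixed υ (-a) ≠ ⊥ := by
  intro h
  have hfix : ∀ x ∈ A.peirceHalf υ, A.sharpMul a x = x := by
    intro x hx
    obtain ⟨y, hy, z, hz, rfl⟩ := exists_halfFixed h2 hυ ha hS hx
    rw [h, Submodule.mem_bot] at hz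
    rw [hz, add_zero, (mem_halfFixed.1 hy).2]
  obtain ⟨x, hx, hx0⟩ := Submodule.exists_mem_ne_zero_of_ne_bot
    (peirceHalf_ne_bot h2 hυ hdim hsimple)
  -- An element of a^⊥ interchanges the eigenspaces of a, hence kills H. By the Clifford relation it
  -- is then in the radical of S on W.
  have hperp : ∀ b ∈ A.tracelessPerp υ a, b = 0 := by
    intro b hb
    have hkill : ∀ x ∈ A.peirceHalf υ, A.sharpMul b x = 0 := by
      intro x hx
      have h3 := sharpMul_mem_halfFixed_neg h2 hυ ha hb (mem_halfFixed.2 ⟨hx, hfix x hx⟩)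
      rwa [h, Submodule.mem_bot] at h3
    apply eq_zero_of_mem_traceless h2 hυ hA hb.1
    intro w hw
    have h3 := clifford h2 hυ hb.1 hw hx
    rw [hkill x hx, hkill _ (sharpMul_mem_half h2 hυ hw hx), map_zero, add_zero] at h3
    simpa [hx0] using h3.symm
  have hne : A.one - υ - a ≠ 0 := by
    intro h3
    have h4 := T_compl_self h2 hυ
    have h5 := T_compl_traceless h2 hυ ha
    rw [← sub_eq_zero.1 h3, h4] at h5
    exact h2 h5
  refine hsimple.jmul_not_mem_span hdim hne fun y => ?_
  obtain ⟨u, b, w, hw, z, hz, rfl⟩ := exists_peirce h2 hυ y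
  obtain ⟨c, d, hd, rfl⟩ := exists_tracelessPerp h2 hυ ha hS hw
  have hυa : A.sharpMul a υ = -a := by
    rw [A.sharpMul_comm, (mem_tracelessZero h2 hυ).1 ha]
  have haa : A.sharpMul a a = (-2 : k) • υ := by
    rw [A.sharpMul_self, sharp_traceless h2 hυ ha, hS]; module
  have hea := sharpMul_compl_traceless h2 hυ ha
  have hae : A.sharpMul a (A.one - υ) = 0 := by rw [A.sharpMul_comm, hea]
  have heυ : A.sharpMul (A.one - υ) υ = A.one - υ := by
    rw [A.sharpMul_comm, sharpMul_idem_compl h2 hυ]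
  have hee : A.sharpMul (A.one - υ) (A.one - υ) = (2 : k) • υ := by
    rw [A.sharpMul_self, sharp_compl h2 hυ]
  have hez := sharpMul_compl_half h2 hυ hz
  have haz := hfix z hz
  have htz := ((mem_peirceHalf h2 hυ).1 hz).2.2
  have hte := tr_compl h2 hυ
  have hta := tr_tracelessZero h2 hυ ha
  have htυ := hυ.tr_eq h2
  have h1 : A.one = (A.one - υ) + υ := by abel
  rw [hperp d hd, jmul_apply]
  generalize A.one - υ = e at *
  -- Under the Jordan product 1 − υ − a annihilates υ and H, is fixed by 1 − υ and is negated by a.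
  refine Submodule.mem_span_singleton.2 ⟨b - c, ?_⟩
  simp only [map_add, map_sub, map_smul, map_neg, LinearMap.sub_apply, hυa, haa, hea, hae, heυ,
    hee, hez, haz, htz, hte, hta, htυ, h1, map_zero, add_zero, smul_eq_mul]
  match_scalars <;> field_simp <;> ring

end Involution

variable [IsAlgClosed k]

lemma exists_involution (hA : A.IsNondegenerate) (h : A.tracelessZero υ ≠ ⊥) :
    ∃ a ∈ A.tracelessZero υ, A.S a = -1 := by
  obtain ⟨w, hw, hw0⟩ := Submodule.exists_mem_ne_zero_of_ne_bot h
  have h3 : ∃ y ∈ A.tracelessZero υ, A.T w y ≠ 0 := by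
    by_contra! h3
    apply hw0
    apply eq_zero_of_mem_traceless h2 hυ hA hw
    intro b hb
    rw [← neg_eq_zero, ← T_traceless h2 hυ hw, h3 b hb]
  obtain ⟨y, hy, hwy⟩ := h3
  obtain ⟨z, hz, hzz⟩ := exists_T_self_ne_zero h2 hw hy hwy
  have hS : A.S z ≠ 0 := by
    intro h4
    rw [T_traceless h2 hυ hz, QuadraticMap.polar_self, h4] at hzz
    simp at hzz
  obtain ⟨c, hc⟩ := IsAlgClosed.exists_eq_mul_self (-(A.S z)⁻¹)
  refine ⟨c • z, Submodule.smul_mem _ _ hz, ?_⟩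
  rw [QuadraticMap.map_smul, ← hc, smul_eq_mul]
  field_simp

omit [IsAlgClosed k] in
lemma finrank_eq_add [FiniteDimensional k J] : Module.finrank k J =
    2 + Module.finrank k (A.tracelessZero υ) + Module.finrank k (A.peirceHalf υ) := by
  let f : (k × k) × (A.tracelessZero υ × A.peirceHalf υ) →ₗ[k] J :=
    ((LinearMap.toSpanSingleton k J υ).coprod (LinearMap.toSpanSingleton k J (A.one - υ))).coprod
      ((A.tracelessZero υ).subtype.coprod (A.peirceHalf υ).subtype)
  have hf : Function.Bijective f := by
    constructor
    · rw [← LinearMap.ker_eq_bot, LinearMap.ker_eq_bot']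
      rintro ⟨⟨a, b⟩, ⟨w, hw⟩, ⟨x, hx⟩⟩ h
      have h0 : a • υ + b • (A.one - υ) + (w + x) = 0 := by simpa [f] using h
      have ha : a = 0 := by
        have h3 := congrArg (A.T υ) h0
        simp only [map_add, map_smul, T_idem_self h2 hυ, T_idem_compl h2 hυ,
          T_idem_tracelessZero h2 hυ hw, ((mem_peirceHalf h2 hυ).1 hx).2.1, map_zero] at h3
        simpa using h3
      have hb : b = 0 := by
        have h3 := congrArg (A.T (A.one - υ)) h0
        simp only [map_add, map_smul, T_compl_self h2 hυ, A.T_comm (A.one - υ) υ,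
          T_idem_compl h2 hυ, T_compl_traceless h2 hυ hw, T_compl_half h2 hυ hx, map_zero] at h3
        simpa [h2] using h3
      subst ha hb
      have hw0 : w = 0 := by
        have h3 := congrArg (A.sharpMul υ) h0
        simpa [-map_sub, (mem_tracelessZero h2 hυ).1 hw, ((mem_peirceHalf h2 hυ).1 hx).1] using h3
      subst hw0
      simpa using h0
    · intro y
      obtain ⟨a, b, w, hw, z, hz, rfl⟩ := exists_peirce h2 hυ y
      exact ⟨⟨⟨a, b⟩, ⟨w, hw⟩, ⟨z, hz⟩⟩, by simp [f, add_assoc]⟩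
  rw [← (LinearEquiv.ofBijective f hf).finrank_eq]
  simp only [Module.finrank_prod, Module.finrank_self]
  omega

lemma finrank_tracelessZero_and_half (hdim : Module.finrank k J = 9) (hA : A.IsNondegenerate)
    (hsimple : A.IsSimple) :
    Module.finrank k (A.tracelessZero υ) = 3 ∧ Module.finrank k (A.peirceHalf υ) = 4 := by
  have : FiniteDimensional k J := Module.finite_of_finrank_pos (by omega)
  have hW : A.tracelessZero υ ≠ ⊥ := by
    intro h
    apply peirceHalf_ne_bot h2 hυ (by omega) hsimple
    rw [eq_bot_iff]
    intro x hx
    exact eq_zero_of_tracelessZero_eq_bot h2 hυ hA h hx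
  obtain ⟨a, ha, hS⟩ := exists_involution h2 hυ hA hW
  -- The eigenspaces of a are orthogonal, so T is nondegenerate on each. The one for +1 is nonzero
  -- by `halfFixed_neg_ne_bot` for −a, and so contains an anisotropic vector.
  have key : ∀ a ∈ A.tracelessZero υ, A.S a = -1 →
      Module.finrank k (A.halfFixed υ (-a)) = Module.finrank k (A.tracelessPerp υ a) := by
    intro a ha hS
    have ha' := neg_mem ha
    have hS' : A.S (-a) = -1 := by rw [QuadraticMap.map_neg, hS]
    have h := halfFixed_neg_ne_bot h2 hυ ha' hS' hA hsimple (by omega)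
    rw [neg_neg] at h
    obtain ⟨x, hx, hx0⟩ := Submodule.exists_mem_ne_zero_of_ne_bot h
    have h3 : ∃ y ∈ A.halfFixed υ a, A.T x y ≠ 0 := by
      by_contra! h3
      apply hx0
      apply eq_zero_of_mem_half h2 hυ hA hx.1
      intro y hy
      obtain ⟨w, hw, z, hz, rfl⟩ := exists_halfFixed h2 hυ ha hS hy
      rw [map_add, h3 w hw, T_halfFixed h2 hx hz, add_zero]
    obtain ⟨y, hy, hxy⟩ := h3
    obtain ⟨z, hz, hzz⟩ := exists_T_self_ne_zero h2 hx hy hxy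
    exact finrank_halfFixed_neg h2 hυ ha hS hA hz hzz
  have h3 := key a ha hS
  have h4 := key (-a) (neg_mem ha) (by rw [QuadraticMap.map_neg, hS])
  have h5 : A.tracelessPerp υ (-a) = A.tracelessPerp υ a := by
    ext; simp [tracelessPerp]
  rw [neg_neg, h5] at h4
  have h6 := finrank_peirceHalf_eq h2 hυ ha hS
  have h7 := finrank_tracelessZero_eq h2 hυ ha hS
  have h8 := finrank_eq_add h2 hυ
  omega

end Dimension
end CubicJordanAlgebra

namespace CubicJordanAlgebra

variable {k J : Type*} [Field k] [AddCommGroup J] [Module k J]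

/-! ### Good planes: parameters and generic bases -/

section Planes

variable {A : CubicJordanAlgebra k J} {υ : J}

namespace IsZeroFrame

variable {π : Fin 4 → J} (hπ : A.IsZeroFrame υ π)
include hπ

lemma span_eq_tracelessZero : Submodule.span k {π 0, π 1, π 3} = A.tracelessZero υ := by
  rw [hπ.span_eq, hπ.pi3, tracelessZero]

lemma mem_zero : π 0 ∈ A.tracelessZero υ := by
  rw [← hπ.span_eq_tracelessZero]; exact Submodule.subset_span (by simp)

lemma mem_one : π 1 ∈ A.tracelessZero υ := by
  rw [← hπ.span_eq_tracelessZero]; exact Submodule.subset_span (by simp)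

lemma mem_three : π 3 ∈ A.tracelessZero υ := by
  rw [← hπ.span_eq_tracelessZero]; exact Submodule.subset_span (by simp)

lemma exists_eq {w : J} (hw : w ∈ A.tracelessZero υ) :
    ∃ a b c : k, w = a • π 0 + b • π 1 + c • π 3 := by
  rw [← hπ.span_eq_tracelessZero, Submodule.mem_span_triple] at hw
  obtain ⟨a, b, c, h⟩ := hw
  exact ⟨a, b, c, h.symm⟩

lemma eq_zero_of_polar (h2 : (2 : k) ≠ 0) (hυ : A.IsPrimitiveIdempotent υ) (hA : A.IsNondegenerate)
    {w : J} (hw : w ∈ A.tracelessZero υ) (h0 : QuadraticMap.polar A.S w (π 0) = 0)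
    (h1 : QuadraticMap.polar A.S w (π 1) = 0) (h3 : QuadraticMap.polar A.S w (π 3) = 0) :
    w = 0 := by
  apply eq_zero_of_mem_traceless h2 hυ hA hw
  intro b hb
  obtain ⟨p, q, r, rfl⟩ := hπ.exists_eq hb
  simp only [QuadraticMap.polar_add_right, QuadraticMap.polar_smul_right, h0, h1, h3, smul_zero,
    add_zero]

lemma eq_zero_of_smul_add_smul {p q : k} (h : p • π 1 + q • π 3 = 0) : p = 0 ∧ q = 0 := by
  have h1 := Fintype.linearIndependent_iff.1 hπ.linearIndependent ![0, p, q]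
    (by simpa [Fin.sum_univ_three] using h)
  exact ⟨by simpa using h1 1, by simpa using h1 2⟩

end IsZeroFrame

lemma exists_eval_ne_zero [Infinite k] {ι : Type*} (s : Finset ι) (p : ι → Polynomial k)
    (hp : ∀ i ∈ s, p i ≠ 0) : ∃ t : k, ∀ i ∈ s, (p i).eval t ≠ 0 := by
  by_contra! h
  apply Finset.prod_ne_zero_iff.2 hp
  apply Polynomial.funext
  intro t
  obtain ⟨i, hi, hi'⟩ := h t
  rw [Polynomial.eval_prod, Polynomial.eval_zero]
  exact Finset.prod_eq_zero hi hi'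

/-- Finitely many nonzero polynomials of degree at most `2` have a common non-root. -/
lemma exists_quadratic_ne_zero [Infinite k] {n : ℕ} (a b c : Fin n → k)
    (h : ∀ i, a i ≠ 0 ∨ b i ≠ 0 ∨ c i ≠ 0) : ∃ t : k, ∀ i, a i + b i * t + c i * t ^ 2 ≠ 0 := by
  obtain ⟨t, ht⟩ := exists_eval_ne_zero Finset.univ (fun i => Polynomial.C (a i) +
    Polynomial.C (b i) * Polynomial.X + Polynomial.C (c i) * Polynomial.X ^ 2) fun i _ h0 => by
      have h3 := congrArg (Polynomial.coeff · 0) h0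
      have h4 := congrArg (Polynomial.coeff · 1) h0
      have h5 := congrArg (Polynomial.coeff · 2) h0
      simp [Polynomial.coeff_X, Polynomial.coeff_C, Polynomial.coeff_X_pow] at h3 h4 h5
      rcases h i with h | h | h <;> exact h ‹_›
  exact ⟨t, fun i => by simpa using ht i (Finset.mem_univ i)⟩

variable (h2 : (2 : k) ≠ 0) (hυ : A.IsPrimitiveIdempotent υ)
include h2 hυ

/-- K turns out to be orthogonal to all of H. On K, f♯g♯ = −S(f,g) and f kills K, so
self-adjointness of f makes K totally isotropic. Taking T with v in the Clifford relation for h and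
g then gives 2l·T(g♯u, v) = 0, so K is orthogonal to g♯K too. -/
lemma eq_zero_of_scalar (hA : A.IsNondegenerate) {K : Submodule k J} (hK : K ≤ A.peirceHalf υ)
    {f g h : J} (hf : f ∈ A.tracelessZero υ) (hg : g ∈ A.tracelessZero υ)
    (hh : h ∈ A.tracelessZero υ) (hfK : ∀ v ∈ K, A.sharpMul f v = 0)
    (hfg : QuadraticMap.polar A.S f g ≠ 0) {l : k} (hl : l ≠ 0)
    (hhK : ∀ v ∈ K, A.sharpMul h v = l • v)
    (hH : ∀ x ∈ A.peirceHalf υ, ∃ v ∈ K, ∃ w ∈ K, x = v + A.sharpMul g w) {v : J} (hv : v ∈ K) :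
    v = 0 := by
  have h0 : ∀ v ∈ K, ∀ w ∈ K, A.T v w = 0 := by
    intro v hv w hw
    have h3 := clifford h2 hυ hf hg (hK hv)
    rw [hfK v hv, map_zero, add_zero] at h3
    have h4 := A.T_sharpMul_right f (A.sharpMul g v) w
    rw [h3, hfK w hw, map_zero, map_smul, LinearMap.smul_apply, smul_eq_mul, neg_mul,
      neg_eq_zero] at h4
    exact (mul_eq_zero.1 h4).resolve_left hfg
  apply eq_zero_of_mem_half h2 hυ hA (hK hv)
  intro x hx
  obtain ⟨w, hw, u, hu, rfl⟩ := hH x hx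
  have h3 := A.T_sharpMul_right h (A.sharpMul g u) v
  have h4 := congrArg (A.T · v) (clifford h2 hυ hh hg (hK hu))
  simp only [map_add, map_smul, LinearMap.add_apply, LinearMap.smul_apply, hhK v hv, hhK u hu, h3,
    h0 u hu v hv, smul_eq_mul] at h4
  have h5 : (2 * l) * A.T (A.sharpMul g u) v = 0 := by linear_combination h4
  rw [map_add, h0 v hv w hw, A.T_comm, (mul_eq_zero.1 h5).resolve_left (mul_ne_zero h2 hl),
    add_zero]

/-- A 2×2 matrix with scalar square and nonzero trace is scalar. If a were scalar on V, then b would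
be too by the Clifford relation, and a combination d of a and b would kill V; `eq_zero_of_scalar`
rules this out. -/
lemma trace_eq_zero (hA : A.IsNondegenerate) {a b c : J} (ha : a ∈ A.tracelessZero υ)
    (hb : b ∈ A.tracelessZero υ) (hc : c ∈ A.tracelessZero υ)
    (hpol : ∀ w ∈ A.tracelessZero υ, QuadraticMap.polar A.S w a = 0 →
      QuadraticMap.polar A.S w b = 0 → QuadraticMap.polar A.S w c = 0 → w = 0)
    (hab : ∀ p q : k, p • a + q • b = 0 → q = 0)
    {V : Submodule k J} (hV : V ≤ A.peirceHalf υ)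
    (hbV : ∀ v ∈ V, A.sharpMul b v ∈ V)
    (hH : ∀ x ∈ A.peirceHalf υ, ∃ v ∈ V, ∃ w ∈ V, x = v + A.sharpMul c w)
    {ψ : Fin 2 → J} (hψ : LinearIndependent k ψ) (hspan : Submodule.span k (Set.range ψ) = V)
    {p q r s : k} (h0 : A.sharpMul a (ψ 0) = p • ψ 0 + q • ψ 1)
    (h1 : A.sharpMul a (ψ 1) = r • ψ 0 + s • ψ 1) : p + s = 0 := by
  by_contra hps
  have hψ0 : ψ 0 ∈ V := hspan ▸ Submodule.subset_span ⟨0, rfl⟩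
  have hψ1 : ψ 1 ∈ V := hspan ▸ Submodule.subset_span ⟨1, rfl⟩
  have hind : ∀ p q : k, p • ψ 0 + q • ψ 1 = 0 → p = 0 ∧ q = 0 := by
    have : ψ = ![ψ 0, ψ 1] := by ext i; fin_cases i <;> rfl
    rw [this] at hψ
    exact LinearIndependent.pair_iff.1 hψ
  have e0 := clifford_sq h2 hυ ha (hV hψ0)
  have e1 := clifford_sq h2 hυ ha (hV hψ1)
  rw [h0, map_add, map_smul, map_smul, h0, h1] at e0
  rw [h1, map_add, map_smul, map_smul, h0, h1] at e1
  obtain ⟨e2, e3⟩ := hind (p * p + q * r + A.S a) (q * (p + s)) (by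
    linear_combination (norm := module) e0)
  obtain ⟨e4, e5⟩ := hind (r * (p + s)) (r * q + s * s + A.S a) (by
    linear_combination (norm := module) e1)
  have hq : q = 0 := (mul_eq_zero.1 e3).resolve_right hps
  have hr : r = 0 := (mul_eq_zero.1 e4).resolve_right hps
  subst hq hr
  have e6 : (p + s) * (p - s) = 0 := by linear_combination e2 - e5
  have e7 : s = p := (sub_eq_zero.1 ((mul_eq_zero.1 e6).resolve_left hps)).symm
  subst e7
  have hs : s ≠ 0 := by
    rintro rfl; simp at hps
  have haV : ∀ v ∈ V, A.sharpMul a v = s • v := by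
    intro v hv
    rw [← hspan, Submodule.mem_span_range_iff_exists_fun] at hv
    obtain ⟨x, rfl⟩ := hv
    simp only [Fin.sum_univ_two, map_add, map_smul, h0, h1]
    module
  have hbV' : ∀ v ∈ V, s • A.sharpMul b v = (-QuadraticMap.polar A.S a b / 2) • v := by
    intro v hv
    have h3 := clifford h2 hυ ha hb (hV hv)
    rw [haV v hv, haV _ (hbV v hv), map_smul] at h3
    have h4 : (2 : k) • (s • A.sharpMul b v - (-QuadraticMap.polar A.S a b / 2) • v) = 0 := by
      rw [smul_sub, smul_smul 2 (_ / _), mul_div_cancel₀ _ h2, ← h3]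
      module
    exact sub_eq_zero.1 ((smul_eq_zero.1 h4).resolve_left h2)
  -- Since s·b acts on V as m, the element d kills V. Hence it is S-orthogonal to everything in W
  -- that preserves V, in particular to a and b, so it must pair nontrivially with c.
  set m := -QuadraticMap.polar A.S a b / 2 with hm
  set d := (-m) • a + (s * s) • b with hd
  have hdW : d ∈ A.tracelessZero υ :=
    add_mem (Submodule.smul_mem _ _ ha) (Submodule.smul_mem _ _ hb)
  have hdV : ∀ v ∈ V, A.sharpMul d v = 0 := by
    intro v hv
    simp only [hd, map_add, map_smul, LinearMap.add_apply, LinearMap.smul_apply, mul_smul,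
      hbV' v hv, haV v hv]
    module
  have hψ00 : ψ 0 ≠ 0 := hψ.ne_zero 0
  have hpold : ∀ w ∈ A.tracelessZero υ, (∀ v ∈ V, A.sharpMul w v ∈ V) →
      QuadraticMap.polar A.S d w = 0 := by
    intro w hw hwV
    have h3 := clifford h2 hυ hdW hw (hV hψ0)
    rw [hdV _ hψ0, hdV _ (hwV _ hψ0), map_zero, add_zero] at h3
    simpa [hψ00] using h3.symm
  have hdc : QuadraticMap.polar A.S d c ≠ 0 := by
    intro h3
    have h4 := hpol d hdW (hpold a ha fun v hv => by
      rw [haV v hv]; exact Submodule.smul_mem _ _ hv) (hpold b hb hbV) h3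
    have h5 := hab _ _ h4
    exact hs (by simpa using h5)
  exact hψ00 (eq_zero_of_scalar h2 hυ hA hV hdW hc ha hdV hdc hs haV hH hψ0)

omit h2 hυ in
lemma IsGoodPlane.le {π : Fin 4 → J} {V : Submodule k J} (hV : A.IsGoodPlane υ π V) :
    V ≤ A.peirceHalf υ := by
  rw [← hV.sup_eq]; exact le_sup_left

omit h2 hυ in
lemma IsGoodPlane.exists_eq {π : Fin 4 → J} {V : Submodule k J} (hV : A.IsGoodPlane υ π V) :
    ∀ x ∈ A.peirceHalf υ, ∃ v ∈ V, ∃ w ∈ V, x = v + A.sharpMul (π 0) w := by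
  intro x hx
  rw [← hV.sup_eq] at hx
  obtain ⟨v, hv, y, hy, rfl⟩ := Submodule.mem_sup.1 hx
  obtain ⟨w, hw, rfl⟩ := hy
  exact ⟨v, hv, w, hw, rfl⟩

lemma exists_parameters (hA : A.IsNondegenerate) {π : Fin 4 → J} (hπ : A.IsZeroFrame υ π)
    {V : Submodule k J} (hV : A.IsGoodPlane υ π V) {ψ : Fin 2 → J}
    (hψ : LinearIndependent k ψ) (hspan : Submodule.span k (Set.range ψ) = V) :
    ∃! c : UpsilonParam k, A.IsParameters π ψ c := by
  have hψm : ∀ i, ψ i ∈ V := fun i => hspan ▸ Submodule.subset_span ⟨i, rfl⟩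
  have hind : ∀ p q : k, p • ψ 0 + q • ψ 1 = 0 → p = 0 ∧ q = 0 := by
    have : ψ = ![ψ 0, ψ 1] := by ext i; fin_cases i <;> rfl
    rw [this] at hψ
    exact LinearIndependent.pair_iff.1 hψ
  have h1V : ∀ v ∈ V, A.sharpMul (π 1) v ∈ V := fun v hv =>
    hV.pi2_stable (Submodule.mem_map_of_mem hv)
  have h3V : ∀ v ∈ V, A.sharpMul (π 3) v ∈ V := fun v hv =>
    hV.pi4_stable (Submodule.mem_map_of_mem hv)
  have hex : ∀ v ∈ V, ∃ p q : k, v = p • ψ 0 + q • ψ 1 := by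
    intro v hv
    rw [← hspan, Submodule.mem_span_range_iff_exists_fun] at hv
    obtain ⟨x, rfl⟩ := hv
    exact ⟨x 0, x 1, by rw [Fin.sum_univ_two]⟩
  obtain ⟨p, q, h10⟩ := hex _ (h1V _ (hψm 0))
  obtain ⟨r, s, h11⟩ := hex _ (h1V _ (hψm 1))
  obtain ⟨p', q', h30⟩ := hex _ (h3V _ (hψm 0))
  obtain ⟨r', s', h31⟩ := hex _ (h3V _ (hψm 1))
  have htr := trace_eq_zero h2 hυ hA hπ.mem_one hπ.mem_three hπ.mem_zero
    (fun w hw h h' h'' => hπ.eq_zero_of_polar h2 hυ hA hw h'' h h')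
    (fun p q h => (hπ.eq_zero_of_smul_add_smul h).2) hV.le h3V hV.exists_eq hψ hspan h10 h11
  have htr' := trace_eq_zero h2 hυ hA hπ.mem_three hπ.mem_one hπ.mem_zero
    (fun w hw h h' h'' => hπ.eq_zero_of_polar h2 hυ hA hw h'' h' h)
    (fun p q h => (hπ.eq_zero_of_smul_add_smul ((add_comm _ _).trans h)).1) hV.le h1V
    hV.exists_eq hψ hspan h30 h31
  rw [add_eq_zero_iff_eq_neg'] at htr htr'
  subst htr htr'
  refine ⟨⟨-A.S (π 0), ![QuadraticMap.polar A.S (π 0) (π 1), q, -p, -r],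
    ![-QuadraticMap.polar A.S (π 0) (π 3), -q', p', r']⟩, ?_, ?_⟩
  · constructor <;> simp [h10, h11, h30, h31, sub_eq_add_neg]
  · intro c hc
    have e1 := hc.pi2_psi1
    have e2 := hc.pi2_psi2
    have e3 := hc.pi4_psi1
    have e4 := hc.pi4_psi2
    rw [h10] at e1
    rw [h11] at e2
    rw [h30] at e3
    rw [h31] at e4
    obtain ⟨f1, f1'⟩ := hind (p + c.s 2) (q - c.s 1) (by linear_combination (norm := module) e1)
    obtain ⟨f2, -⟩ := hind (r + c.s 3) (-p - c.s 2) (by linear_combination (norm := module) e2)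
    obtain ⟨f3, f3'⟩ := hind (p' - c.t 2) (q' + c.t 1) (by linear_combination (norm := module) e3)
    obtain ⟨f4, -⟩ := hind (r' - c.t 3) (-p' + c.t 2) (by linear_combination (norm := module) e4)
    ext i
    · exact hc.z
    · fin_cases i
      · exact hc.s1
      · simp; linear_combination -f1'
      · simp; linear_combination f1
      · simp; linear_combination f2
    · fin_cases i
      · exact hc.t1
      · simp; linear_combination f3'
      · simp; linear_combination -f3
      · simp; linear_combination -f4

/-- For a suitable choice of the basis of a good plane, all parameters are nonzero. -/
lemma exists_allNonzero [IsAlgClosed k] (hA : A.IsNondegenerate) {π : Fin 4 → J}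
    (hπ : A.IsZeroFrame υ π) {V : Submodule k J} (hV : A.IsGoodPlane υ π V)
    (hS1 : A.S (π 1) ≠ 0) (hS3 : A.S (π 3) ≠ 0) :
    ∃ (ψ : Fin 2 → J) (c : UpsilonParam k), LinearIndependent k ψ ∧
      Submodule.span k (Set.range ψ) = V ∧ A.IsParameters π ψ c ∧ c.AllNonzero := by
  have : FiniteDimensional k V := Module.finite_of_finrank_pos (by rw [hV.finrank_eq]; norm_num)
  let B := Module.finBasisOfFinrankEq k V hV.finrank_eq
  let φ : Fin 2 → J := fun i => (B i : J)
  have hφ : LinearIndependent k φ := B.linearIndependent.map' V.subtype V.ker_subtype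
  have hspan : Submodule.span k (Set.range φ) = V := by
    have h3 := congrArg (Submodule.map V.subtype) B.span_eq
    rwa [Submodule.map_span, ← Set.range_comp, Submodule.map_top, Submodule.range_subtype] at h3
  have hφ0 : φ 0 ∈ A.peirceHalf υ := hV.le (B 0).2
  obtain ⟨c, hc, -⟩ := exists_parameters h2 hυ hA hπ hV hφ hspan
  -- If all three vanished, π₂ would kill φ 0, although its square on H is −S(π₂) ≠ 0.
  have hs : c.s 1 ≠ 0 ∨ 2 * c.s 2 ≠ 0 ∨ c.s 3 ≠ 0 := by
    by_contra! h
    have h3 := clifford_sq h2 hυ hπ.mem_one hφ0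
    rw [hc.pi2_psi1, h.1, (mul_eq_zero.1 h.2.1).resolve_left h2] at h3
    simp [hS1, hφ.ne_zero 0] at h3
  have ht : c.t 1 ≠ 0 ∨ 2 * c.t 2 ≠ 0 ∨ c.t 3 ≠ 0 := by
    by_contra! h
    have h3 := clifford_sq h2 hυ hπ.mem_three hφ0
    rw [hc.pi4_psi1, h.1, (mul_eq_zero.1 h.2.1).resolve_left h2] at h3
    simp [hS3, hφ.ne_zero 0] at h3
  -- A traceless 2×2 matrix is a binary quadratic form q(x) = s₂ + 2s₃x + s₄x². In the basis φ₀ +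
  -- xφ₁, φ₀ + yφ₁ its parameters become q(x), the polar value q(x,y), and q(y), each divided by y −
  -- x. First x is chosen off the roots of both forms.
  obtain ⟨x, hx⟩ := exists_quadratic_ne_zero ![c.s 1, c.t 1] ![2 * c.s 2, 2 * c.t 2]
    ![c.s 3, c.t 3] (by
      intro i
      fin_cases i
      · simpa using hs
      · simpa using ht)
  have hx0 : c.s 1 + 2 * c.s 2 * x + c.s 3 * x ^ 2 ≠ 0 := by simpa using hx 0
  have hx1 : c.t 1 + 2 * c.t 2 * x + c.t 3 * x ^ 2 ≠ 0 := by simpa using hx 1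
  have hlin : ∀ p q r : k, p + 2 * q * x + r * x ^ 2 ≠ 0 → p + q * x ≠ 0 ∨ q + r * x ≠ 0 := by
    intro p q r h
    by_contra! h3
    exact h (by linear_combination h3.1 + x * h3.2)
  -- Then y avoids the same roots, x itself, and the zeros of the two polar values, which are
  -- nonzero polynomials in y because q(x) ≠ 0.
  obtain ⟨y, hy⟩ := exists_quadratic_ne_zero
    ![c.s 1, c.t 1, -x, c.s 1 + c.s 2 * x, c.t 1 + c.t 2 * x]
    ![2 * c.s 2, 2 * c.t 2, 1, c.s 2 + c.s 3 * x, c.t 2 + c.t 3 * x]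
    ![c.s 3, c.t 3, 0, 0, 0] (by
      intro i
      fin_cases i
      · simpa using hs
      · simpa using ht
      · simp
      · simpa using hlin _ _ _ hx0
      · simpa using hlin _ _ _ hx1)
  have hy0 : c.s 1 + 2 * c.s 2 * y + c.s 3 * y ^ 2 ≠ 0 := by simpa using hy 0
  have hy1 : c.t 1 + 2 * c.t 2 * y + c.t 3 * y ^ 2 ≠ 0 := by simpa using hy 1
  have hD : y - x ≠ 0 := by
    have := hy 2
    simp at this
    intro h; exact this (by linear_combination h)
  have hsB : c.s 1 + c.s 2 * x + (c.s 2 + c.s 3 * x) * y ≠ 0 := by simpa using hy 3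
  have htB : c.t 1 + c.t 2 * x + (c.t 2 + c.t 3 * x) * y ≠ 0 := by simpa using hy 4
  refine ⟨![φ 0 + x • φ 1, φ 0 + y • φ 1], ⟨c.z,
    ![c.s 0, (c.s 1 + 2 * c.s 2 * x + c.s 3 * x ^ 2) / (y - x),
      (c.s 1 + c.s 2 * x + (c.s 2 + c.s 3 * x) * y) / (y - x),
      (c.s 1 + 2 * c.s 2 * y + c.s 3 * y ^ 2) / (y - x)],
    ![c.t 0, (c.t 1 + 2 * c.t 2 * x + c.t 3 * x ^ 2) / (y - x),
      (c.t 1 + c.t 2 * x + (c.t 2 + c.t 3 * x) * y) / (y - x),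
      (c.t 1 + 2 * c.t 2 * y + c.t 3 * y ^ 2) / (y - x)]⟩, ?_, ?_, ?_, ?_⟩
  · have hind : ∀ p q : k, p • φ 0 + q • φ 1 = 0 → p = 0 ∧ q = 0 := by
      have : φ = ![φ 0, φ 1] := by ext i; fin_cases i <;> rfl
      rw [this] at hφ
      exact LinearIndependent.pair_iff.1 hφ
    rw [LinearIndependent.pair_iff]
    intro p q h
    obtain ⟨h3, h4⟩ := hind (p + q) (p * x + q * y) (by linear_combination (norm := module) h)
    have h5 : q * (y - x) = 0 := by linear_combination h4 - x * h3
    have h6 := (mul_eq_zero.1 h5).resolve_right hD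
    exact ⟨by linear_combination h3 - h6, h6⟩
  · rw [← hspan]
    apply le_antisymm
    · rw [Submodule.span_le]
      rintro _ ⟨i, rfl⟩
      have h0 : φ 0 ∈ Submodule.span k (Set.range φ) := Submodule.subset_span ⟨0, rfl⟩
      have h1 : φ 1 ∈ Submodule.span k (Set.range φ) := Submodule.subset_span ⟨1, rfl⟩
      fin_cases i <;> exact add_mem h0 (Submodule.smul_mem _ _ h1)
    · rw [Submodule.span_le]
      rintro _ ⟨i, rfl⟩
      rw [SetLike.mem_coe, Submodule.mem_span_range_iff_exists_fun]
      fin_cases i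
      · refine ⟨![y / (y - x), -x / (y - x)], ?_⟩
        simp only [Fin.sum_univ_two, Matrix.cons_val_zero, Matrix.cons_val_one]
        change _ = φ 0
        match_scalars <;> field_simp <;> ring
      · refine ⟨![-1 / (y - x), 1 / (y - x)], ?_⟩
        simp only [Fin.sum_univ_two, Matrix.cons_val_zero, Matrix.cons_val_one]
        change _ = φ 1
        match_scalars <;> field_simp <;> ring
  · constructor
    · exact hc.s1
    · exact hc.t1
    · exact hc.z
    all_goals
      simp only [Matrix.cons_val_zero, Matrix.cons_val_one, Matrix.cons_val, map_add, map_smul,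
        hc.pi2_psi1, hc.pi2_psi2, hc.pi4_psi1, hc.pi4_psi2]
      match_scalars <;> field_simp <;> ring
  · constructor
    · intro i hi
      fin_cases i
      · simp at hi
      · exact div_ne_zero hx0 hD
      · exact div_ne_zero hsB hD
      · exact div_ne_zero hy0 hD
    · intro i hi
      fin_cases i
      · simp at hi
      · exact div_ne_zero hx1 hD
      · exact div_ne_zero htB hD
      · exact div_ne_zero hy1 hD

end Planes
end CubicJordanAlgebra

namespace CubicJordanAlgebra

variable {k J : Type*} [Field k] [AddCommGroup J] [Module k J]

/-! ### Existence of frames and good planes -/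

section Existence

variable {A : CubicJordanAlgebra k J} {υ : J}

lemma S_add (x y : J) : A.S (x + y) = A.S x + A.S y + QuadraticMap.polar A.S x y := by
  simp [QuadraticMap.polar]

lemma polar_S_smul_self {c : k} {x : J} (hc : c ≠ 0) (h : A.S (c • x) = 0) :
    QuadraticMap.polar A.S (c • x) x = 0 := by
  rw [QuadraticMap.map_smul, smul_eq_mul] at h
  rw [QuadraticMap.polar_smul_left, QuadraticMap.polar_self,
    (mul_eq_zero.1 h).resolve_left (mul_ne_zero hc hc)]
  simp

variable (h2 : (2 : k) ≠ 0) (hυ : A.IsPrimitiveIdempotent υ)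
include h2 hυ

lemma exists_zeroFrame [IsAlgClosed k] (hdim : Module.finrank k J = 9) (hA : A.IsNondegenerate)
    (hsimple : A.IsSimple) : ∃ π, A.IsZeroFrame υ π ∧ A.S (π 1) ≠ 0 ∧ A.S (π 3) ≠ 0 := by
  have : FiniteDimensional k J := Module.finite_of_finrank_pos (by omega)
  have hW := (finrank_tracelessZero_and_half h2 hυ hdim hA hsimple).1
  have hne : A.tracelessZero υ ≠ ⊥ := by
    intro h; rw [h, finrank_bot] at hW; omega
  obtain ⟨a, ha, hS⟩ := exists_involution h2 hυ hA hne
  have hC := finrank_tracelessZero_eq h2 hυ ha hS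
  let B := Module.finBasisOfFinrankEq k (A.tracelessPerp υ a) (n := 2) (by omega)
  have hB : LinearIndependent k ![(B 0 : J), (B 1 : J)] := by
    have h := B.linearIndependent.map' (A.tracelessPerp υ a).subtype (Submodule.ker_subtype _)
    have h3 : (A.tracelessPerp υ a).subtype ∘ B = ![(B 0 : J), (B 1 : J)] := by
      ext i; fin_cases i <;> rfl
    rwa [h3] at h
  have hB0 := (B 0).2
  have hB1 := (B 1).2
  set b : J := (B 0 : J)
  set c : J := (B 1 : J)
  -- The two polynomials are t and S(a + tc) = −1 + S(c)t²; the frame uses π₁ = b, π₂ = a, π₄ = a +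
  -- tc.
  obtain ⟨t, ht⟩ := exists_quadratic_ne_zero ![0, -1] ![(1 : k), 0] ![0, A.S c] (by
    intro i; fin_cases i <;> simp)
  have ht0 : t ≠ 0 := by simpa using ht 0
  have ht1 : -1 + A.S c * t ^ 2 ≠ 0 := by simpa using ht 1
  have hac : A.T a c = 0 := hB1.2
  have hab : A.T a b = 0 := hB0.2
  have hpol : QuadraticMap.polar A.S a c = 0 := by
    rw [← neg_eq_zero, ← T_traceless h2 hυ ha, hac]
  have hli : LinearIndependent k ![b, a, a + t • c] := by
    rw [Fintype.linearIndependent_iff]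
    intro g hg
    simp only [Fin.sum_univ_three, Matrix.cons_val_zero, Matrix.cons_val_one,
      Matrix.cons_val] at hg
    have h3 := congrArg (A.T a) hg
    simp only [map_add, map_smul, hab, hac, T_self_involution h2 hυ ha hS, smul_eq_mul,
      map_zero] at h3
    have h4 : g 1 + g 2 = 0 := by
      have : 2 * (g 1 + g 2) = 0 := by linear_combination h3
      exact (mul_eq_zero.1 this).resolve_left h2
    obtain ⟨h5, h6⟩ := LinearIndependent.pair_iff.1 hB (g 0) (g 2 * t) (by
      rw [eq_neg_of_add_eq_zero_left h4] at hg
      linear_combination (norm := module) hg)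
    have h7 : g 2 = 0 := (mul_eq_zero.1 h6).resolve_right ht0
    rw [h7, add_zero] at h4
    intro i; fin_cases i
    · exact h5
    · exact h4
    · exact h7
  refine ⟨![b, a, A.one - υ, a + t • c], ⟨rfl, hli, ?_⟩, ?_, ?_⟩
  · change Submodule.span k {b, a, a + t • c} = A.tracelessZero υ
    have h3 := finrank_span_eq_card hli
    have h4 : Set.range ![b, a, a + t • c] = {b, a, a + t • c} := by
      rw [Matrix.range_cons, Matrix.range_cons_cons_empty]; rfl
    rw [h4] at h3
    apply Submodule.eq_of_le_of_finrank_eq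
    · rw [Submodule.span_le]
      rintro x (rfl | rfl | rfl)
      · exact hB0.1
      · exact ha
      · exact add_mem ha (Submodule.smul_mem _ _ hB1.1)
    · rw [h3, hW]; rfl
  · change A.S a ≠ 0
    rw [hS]; simp
  · change A.S (a + t • c) ≠ 0
    rw [S_add, QuadraticMap.map_smul, QuadraticMap.polar_smul_right, hpol, hS]
    intro h; apply ht1; rw [← h, smul_eq_mul, smul_eq_mul]; ring

/-- The last hypothesis gives both injectivity of π₁♯ on V and disjointness of V from its image;
then 2 + 2 = 4. -/
lemma isGoodPlane_of [FiniteDimensional k J] (hH : Module.finrank k (A.peirceHalf υ) = 4)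
    {π : Fin 4 → J} (hπ : A.IsZeroFrame υ π) {V : Submodule k J} (hV : V ≤ A.peirceHalf υ)
    (hfin : Module.finrank k V = 2) (h1 : ∀ v ∈ V, A.sharpMul (π 1) v ∈ V)
    (h3 : ∀ v ∈ V, A.sharpMul (π 3) v ∈ V) (h0 : ∀ v ∈ V, A.sharpMul (π 0) v ∈ V → v = 0) :
    A.IsGoodPlane υ π V := by
  have hfin' : Module.finrank k (V.map (A.sharpMul (π 0))) = 2 := by
    rw [← hfin]
    apply le_antisymm (Submodule.finrank_map_le _ _)
    refine LinearMap.finrank_le_finrank_of_injective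
      (f := (A.sharpMul (π 0)).restrict fun x hx => Submodule.mem_map_of_mem hx) ?_
    rw [← LinearMap.ker_eq_bot, LinearMap.ker_eq_bot']
    rintro ⟨x, hx⟩ h
    have h' : A.sharpMul (π 0) x = 0 := congrArg Subtype.val h
    exact Subtype.ext (h0 x hx (by rw [h']; exact zero_mem _))
  have hdis : Disjoint V (V.map (A.sharpMul (π 0))) := by
    rw [Submodule.disjoint_def]
    rintro _ hx ⟨v, hv, rfl⟩
    rw [h0 v hv hx, map_zero]
  refine ⟨hfin, ?_, ?_, hfin', hdis, ?_⟩
  · rintro _ ⟨v, hv, rfl⟩; exact h1 v hv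
  · rintro _ ⟨v, hv, rfl⟩; exact h3 v hv
  · apply Submodule.eq_of_le_of_finrank_eq
    · refine sup_le hV ?_
      rintro _ ⟨v, hv, rfl⟩
      exact sharpMul_mem_half h2 hυ hπ.mem_zero (hV hv)
    · have h4 := Submodule.finrank_sup_add_finrank_inf_eq V (V.map (A.sharpMul (π 0)))
      rw [hdis.eq_bot, finrank_bot] at h4
      omega

section Isotropic

variable {f g : J} (hf : f ∈ A.tracelessZero υ) (hg : g ∈ A.tracelessZero υ) (hS : A.S f = 0)
  (hfg : QuadraticMap.polar A.S f g ≠ 0)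
include hf hg

lemma sharpMul_isotropic {v : J} (hv : v ∈ A.peirceHalf υ ⊓ LinearMap.ker (A.sharpMul f)) :
    A.sharpMul f (A.sharpMul g v) = -QuadraticMap.polar A.S f g • v := by
  have h := clifford h2 hυ hf hg hv.1
  rwa [LinearMap.mem_ker.1 hv.2, map_zero, add_zero] at h

include hS hfg

/-- As f♯f♯ = 0 on H, the image of f♯ lies in its kernel. The Clifford relation writes −S(f,g)x as
f♯(g♯x) + g♯(f♯x). -/
lemma exists_isotropic {x : J} (hx : x ∈ A.peirceHalf υ) :
    ∃ v ∈ A.peirceHalf υ ⊓ LinearMap.ker (A.sharpMul f),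
      ∃ w ∈ A.peirceHalf υ ⊓ LinearMap.ker (A.sharpMul f), x = v + A.sharpMul g w := by
  have hfx : A.sharpMul f x ∈ A.peirceHalf υ ⊓ LinearMap.ker (A.sharpMul f) := by
    refine ⟨sharpMul_mem_half h2 hυ hf hx, ?_⟩
    rw [SetLike.mem_coe, LinearMap.mem_ker, clifford_sq h2 hυ hf hx, hS, neg_zero, zero_smul]
  have hgx := sharpMul_mem_half h2 hυ hg hx
  refine ⟨(-(QuadraticMap.polar A.S f g)⁻¹) • A.sharpMul f (A.sharpMul g x), ?_,
    (-(QuadraticMap.polar A.S f g)⁻¹) • A.sharpMul f x, Submodule.smul_mem _ _ hfx, ?_⟩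
  · refine Submodule.smul_mem _ _ ⟨sharpMul_mem_half h2 hυ hf hgx, ?_⟩
    rw [SetLike.mem_coe, LinearMap.mem_ker, clifford_sq h2 hυ hf hgx, hS, neg_zero, zero_smul]
  · rw [map_smul, ← smul_add, clifford h2 hυ hf hg hx, smul_smul, neg_mul_neg,
      inv_mul_cancel₀ hfg, one_smul]

lemma finrank_isotropic [FiniteDimensional k J] (hH : Module.finrank k (A.peirceHalf υ) = 4) :
    Module.finrank k ↥(A.peirceHalf υ ⊓ LinearMap.ker (A.sharpMul f)) = 2 := by
  set K := A.peirceHalf υ ⊓ LinearMap.ker (A.sharpMul f)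
  have hK : ∀ w ∈ K, A.sharpMul f (A.sharpMul g w) = 0 → w = 0 := by
    intro w hw h
    rw [sharpMul_isotropic h2 hυ hf hg hw] at h
    exact (smul_eq_zero.1 h).resolve_left (neg_ne_zero.2 hfg)
  let F : K × K →ₗ[k] A.peirceHalf υ :=
    LinearMap.codRestrict _ (K.subtype.coprod (A.sharpMul g ∘ₗ K.subtype)) (by
      rintro ⟨v, w⟩
      exact add_mem v.2.1 (sharpMul_mem_half h2 hυ hg w.2.1))
  have hF : Function.Bijective F := by
    constructor
    · rw [← LinearMap.ker_eq_bot, LinearMap.ker_eq_bot']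
      rintro ⟨⟨v, hv⟩, ⟨w, hw⟩⟩ h
      have h3 : v + A.sharpMul g w = 0 := congrArg Subtype.val h
      have h4 : w = 0 := hK w hw (by
        have h5 := congrArg (A.sharpMul f) h3
        rwa [map_add, LinearMap.mem_ker.1 hv.2, zero_add, map_zero] at h5)
      subst h4
      rw [map_zero, add_zero] at h3
      subst h3
      rfl
    · rintro ⟨x, hx⟩
      obtain ⟨v, hv, w, hw, rfl⟩ := exists_isotropic h2 hυ hf hg hS hfg hx
      exact ⟨⟨⟨v, hv⟩, ⟨w, hw⟩⟩, rfl⟩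
  have h := (LinearEquiv.ofBijective F hF).finrank_eq
  rw [Module.finrank_prod, hH] at h
  omega

end Isotropic

/-- V is the kernel of n in H. It is stable under π₂ and π₄, which anticommute with n, while
n♯(π₁♯v) = −S(n,π₁)v ≠ 0 for v ≠ 0 in V. -/
lemma exists_goodPlane_of_isotropic [FiniteDimensional k J] (hA : A.IsNondegenerate)
    (hH : Module.finrank k (A.peirceHalf υ) = 4)
    {π : Fin 4 → J} (hπ : A.IsZeroFrame υ π) {n : J} (hn : n ∈ A.tracelessZero υ) (hn0 : n ≠ 0)
    (hS : A.S n = 0) (h1 : QuadraticMap.polar A.S n (π 1) = 0)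
    (h3 : QuadraticMap.polar A.S n (π 3) = 0) : ∃ V, A.IsGoodPlane υ π V := by
  have h0 : QuadraticMap.polar A.S n (π 0) ≠ 0 := fun h0 =>
    hn0 (hπ.eq_zero_of_polar h2 hυ hA hn h0 h1 h3)
  have hstab : ∀ a ∈ A.tracelessZero υ, QuadraticMap.polar A.S n a = 0 →
      ∀ v ∈ A.peirceHalf υ ⊓ LinearMap.ker (A.sharpMul n),
        A.sharpMul a v ∈ A.peirceHalf υ ⊓ LinearMap.ker (A.sharpMul n) := by
    intro a ha hna v hv
    refine ⟨sharpMul_mem_half h2 hυ ha hv.1, ?_⟩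
    have h := clifford h2 hυ hn ha hv.1
    rw [LinearMap.mem_ker.1 hv.2, map_zero, add_zero, hna, neg_zero, zero_smul] at h
    exact h
  refine ⟨_, isGoodPlane_of h2 hυ hH hπ inf_le_left
    (finrank_isotropic h2 hυ hn hπ.mem_zero hS h0 hH) (hstab _ hπ.mem_one h1)
    (hstab _ hπ.mem_three h3) fun v hv hv' => ?_⟩
  have h := sharpMul_isotropic h2 hυ hn hπ.mem_zero hv
  rw [LinearMap.mem_ker.1 hv'.2] at h
  exact (smul_eq_zero.1 h.symm).resolve_left (neg_ne_zero.2 h0)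

/-- The kernel K of f is stable under n, which has eigenvectors y, z in K for both square roots ±l
of −S(n). The vector y + z and its image under g span the plane; it is stable under f and g, but n
sends y + z to l(y − z), outside it. -/
lemma exists_plane_of_nonisotropic [IsAlgClosed k] [FiniteDimensional k J]
    (hA : A.IsNondegenerate) (hH : Module.finrank k (A.peirceHalf υ) = 4) {f g n : J}
    (hf : f ∈ A.tracelessZero υ) (hg : g ∈ A.tracelessZero υ) (hn : n ∈ A.tracelessZero υ)
    (hS : A.S f = 0) (hfg : QuadraticMap.polar A.S f g ≠ 0) (hSn : A.S n ≠ 0)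
    (hnf : QuadraticMap.polar A.S n f = 0) (hng : QuadraticMap.polar A.S n g = 0) :
    ∃ V ≤ A.peirceHalf υ, Module.finrank k V = 2 ∧ (∀ v ∈ V, A.sharpMul f v ∈ V) ∧
      (∀ v ∈ V, A.sharpMul g v ∈ V) ∧ ∀ v ∈ V, A.sharpMul n v ∈ V → v = 0 := by
  set K := A.peirceHalf υ ⊓ LinearMap.ker (A.sharpMul f) with hKdef
  have hKfin : Module.finrank k K = 2 := finrank_isotropic h2 hυ hf hg hS hfg hH
  have hKne : K ≠ ⊥ := by
    intro h; rw [h, finrank_bot] at hKfin; omega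
  obtain ⟨l, hl⟩ := IsAlgClosed.exists_eq_mul_self (-A.S n)
  have hl0 : l ≠ 0 := by
    rintro rfl
    exact hSn (by simpa using hl)
  have hnK : ∀ v ∈ K, A.sharpMul n v ∈ K := by
    intro v hv
    refine ⟨sharpMul_mem_half h2 hυ hn hv.1, ?_⟩
    have h := clifford h2 hυ hn hf hv.1
    rwa [LinearMap.mem_ker.1 hv.2, map_zero, zero_add, hnf, neg_zero, zero_smul] at h
  have hnn : ∀ v ∈ A.peirceHalf υ, A.sharpMul n (A.sharpMul n v) = (l * l) • v := by
    intro v hv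
    rw [clifford_sq h2 hυ hn hv, hl]
  have hgn : ∀ v ∈ A.peirceHalf υ, A.sharpMul n (A.sharpMul g v) =
      -A.sharpMul g (A.sharpMul n v) := by
    intro v hv
    have h := clifford h2 hυ hn hg hv
    rw [hng, neg_zero, zero_smul] at h
    exact eq_neg_of_add_eq_zero_left h
  have hfgK : ∀ v ∈ K, A.sharpMul f (A.sharpMul g v) = -QuadraticMap.polar A.S f g • v :=
    fun v hv => sharpMul_isotropic h2 hυ hf hg hv
  -- The operator n + m sends K into the m-eigenspace. If that were zero, n would be the scalar −m
  -- on K, which `eq_zero_of_scalar` forbids.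
  have heig : ∀ m : k, m * m = l * l → ∃ y ∈ K, y ≠ 0 ∧ A.sharpMul n y = m • y := by
    intro m hm
    have hm0 : m ≠ 0 := by
      rintro rfl
      rw [mul_zero] at hm
      exact hl0 (mul_self_eq_zero.1 hm.symm)
    by_contra! H
    have h3 : ∀ v ∈ K, A.sharpMul n v = (-m) • v := by
      intro v hv
      by_contra h4
      refine H (A.sharpMul n v + m • v) (add_mem (hnK v hv) (Submodule.smul_mem _ _ hv)) ?_ ?_
      · intro h5
        rw [neg_smul] at h4
        exact h4 (eq_neg_of_add_eq_zero_left h5)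
      · rw [map_add, map_smul, hnn v hv.1, ← hm]; module
    obtain ⟨v, hv, hv0⟩ := Submodule.exists_mem_ne_zero_of_ne_bot hKne
    exact hv0 (eq_zero_of_scalar h2 hυ hA inf_le_left hf hg hn (fun v hv => hv.2) hfg
      (neg_ne_zero.2 hm0) h3 (fun x hx => exists_isotropic h2 hυ hf hg hS hfg hx) hv)
  obtain ⟨y, hy, hy0, hny⟩ := heig l rfl
  obtain ⟨z, hz, hz0, hnz⟩ := heig (-l) (by ring)
  have hyz : ∀ p q : k, p • y + q • z = 0 → p = 0 ∧ q = 0 := by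
    intro p q h
    have h3 := congrArg (A.sharpMul n) h
    rw [map_add, map_smul, map_smul, hny, hnz, map_zero] at h3
    have h4 : (2 * l * p) • y = 0 := by linear_combination (norm := module) h3 + l • h
    have h5 : (2 * l * q) • z = 0 := by linear_combination (norm := module) l • h - h3
    have h6 : 2 * l ≠ 0 := mul_ne_zero h2 hl0
    exact ⟨(mul_eq_zero.1 ((smul_eq_zero.1 h4).resolve_right hy0)).resolve_left h6,
      (mul_eq_zero.1 ((smul_eq_zero.1 h5).resolve_right hz0)).resolve_left h6⟩
  have hfy := LinearMap.mem_ker.1 hy.2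
  have hfz := LinearMap.mem_ker.1 hz.2
  set s := QuadraticMap.polar A.S f g
  have hfgy := hfgK y hy
  have hfgz := hfgK z hz
  have hli : LinearIndependent k ![y + z, A.sharpMul g (y + z)] := by
    rw [LinearIndependent.pair_iff]
    intro p q h
    have h3 := congrArg (A.sharpMul f) h
    simp only [map_add, map_smul, hfy, hfz, hfgy, hfgz, map_zero] at h3
    obtain ⟨h4, -⟩ := hyz (q * s) (q * s) (by linear_combination (norm := module) -h3)
    have h5 := (mul_eq_zero.1 h4).resolve_right hfg
    rw [h5] at h
    obtain ⟨h6, -⟩ := hyz p p (by linear_combination (norm := module) h)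
    exact ⟨h6, h5⟩
  refine ⟨Submodule.span k {y + z, A.sharpMul g (y + z)}, ?_, ?_, ?_, ?_, ?_⟩
  · rw [Submodule.span_le]
    rintro x (rfl | rfl)
    · exact add_mem hy.1 hz.1
    · exact sharpMul_mem_half h2 hυ hg (add_mem hy.1 hz.1)
  · have h := finrank_span_eq_card hli
    rw [Matrix.range_cons_cons_empty] at h
    simpa using h
  · intro v hv
    obtain ⟨p, q, rfl⟩ := Submodule.mem_span_pair.1 hv
    refine Submodule.mem_span_pair.2 ⟨-q * s, 0, ?_⟩
    simp only [map_add, map_smul, hfy, hfz, hfgy, hfgz]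
    module
  · intro v hv
    obtain ⟨p, q, rfl⟩ := Submodule.mem_span_pair.1 hv
    refine Submodule.mem_span_pair.2 ⟨-q * A.S g, p, ?_⟩
    have h := clifford_sq h2 hυ hg (add_mem hy.1 hz.1)
    simp only [map_add, map_smul] at h ⊢
    linear_combination (norm := module) -(q • h)
  · intro v hv hv'
    obtain ⟨p, q, rfl⟩ := Submodule.mem_span_pair.1 hv
    obtain ⟨c, d, h⟩ := Submodule.mem_span_pair.1 hv'
    simp only [map_add, map_smul, hny, hnz, hgn y hy.1, hgn z hz.1] at h
    have h3 := congrArg (A.sharpMul f) h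
    simp only [map_add, map_smul, map_neg, hfy, hfz, hfgy, hfgz] at h3
    obtain ⟨h4, h5⟩ := hyz ((d + q * l) * s) ((d - q * l) * s) (by
      linear_combination (norm := module) -h3)
    have h6 := (mul_eq_zero.1 h4).resolve_right hfg
    have h7 := (mul_eq_zero.1 h5).resolve_right hfg
    have h8 : q = 0 := by
      have : 2 * l * q = 0 := by linear_combination h6 - h7
      exact (mul_eq_zero.1 this).resolve_left (mul_ne_zero h2 hl0)
    subst h8
    have h9 : d = 0 := by linear_combination h6
    subst h9
    obtain ⟨h10, h11⟩ := hyz (c - p * l) (c + p * l) (by linear_combination (norm := module) h)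
    have h12 : p = 0 := by
      have : 2 * l * p = 0 := by linear_combination h11 - h10
      exact (mul_eq_zero.1 this).resolve_left (mul_ne_zero h2 hl0)
    rw [h12]; simp

lemma exists_goodPlane [IsAlgClosed k] (hdim : Module.finrank k J = 9) (hA : A.IsNondegenerate)
    (hsimple : A.IsSimple) {π : Fin 4 → J} (hπ : A.IsZeroFrame υ π) :
    ∃ V, A.IsGoodPlane υ π V := by
  have : FiniteDimensional k J := Module.finite_of_finrank_pos (by omega)
  obtain ⟨hW, hH⟩ := finrank_tracelessZero_and_half h2 hυ hdim hA hsimple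
  by_cases hiso : ∃ n ∈ A.tracelessZero υ, n ≠ 0 ∧ A.S n = 0 ∧
      QuadraticMap.polar A.S n (π 1) = 0 ∧ QuadraticMap.polar A.S n (π 3) = 0
  · obtain ⟨n, hn, hn0, hS, h1, h3⟩ := hiso
    exact exists_goodPlane_of_isotropic h2 hυ hA hH hπ hn hn0 hS h1 h3
  have hmem1 := hπ.mem_one
  have hmem3 := hπ.mem_three
  obtain ⟨n, hn, hn0, h1, h3⟩ : ∃ n ∈ A.tracelessZero υ, n ≠ 0 ∧
      QuadraticMap.polar A.S n (π 1) = 0 ∧ QuadraticMap.polar A.S n (π 3) = 0 := by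
    let F : A.tracelessZero υ →ₗ[k] k × k :=
      ((A.T (π 1)).prod (A.T (π 3))) ∘ₗ (A.tracelessZero υ).subtype
    have hF : LinearMap.ker F ≠ ⊥ := LinearMap.ker_ne_bot_of_finrank_lt (by
      rw [hW, Module.finrank_prod, Module.finrank_self]; norm_num)
    obtain ⟨⟨n, hn⟩, hn', hn0⟩ := Submodule.exists_mem_ne_zero_of_ne_bot hF
    have h3 : (A.T (π 1) n, A.T (π 3) n) = 0 := hn'
    rw [Prod.mk_eq_zero, A.T_comm, A.T_comm (π 3), T_traceless h2 hυ hn, T_traceless h2 hυ hn,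
      neg_eq_zero, neg_eq_zero] at h3
    exact ⟨n, hn, fun h => hn0 (Subtype.ext h), h3⟩
  have hSn : A.S n ≠ 0 := fun h => hiso ⟨n, hn, hn0, h, h1, h3⟩
  obtain ⟨α, β, hne, hq⟩ : ∃ α β : k, (α ≠ 0 ∨ β ≠ 0) ∧ A.S (α • π 1 + β • π 3) = 0 := by
    by_cases hS : A.S (π 1) = 0
    · exact ⟨1, 0, by simp, by simpa using hS⟩
    · have : NeZero (2 : k) := ⟨h2⟩
      obtain ⟨x, hx⟩ := exists_quadratic_eq_zero hS (IsAlgClosed.exists_eq_mul_self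
        (discrim (A.S (π 1)) (QuadraticMap.polar A.S (π 1) (π 3)) (A.S (π 3))))
      refine ⟨x, 1, by simp, ?_⟩
      rw [S_add, QuadraticMap.map_smul, QuadraticMap.polar_smul_left, one_smul,
        ← hx, smul_eq_mul, smul_eq_mul]
      ring
  set f := α • π 1 + β • π 3 with hf
  have hfW : f ∈ A.tracelessZero υ :=
    add_mem (Submodule.smul_mem _ _ hmem1) (Submodule.smul_mem _ _ hmem3)
  have hf0 : f ≠ 0 := by
    intro h
    obtain ⟨h4, h5⟩ := hπ.eq_zero_of_smul_add_smul h
    simp [h4, h5] at hne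
  have hnf : QuadraticMap.polar A.S n f = 0 := by
    rw [hf, QuadraticMap.polar_add_right, QuadraticMap.polar_smul_right,
      QuadraticMap.polar_smul_right, h1, h3]
    simp
  obtain ⟨n0, n1, n3, hneq⟩ := hπ.exists_eq hn
  -- An anisotropic n orthogonal to π₂ and π₄ is not in their span, so n can replace π₁ in testing
  -- the plane.
  have hn00 : n0 ≠ 0 := by
    rintro rfl
    have h4 := QuadraticMap.polar_self A.S n
    nth_rw 2 [hneq] at h4
    simp only [QuadraticMap.polar_add_right, QuadraticMap.polar_smul_right, h1, h3] at h4
    have h5 : 2 * A.S n = 0 := by simpa using h4.symm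
    exact hSn ((mul_eq_zero.1 h5).resolve_left h2)
  -- The partner of the isotropic vector f is whichever of π₂, π₄ pairs nontrivially with it. Being
  -- isotropic, f is not a multiple of that partner, so stability under f and the partner yields
  -- stability under both π₂ and π₄.
  have key : ∃ V ≤ A.peirceHalf υ, Module.finrank k V = 2 ∧
      (∀ v ∈ V, A.sharpMul (π 1) v ∈ V) ∧ (∀ v ∈ V, A.sharpMul (π 3) v ∈ V) ∧
        ∀ v ∈ V, A.sharpMul n v ∈ V → v = 0 := by
    by_cases hf1 : QuadraticMap.polar A.S f (π 1) = 0
    · have hf3 : QuadraticMap.polar A.S f (π 3) ≠ 0 := fun hf3 =>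
        hiso ⟨f, hfW, hf0, hq, hf1, hf3⟩
      have hα : α ≠ 0 := by
        rintro rfl
        have hfβ : f = β • π 3 := by rw [hf, zero_smul, zero_add]
        rw [hfβ] at hq hf3
        exact hf3 (polar_S_smul_self (hne.resolve_left (by simp)) hq)
      obtain ⟨V, hV, hfin, hVf, hV3, hVn⟩ :=
        exists_plane_of_nonisotropic h2 hυ hA hH hfW hmem3 hn hq hf3 hSn hnf h3
      refine ⟨V, hV, hfin, fun v hv => ?_, hV3, hVn⟩
      have h4 : A.sharpMul (π 1) v = α⁻¹ • (A.sharpMul f v - β • A.sharpMul (π 3) v) := by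
        rw [hf, map_add, LinearMap.add_apply, map_smul, map_smul, LinearMap.smul_apply,
          LinearMap.smul_apply, add_sub_cancel_right, inv_smul_smul₀ hα]
      rw [h4]
      exact Submodule.smul_mem _ _ (sub_mem (hVf v hv) (Submodule.smul_mem _ _ (hV3 v hv)))
    · have hβ : β ≠ 0 := by
        rintro rfl
        have hfα : f = α • π 1 := by rw [hf, zero_smul, add_zero]
        rw [hfα] at hq hf1
        exact hf1 (polar_S_smul_self (hne.resolve_right (by simp)) hq)
      obtain ⟨V, hV, hfin, hVf, hV1, hVn⟩ :=
        exists_plane_of_nonisotropic h2 hυ hA hH hfW hmem1 hn hq hf1 hSn hnf h1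
      refine ⟨V, hV, hfin, hV1, fun v hv => ?_, hVn⟩
      have h4 : A.sharpMul (π 3) v = β⁻¹ • (A.sharpMul f v - α • A.sharpMul (π 1) v) := by
        rw [hf, map_add, LinearMap.add_apply, map_smul, map_smul, LinearMap.smul_apply,
          LinearMap.smul_apply, add_sub_cancel_left, inv_smul_smul₀ hβ]
      rw [h4]
      exact Submodule.smul_mem _ _ (sub_mem (hVf v hv) (Submodule.smul_mem _ _ (hV1 v hv)))
  obtain ⟨V, hV, hfin, hV1, hV3, hVn⟩ := key
  refine ⟨V, isGoodPlane_of h2 hυ hH hπ hV hfin hV1 hV3 fun v hv hv' => hVn v hv ?_⟩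
  rw [hneq]
  simp only [map_add, map_smul, LinearMap.add_apply, LinearMap.smul_apply]
  exact add_mem (add_mem (Submodule.smul_mem _ _ hv') (Submodule.smul_mem _ _ (hV1 v hv)))
    (Submodule.smul_mem _ _ (hV3 v hv))

end Existence
end CubicJordanAlgebra

namespace Upsilon

/-! ### The explicit formulas as polynomials -/

section Explicit

variable {R : Type*} [CommRing R] (c : UpsilonParam R) (v : UpsilonPoint R)

lemma sharp_u : (sharp c v).u =
    v.p 2 ^ 2 - c.z * v.p 0 ^ 2 + (c.s 1 * c.s 3 - c.s 2 ^ 2) * v.p 1 ^ 2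
      + (c.t 1 * c.t 3 - c.t 2 ^ 2) * v.p 3 ^ 2 + c.s 0 * v.p 0 * v.p 1 - c.t 0 * v.p 0 * v.p 3
      - (c.s 3 * c.t 1 - 2 * c.s 2 * c.t 2 + c.s 1 * c.t 3) * v.p 1 * v.p 3 := by
  simp [sharp, Pf, pfaffian₄, M, upperM, Fin.succAbove, Fin.lt_def]
  ring

lemma sharp_x0 : (sharp c v).x 0 = v.x 0 * (-v.p 2 + (v.p 1 * c.s 2 - v.p 3 * c.t 2))
    - v.x 1 * (v.p 3 * c.t 3 - v.p 1 * c.s 3) - v.y 0 * v.p 0 := by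
  simp [sharp, Pf, pfaffian₄, M, upperM, Fin.succAbove, Fin.lt_def]
  ring

lemma sharp_x1 : (sharp c v).x 1 = v.x 0 * (v.p 3 * c.t 1 - v.p 1 * c.s 1)
    - v.x 1 * (v.p 2 + (v.p 1 * c.s 2 - v.p 3 * c.t 2)) - v.y 1 * v.p 0 := by
  simp [sharp, Pf, pfaffian₄, M, upperM, Fin.succAbove, Fin.lt_def]
  ring

lemma sharp_y0 : (sharp c v).y 0 = v.x 0 * (-(c.z * v.p 0) + v.p 1 * c.s 0 - v.p 3 * c.t 0)
    - v.y 0 * (v.p 2 + (v.p 1 * c.s 2 - v.p 3 * c.t 2))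
    + v.y 1 * (v.p 3 * c.t 3 - v.p 1 * c.s 3) := by
  simp [sharp, Pf, pfaffian₄, M, upperM, Fin.succAbove, Fin.lt_def]

lemma sharp_y1 : (sharp c v).y 1 = v.x 1 * (-(c.z * v.p 0) + v.p 1 * c.s 0 - v.p 3 * c.t 0)
    - v.y 0 * (v.p 3 * c.t 1 - v.p 1 * c.s 1)
    + v.y 1 * (-v.p 2 + (v.p 1 * c.s 2 - v.p 3 * c.t 2)) := by
  simp [sharp, Pf, pfaffian₄, M, upperM, Fin.succAbove, Fin.lt_def]

/-- The part of `p_i♯` that is quadratic in `x` and `y`. -/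
def halfSharp : Fin 4 → R :=
  ![ST c 0 1 * -v.x 0 ^ 2 + ST c 0 2 * (-2 * v.x 0 * v.x 1) - ST c 0 3 * v.x 1 ^ 2
      - ST c 1 2 * (2 * v.x 0 * v.y 0) - ST c 1 3 * (v.x 0 * v.y 1 + v.x 1 * v.y 0)
      - ST c 2 3 * (2 * v.x 1 * v.y 1),
    c.t 0 * (v.y 0 * v.x 1 - v.y 1 * v.x 0) + c.t 1 * (v.y 0 ^ 2 - c.z * v.x 0 ^ 2)
      + 2 * c.t 2 * (v.y 0 * v.y 1 - c.z * v.x 0 * v.x 1)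
      + c.t 3 * (v.y 1 ^ 2 - c.z * v.x 1 ^ 2),
    -(ST c 0 1 * (v.x 0 * v.y 0) + ST c 0 2 * (v.x 0 * v.y 1 + v.x 1 * v.y 0)
      + ST c 0 3 * (v.x 1 * v.y 1) + ST c 1 2 * (v.y 0 ^ 2 + c.z * v.x 0 ^ 2)
      + ST c 1 3 * (v.y 0 * v.y 1 + c.z * v.x 0 * v.x 1)
      + ST c 2 3 * (v.y 1 ^ 2 + c.z * v.x 1 ^ 2)),
    c.s 0 * (v.y 0 * v.x 1 - v.y 1 * v.x 0) + c.s 1 * (v.y 0 ^ 2 - c.z * v.x 0 ^ 2)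
      + 2 * c.s 2 * (v.y 0 * v.y 1 - c.z * v.x 0 * v.x 1)
      + c.s 3 * (v.y 1 ^ 2 - c.z * v.x 1 ^ 2)]

lemma sharp_p0 : (sharp c v).p 0 = -(v.u * v.p 0) + halfSharp c v 0 := by
  simp [sharp, M₁, upperM₁, halfSharp, ST, dotProduct, Matrix.mulVec, Fin.sum_univ_four]
  ring

lemma sharp_p1 : (sharp c v).p 1 = -(v.u * v.p 1) + halfSharp c v 1 := by
  simp [sharp, deltaVec, minor, minorMatrix, halfSharp, dotProduct, Fin.sum_univ_four]
  ring

lemma sharp_p2 : (sharp c v).p 2 = v.u * v.p 2 + halfSharp c v 2 := by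
  simp [sharp, M₃, upperM₃, halfSharp, ST, dotProduct, Matrix.mulVec, Fin.sum_univ_four]
  ring

lemma sharp_p3 : (sharp c v).p 3 = -(v.u * v.p 3) + halfSharp c v 3 := by
  simp [sharp, deltaVec, minor, minorMatrix, halfSharp, dotProduct, Fin.sum_univ_four]
  ring

/-- The cubic form `N_Υ`, without denominators. -/
def cubicN : R :=
  v.u * (sharp c v).u + (2 * c.z * v.p 0 - c.s 0 * v.p 1 + c.t 0 * v.p 3) * halfSharp c v 0
  + 2 * v.p 2 * halfSharp c v 2
  + (-(c.s 0 * v.p 0) + 2 * (c.s 2 ^ 2 - c.s 1 * c.s 3) * v.p 1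
      + (c.s 3 * c.t 1 - 2 * c.s 2 * c.t 2 + c.s 1 * c.t 3) * v.p 3) * halfSharp c v 1
  + (c.t 0 * v.p 0 + (c.s 3 * c.t 1 - 2 * c.s 2 * c.t 2 + c.s 1 * c.t 3) * v.p 1
      + 2 * (c.t 2 ^ 2 - c.t 1 * c.t 3) * v.p 3) * halfSharp c v 3

/-- This is Euler's identity T(σ♯,σ) = 3N(σ) in coordinates. Behind it are T(σ_0♯σ_{1/2}, σ_{1/2}) =
2T(σ_{1/2}♯, σ_0) and T(υ♯σ_0, σ_0) = 2S(σ_0). -/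
lemma three_mul_cubicN : 3 * cubicN c v = threeN c v := by
  rw [threeN, cubicN, sharp_p0, sharp_p1, sharp_p2, sharp_p3, sharp_x0, sharp_x1, sharp_y0,
    sharp_y1, sharp_u]
  simp only [halfSharp, ST, Matrix.cons_val_zero, Matrix.cons_val_one, Matrix.cons_val]
  ring

lemma aeval_cubicN : MvPolynomial.aeval (assign c v) (cubicN genericParam genericPoint) =
    cubicN c v := by
  simp only [cubicN, sharp_u, halfSharp, ST, genericParam, genericPoint, map_add, map_sub,
    map_mul, map_neg, map_pow, map_ofNat, MvPolynomial.aeval_X, assign, Matrix.cons_val_zero,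
    Matrix.cons_val_one, Matrix.cons_val]

end Explicit

end Upsilon

namespace CubicJordanAlgebra

variable {k J : Type*} [Field k] [AddCommGroup J] [Module k J]

/-! ### Multiplication table and bilinear trace on J_{1/2} -/

section Table

variable {A : CubicJordanAlgebra k J} {υ : J}

/-- A vector of `⋀² k⁴` that is annihilated by `s ∧ ·` and `t ∧ ·` is a multiple of `s ∧ t`. -/
lemma exists_eq_smul_wedge {s t : Fin 4 → k} {o01 o02 o03 o12 o13 o23 : k}
    (h1 : s 0 * o12 - s 1 * o02 + s 2 * o01 = 0) (h2 : s 0 * o13 - s 1 * o03 + s 3 * o01 = 0)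
    (h3 : s 0 * o23 - s 2 * o03 + s 3 * o02 = 0) (h4 : s 1 * o23 - s 2 * o13 + s 3 * o12 = 0)
    (h1' : t 0 * o12 - t 1 * o02 + t 2 * o01 = 0) (h2' : t 0 * o13 - t 1 * o03 + t 3 * o01 = 0)
    (h3' : t 0 * o23 - t 2 * o03 + t 3 * o02 = 0) (h4' : t 1 * o23 - t 2 * o13 + t 3 * o12 = 0)
    (h : s 0 * t 1 - s 1 * t 0 ≠ 0 ∨ s 1 * t 2 - s 2 * t 1 ≠ 0 ∨ s 1 * t 3 - s 3 * t 1 ≠ 0) :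
    ∃ κ, o01 = κ * (s 0 * t 1 - s 1 * t 0) ∧ o02 = κ * (s 0 * t 2 - s 2 * t 0) ∧
      o03 = κ * (s 0 * t 3 - s 3 * t 0) ∧ o12 = κ * (s 1 * t 2 - s 2 * t 1) ∧
      o13 = κ * (s 1 * t 3 - s 3 * t 1) ∧ o23 = κ * (s 2 * t 3 - s 3 * t 2) := by
  rcases h with h | h | h
  · refine ⟨o01 / (s 0 * t 1 - s 1 * t 0), ?_, ?_, ?_, ?_, ?_, ?_⟩ <;>
      rw [div_mul_eq_mul_div, eq_div_iff h]
    · linear_combination t 0 * h1 - s 0 * h1'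
    · linear_combination t 0 * h2 - s 0 * h2'
    · linear_combination t 1 * h1 - s 1 * h1'
    · linear_combination t 1 * h2 - s 1 * h2'
    · grind
  · refine ⟨o12 / (s 1 * t 2 - s 2 * t 1), ?_, ?_, ?_, ?_, ?_, ?_⟩ <;>
      rw [div_mul_eq_mul_div, eq_div_iff h]
    all_goals grind
  · refine ⟨o13 / (s 1 * t 3 - s 3 * t 1), ?_, ?_, ?_, ?_, ?_, ?_⟩ <;>
      rw [div_mul_eq_mul_div, eq_div_iff h]
    all_goals grind

/-- The values of the bilinear trace on `ψ₁, ψ₂, χ₁, χ₂` for a suitably scaled basis. -/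
structure IsNormalized (A : CubicJordanAlgebra k J) (π : Fin 4 → J) (ψ : Fin 2 → J)
    (c : UpsilonParam k) : Prop where
  psi00 : A.T (ψ 0) (ψ 0) = 4 * Upsilon.ST c 1 2
  psi01 : A.T (ψ 0) (ψ 1) = 2 * Upsilon.ST c 1 3
  psi11 : A.T (ψ 1) (ψ 1) = 4 * Upsilon.ST c 2 3
  chi00 : A.T (A.chi π ψ 0) (ψ 0) = 2 * Upsilon.ST c 0 1
  chi01 : A.T (A.chi π ψ 0) (ψ 1) = 2 * Upsilon.ST c 0 2
  chi11 : A.T (A.chi π ψ 1) (ψ 1) = 2 * Upsilon.ST c 0 3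

lemma T_chi_comm (π : Fin 4 → J) (ψ : Fin 2 → J) (i j : Fin 2) :
    A.T (A.chi π ψ i) (ψ j) = A.T (A.chi π ψ j) (ψ i) := by
  rw [chi, chi, map_neg, map_neg, LinearMap.neg_apply, LinearMap.neg_apply, T_sharpMul_right,
    A.T_comm (ψ i)]

lemma sharpMul_zero_psi (π : Fin 4 → J) (ψ : Fin 2 → J) (i : Fin 2) :
    A.sharpMul (π 0) (ψ i) = -A.chi π ψ i := (neg_neg _).symm

lemma halfPart_eq (π : Fin 4 → J) (ψ : Fin 2 → J) (v : UpsilonPoint k) :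
    A.halfPart π ψ v = v.x 0 • A.chi π ψ 0 + v.x 1 • A.chi π ψ 1 + v.y 0 • ψ 0 + v.y 1 • ψ 1 := by
  simp only [halfPart, Fin.sum_univ_two]; abel

lemma zeroPart_eq (π : Fin 4 → J) (v : UpsilonPoint k) :
    zeroPart π v = v.p 0 • π 0 + v.p 1 • π 1 + v.p 2 • π 2 + v.p 3 • π 3 := by
  simp only [zeroPart, Fin.sum_univ_four]

variable (h2 : (2 : k) ≠ 0) (hυ : A.IsPrimitiveIdempotent υ) {π : Fin 4 → J}
  (hπ : A.IsZeroFrame υ π) {ψ : Fin 2 → J} (hψ : ∀ i, ψ i ∈ A.peirceHalf υ) {c : UpsilonParam k}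
  (hc : A.IsParameters π ψ c)
include h2 hυ hπ hψ

lemma chi_mem (i : Fin 2) : A.chi π ψ i ∈ A.peirceHalf υ :=
  neg_mem (sharpMul_mem_half h2 hυ hπ.mem_zero (hψ i))

lemma halfPart_mem (v : UpsilonPoint k) : A.halfPart π ψ v ∈ A.peirceHalf υ := by
  have hχ := chi_mem h2 hυ hπ hψ
  rw [halfPart_eq]
  exact add_mem (add_mem (add_mem (Submodule.smul_mem _ _ (hχ 0)) (Submodule.smul_mem _ _ (hχ 1)))
    (Submodule.smul_mem _ _ (hψ 0))) (Submodule.smul_mem _ _ (hψ 1))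

/-- Moving a past π₁ by the Clifford relation reduces the products with χ_i to those with ψ_i. -/
lemma sharpMul_chi {a : J} (ha : a ∈ A.tracelessZero υ) (i : Fin 2) :
    A.sharpMul a (A.chi π ψ i) =
      QuadraticMap.polar A.S (π 0) a • ψ i + A.sharpMul (π 0) (A.sharpMul a (ψ i)) := by
  have h := clifford h2 hυ hπ.mem_zero ha (hψ i)
  rw [chi, map_neg]
  linear_combination (norm := module) -h

include hc

lemma sharpMul_zero_chi (i : Fin 2) : A.sharpMul (π 0) (A.chi π ψ i) = -c.z • ψ i := by
  rw [chi, map_neg, clifford_sq h2 hυ hπ.mem_zero (hψ i), hc.z]; module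

lemma sharpMul_one_chi0 : A.sharpMul (π 1) (A.chi π ψ 0) =
    c.s 0 • ψ 0 + c.s 2 • A.chi π ψ 0 - c.s 1 • A.chi π ψ 1 := by
  rw [sharpMul_chi h2 hυ hπ hψ hπ.mem_one, hc.pi2_psi1, ← hc.s1, map_add, map_smul, map_smul,
    sharpMul_zero_psi, sharpMul_zero_psi]
  module

lemma sharpMul_one_chi1 : A.sharpMul (π 1) (A.chi π ψ 1) =
    c.s 0 • ψ 1 + c.s 3 • A.chi π ψ 0 - c.s 2 • A.chi π ψ 1 := by
  rw [sharpMul_chi h2 hυ hπ hψ hπ.mem_one, hc.pi2_psi2, ← hc.s1, map_add, map_smul, map_smul,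
    sharpMul_zero_psi, sharpMul_zero_psi]
  module

lemma sharpMul_three_chi0 : A.sharpMul (π 3) (A.chi π ψ 0) =
    -c.t 0 • ψ 0 - c.t 2 • A.chi π ψ 0 + c.t 1 • A.chi π ψ 1 := by
  rw [sharpMul_chi h2 hυ hπ hψ hπ.mem_three, hc.pi4_psi1, hc.t1, map_sub, map_smul, map_smul,
    sharpMul_zero_psi, sharpMul_zero_psi]
  module

lemma sharpMul_three_chi1 : A.sharpMul (π 3) (A.chi π ψ 1) =
    -c.t 0 • ψ 1 - c.t 3 • A.chi π ψ 0 + c.t 2 • A.chi π ψ 1 := by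
  rw [sharpMul_chi h2 hυ hπ hψ hπ.mem_three, hc.pi4_psi2, hc.t1, map_sub, map_smul, map_smul,
    sharpMul_zero_psi, sharpMul_zero_psi]
  module

lemma T_chi_chi (i j : Fin 2) :
    A.T (A.chi π ψ i) (A.chi π ψ j) = c.z * A.T (ψ i) (ψ j) := by
  nth_rw 1 [chi]
  rw [map_neg, LinearMap.neg_apply, T_sharpMul_right, sharpMul_zero_chi h2 hυ hπ hψ hc, map_smul,
    smul_eq_mul]
  ring

section Scalars

variable (hψ0 : ψ 0 ≠ 0)
include hψ0

lemma S_one : A.S (π 1) = c.s 1 * c.s 3 - c.s 2 ^ 2 := by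
  have h := clifford_sq h2 hυ hπ.mem_one (hψ 0)
  simp only [hc.pi2_psi1, hc.pi2_psi2, map_add, map_smul] at h
  have h3 : (A.S (π 1) - (c.s 1 * c.s 3 - c.s 2 ^ 2)) • ψ 0 = 0 := by
    linear_combination (norm := module) h
  exact sub_eq_zero.1 ((smul_eq_zero.1 h3).resolve_right hψ0)

lemma S_three : A.S (π 3) = c.t 1 * c.t 3 - c.t 2 ^ 2 := by
  have h := clifford_sq h2 hυ hπ.mem_three (hψ 0)
  simp only [hc.pi4_psi1, hc.pi4_psi2, map_sub, map_smul] at h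
  have h3 : (A.S (π 3) - (c.t 1 * c.t 3 - c.t 2 ^ 2)) • ψ 0 = 0 := by
    linear_combination (norm := module) h
  exact sub_eq_zero.1 ((smul_eq_zero.1 h3).resolve_right hψ0)

lemma polar_S_one_three : QuadraticMap.polar A.S (π 1) (π 3) =
    -(c.s 3 * c.t 1 - 2 * c.s 2 * c.t 2 + c.s 1 * c.t 3) := by
  have h := clifford h2 hυ hπ.mem_one hπ.mem_three (hψ 0)
  simp only [hc.pi2_psi1, hc.pi2_psi2, hc.pi4_psi1, hc.pi4_psi2, map_add, map_sub, map_smul] at h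
  have h3 : (QuadraticMap.polar A.S (π 1) (π 3) +
      (c.s 3 * c.t 1 - 2 * c.s 2 * c.t 2 + c.s 1 * c.t 3)) • ψ 0 = 0 := by
    linear_combination (norm := module) h
  exact eq_neg_of_add_eq_zero_left ((smul_eq_zero.1 h3).resolve_right hψ0)

/-- `s` and `t` are linearly independent. -/
lemma ST_ne_zero (hA : A.IsNondegenerate) (hs : c.s 1 ≠ 0) :
    Upsilon.ST c 0 1 ≠ 0 ∨ Upsilon.ST c 1 2 ≠ 0 ∨ Upsilon.ST c 1 3 ≠ 0 := by
  by_contra! h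
  obtain ⟨h01, h12, h13⟩ := h
  rw [Upsilon.ST] at h01 h12 h13
  -- If the three minors vanish, d = t₂π₂ + s₂π₄ kills ψ₁ and ψ₂ and is S-orthogonal to the whole
  -- frame, hence zero; but s₂ ≠ 0.
  set d := c.t 1 • π 1 + c.s 1 • π 3 with hd
  have hdW : d ∈ A.tracelessZero υ :=
    add_mem (Submodule.smul_mem _ _ hπ.mem_one) (Submodule.smul_mem _ _ hπ.mem_three)
  have hd0 : A.sharpMul d (ψ 0) = 0 := by
    simp only [hd, map_add, map_smul, LinearMap.add_apply, LinearMap.smul_apply, hc.pi2_psi1,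
      hc.pi4_psi1]
    have h3 : (c.s 1 * c.t 2 - c.s 2 * c.t 1) • ψ 0 = 0 := by rw [h12, zero_smul]
    linear_combination (norm := module) h3
  have hd1 : A.sharpMul d (ψ 1) = 0 := by
    simp only [hd, map_add, map_smul, LinearMap.add_apply, LinearMap.smul_apply, hc.pi2_psi2,
      hc.pi4_psi2]
    have h3 : (c.s 1 * c.t 3 - c.s 3 * c.t 1) • ψ 0 - (c.s 1 * c.t 2 - c.s 2 * c.t 1) • ψ 1 = 0 := by
      rw [h12, h13, zero_smul, zero_smul, sub_zero]
    linear_combination (norm := module) h3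
  have h3 : d = 0 := by
    apply hπ.eq_zero_of_polar h2 hυ hA hdW
    · rw [hd, QuadraticMap.polar_comm, QuadraticMap.polar_add_right, QuadraticMap.polar_smul_right,
        QuadraticMap.polar_smul_right, ← hc.s1, ← neg_neg (QuadraticMap.polar A.S (π 0) (π 3)),
        ← hc.t1, smul_eq_mul, smul_eq_mul]
      linear_combination h01
    · have h4 := clifford h2 hυ hdW hπ.mem_one (hψ 0)
      simp only [hd0, hc.pi2_psi1, map_add, map_smul, hd1, smul_zero, add_zero, map_zero] at h4
      simpa [hψ0] using h4.symm
    · have h4 := clifford h2 hυ hdW hπ.mem_three (hψ 0)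
      simp only [hd0, hc.pi4_psi1, map_sub, map_smul, hd1, smul_zero, add_zero, sub_zero,
        map_zero] at h4
      simpa [hψ0] using h4.symm
  exact hs (hπ.eq_zero_of_smul_add_smul h3).2

/-- Self-adjointness of π₂ and of π₄ gives four linear equations each on the values of T. They are
the components of s∧o = 0 and t∧o = 0 for the 2-vector o formed from these values, so o is a
multiple of s∧t. A zero multiple would make ψ₁ orthogonal to H. -/
lemma exists_normalization (hA : A.IsNondegenerate) (hs : c.s 1 ≠ 0)
    (hH : ∀ x ∈ A.peirceHalf υ, ∃ v : UpsilonPoint k, x = A.halfPart π ψ v) :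
    ∃ κ : k, κ ≠ 0 ∧ A.T (ψ 0) (ψ 0) = κ * (4 * Upsilon.ST c 1 2) ∧
      A.T (ψ 0) (ψ 1) = κ * (2 * Upsilon.ST c 1 3) ∧
      A.T (ψ 1) (ψ 1) = κ * (4 * Upsilon.ST c 2 3) ∧
      A.T (A.chi π ψ 0) (ψ 0) = κ * (2 * Upsilon.ST c 0 1) ∧
      A.T (A.chi π ψ 0) (ψ 1) = κ * (2 * Upsilon.ST c 0 2) ∧
      A.T (A.chi π ψ 1) (ψ 1) = κ * (2 * Upsilon.ST c 0 3) := by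
  have h4 : (4 : k) ≠ 0 := by
    rw [show (4 : k) = 2 * 2 by norm_num]; exact mul_ne_zero h2 h2
  have hχ := T_chi_comm (A := A) π ψ 1 0
  have e1 := A.T_sharpMul_right (π 1) (ψ 0) (ψ 1)
  have e2 := A.T_sharpMul_right (π 1) (A.chi π ψ 0) (ψ 0)
  have e3 := A.T_sharpMul_right (π 1) (A.chi π ψ 0) (ψ 1)
  have e4 := A.T_sharpMul_right (π 1) (A.chi π ψ 1) (ψ 1)
  have f1 := A.T_sharpMul_right (π 3) (ψ 0) (ψ 1)
  have f2 := A.T_sharpMul_right (π 3) (A.chi π ψ 0) (ψ 0)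
  have f3 := A.T_sharpMul_right (π 3) (A.chi π ψ 0) (ψ 1)
  have f4 := A.T_sharpMul_right (π 3) (A.chi π ψ 1) (ψ 1)
  simp only [hc.pi2_psi1, hc.pi2_psi2, hc.pi4_psi1, hc.pi4_psi2,
    sharpMul_one_chi0 h2 hυ hπ hψ hc, sharpMul_one_chi1 h2 hυ hπ hψ hc,
    sharpMul_three_chi0 h2 hυ hπ hψ hc, sharpMul_three_chi1 h2 hυ hπ hψ hc, map_add, map_sub,
    map_smul, LinearMap.add_apply, LinearMap.sub_apply, LinearMap.smul_apply, smul_eq_mul,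
    hχ] at e1 e2 e3 e4 f1 f2 f3 f4
  obtain ⟨κ, g1, g2, g3, g4, g5, g6⟩ := exists_eq_smul_wedge (s := c.s) (t := c.t)
    (o01 := 2 * A.T (A.chi π ψ 0) (ψ 0)) (o02 := 2 * A.T (A.chi π ψ 0) (ψ 1))
    (o03 := 2 * A.T (A.chi π ψ 1) (ψ 1)) (o12 := A.T (ψ 0) (ψ 0))
    (o13 := 2 * A.T (ψ 0) (ψ 1)) (o23 := A.T (ψ 1) (ψ 1))
    (by linear_combination e2) (by linear_combination 2 * e3) (by linear_combination e4)
    (by linear_combination e1) (by linear_combination -f2) (by linear_combination -2 * f3)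
    (by linear_combination -f4) (by linear_combination -f1)
    (ST_ne_zero h2 hυ hπ hψ hc hψ0 hA hs)
  -- The mixed values enter o doubled, so κ = 4μ produces the factors 4 and 2 of `IsNormalized`.
  obtain ⟨μ, rfl⟩ : ∃ μ, κ = 4 * μ := ⟨κ / 4, by field_simp⟩
  have hhalf : ∀ p q : k, 2 * p = 4 * μ * q → p = μ * (2 * q) := fun p q h =>
    mul_left_cancel₀ h2 (by linear_combination h)
  refine ⟨μ, ?_, ?_, ?_, ?_, ?_, ?_, ?_⟩
  · rintro rfl
    rw [mul_zero, zero_mul] at g1 g2 g4 g5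
    apply hψ0
    apply eq_zero_of_mem_half h2 hυ hA (hψ 0)
    intro x hx
    obtain ⟨v, rfl⟩ := hH x hx
    rw [halfPart_eq]
    simp only [map_add, map_smul, A.T_comm (ψ 0) (A.chi π ψ _), hχ, g4,
      (mul_eq_zero.1 g1).resolve_left h2, (mul_eq_zero.1 g2).resolve_left h2,
      (mul_eq_zero.1 g5).resolve_left h2, smul_zero, add_zero]
  · rw [g4, Upsilon.ST]; ring
  · exact hhalf _ _ g5
  · rw [g6, Upsilon.ST]; ring
  · exact hhalf _ _ g1
  · exact hhalf _ _ g2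
  · exact hhalf _ _ g3

end Scalars

end Table
end CubicJordanAlgebra

namespace CubicJordanAlgebra

variable {k J : Type*} [Field k] [AddCommGroup J] [Module k J]

/-! ### The formulas for ♯ and N in coordinates -/

section Formulas

variable {A : CubicJordanAlgebra k J} {υ : J}

/-- Matrices on V do not change when both basis vectors are scaled by the same factor; this leaves T
free to be normalized. -/
lemma IsParameters.smul {π : Fin 4 → J} {ψ : Fin 2 → J} {c : UpsilonParam k}
    (hc : A.IsParameters π ψ c) (γ : k) : A.IsParameters π ![γ • ψ 0, γ • ψ 1] c := by
  constructor
  · exact hc.s1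
  · exact hc.t1
  · exact hc.z
  all_goals
    simp only [Matrix.cons_val_zero, Matrix.cons_val_one, map_smul, hc.pi2_psi1, hc.pi2_psi2,
      hc.pi4_psi1, hc.pi4_psi2]
    module

variable (h2 : (2 : k) ≠ 0) (hυ : A.IsPrimitiveIdempotent υ) {π : Fin 4 → J}
  (hπ : A.IsZeroFrame υ π) {ψ : Fin 2 → J}
include h2 hυ hπ

lemma zeroPart_mem (v : UpsilonPoint k) : zeroPart π v ∈ A.peirceZero υ := by
  rw [zeroPart_eq, hπ.pi3]
  exact add_mem (add_mem (add_mem (Submodule.smul_mem _ _ hπ.mem_zero.1)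
    (Submodule.smul_mem _ _ hπ.mem_one.1)) (Submodule.smul_mem _ _ (compl_mem_peirceZero h2 hυ)))
    (Submodule.smul_mem _ _ hπ.mem_three.1)

lemma sharpMul_idem_zeroPart (v : UpsilonPoint k) : A.sharpMul υ (zeroPart π v) =
    -(v.p 0 • π 0) - v.p 1 • π 1 + v.p 2 • π 2 - v.p 3 • π 3 := by
  have h3 : A.sharpMul υ (π 2) = π 2 := by rw [hπ.pi3, sharpMul_idem_compl h2 hυ]
  rw [zeroPart_eq]
  simp only [map_add, map_smul, (mem_tracelessZero h2 hυ).1 hπ.mem_zero,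
    (mem_tracelessZero h2 hυ).1 hπ.mem_one, (mem_tracelessZero h2 hυ).1 hπ.mem_three, h3]
  module

lemma polar_S_compl {w : J} (hw : w ∈ A.tracelessZero υ) :
    QuadraticMap.polar A.S (π 2) w = 0 := by
  rw [polar_S, hπ.pi3, sharpMul_compl_traceless h2 hυ hw, map_zero]

lemma S_two : A.S (π 2) = 1 := by
  rw [S_apply, hπ.pi3, sharp_compl h2 hυ, hυ.tr_eq h2]

lemma exists_zeroPart {x : J} (hx : x ∈ A.peirceZero υ) :
    ∃ v : UpsilonPoint k, x = zeroPart π v := by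
  rw [peirceZero_eq h2 hυ] at hx
  obtain ⟨e, he, w, hw, rfl⟩ := Submodule.mem_sup.1 hx
  obtain ⟨b, rfl⟩ := Submodule.mem_span_singleton.1 he
  obtain ⟨p, q, r, rfl⟩ := hπ.exists_eq hw
  refine ⟨⟨0, ![p, q, b, r], 0, 0⟩, ?_⟩
  rw [zeroPart_eq, hπ.pi3]
  simp only [Matrix.cons_val_zero, Matrix.cons_val_one, Matrix.cons_val]
  module

lemma sharp_zeroPart (v : UpsilonPoint k) :
    A.sharp (zeroPart π v) = A.S (zeroPart π v) • υ := by
  set w := v.p 0 • π 0 + v.p 1 • π 1 + v.p 3 • π 3 with hw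
  have hwW : w ∈ A.tracelessZero υ := add_mem (add_mem (Submodule.smul_mem _ _ hπ.mem_zero)
    (Submodule.smul_mem _ _ hπ.mem_one)) (Submodule.smul_mem _ _ hπ.mem_three)
  have h : zeroPart π v = v.p 2 • π 2 + w := by rw [zeroPart_eq, hw]; abel
  have hmul : A.sharpMul (π 2) w = 0 := by rw [hπ.pi3, sharpMul_compl_traceless h2 hυ hwW]
  have hsh : A.sharp (π 2) = υ := by rw [hπ.pi3, sharp_compl h2 hυ]
  rw [h, sharp_add, S_add, sharp_smul, QuadraticMap.map_smul, QuadraticMap.polar_smul_left,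
    polar_S_compl h2 hυ hπ hwW, S_two h2 hυ hπ, sharp_traceless h2 hυ hwW, hsh, map_smul,
    LinearMap.smul_apply, hmul]
  simp only [smul_eq_mul]
  module

variable {c : UpsilonParam k} (hc : A.IsParameters π ψ c)
include hc

section Psi

variable (hψ : ∀ i, ψ i ∈ A.peirceHalf υ) (hψ0 : ψ 0 ≠ 0)
include hψ

lemma sharpMul_zeroPart_halfPart (v : UpsilonPoint k) :
    A.sharpMul (zeroPart π v) (A.halfPart π ψ v) = A.halfPart π ψ (Upsilon.sharp c v) := by
  have hχ := chi_mem h2 hυ hπ hψ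
  have hπ2 : ∀ x ∈ A.peirceHalf υ, A.sharpMul (π 2) x = -x := fun x hx => by
    rw [hπ.pi3, sharpMul_compl_half h2 hυ hx]
  rw [halfPart_eq, halfPart_eq, zeroPart_eq, Upsilon.sharp_x0, Upsilon.sharp_x1, Upsilon.sharp_y0,
    Upsilon.sharp_y1]
  simp only [map_add, map_smul, LinearMap.add_apply, LinearMap.smul_apply, hπ2 _ (hψ _),
    hπ2 _ (hχ _), sharpMul_zero_psi, sharpMul_zero_chi h2 hυ hπ hψ hc, hc.pi2_psi1, hc.pi2_psi2,
    hc.pi4_psi1, hc.pi4_psi2, sharpMul_one_chi0 h2 hυ hπ hψ hc, sharpMul_one_chi1 h2 hυ hπ hψ hc,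
    sharpMul_three_chi0 h2 hυ hπ hψ hc, sharpMul_three_chi1 h2 hυ hπ hψ hc]
  module

include hψ0

lemma S_zeroPart (v : UpsilonPoint k) : A.S (zeroPart π v) = (Upsilon.sharp c v).u := by
  have hz : A.S (π 0) = -c.z := by rw [hc.z, neg_neg]
  have ht : QuadraticMap.polar A.S (π 0) (π 3) = -c.t 0 := by rw [hc.t1, neg_neg]
  rw [zeroPart_eq, Upsilon.sharp_u]
  simp only [S_add, QuadraticMap.map_smul, QuadraticMap.polar_add_left,
    QuadraticMap.polar_add_right, QuadraticMap.polar_smul_left, QuadraticMap.polar_smul_right,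
    polar_S_compl h2 hυ hπ hπ.mem_three, QuadraticMap.polar_comm A.S _ (π 2),
    polar_S_compl h2 hυ hπ hπ.mem_zero, polar_S_compl h2 hυ hπ hπ.mem_one, ← hc.s1, ht,
    hz, S_two h2 hυ hπ, S_one h2 hυ hπ hψ hc hψ0, S_three h2 hυ hπ hψ hc hψ0,
    polar_S_one_three h2 hυ hπ hψ hc hψ0, smul_eq_mul]
  ring

/-- The Gram matrix of the bilinear trace on `J_0`. -/
lemma T_zeroPart (q v : UpsilonPoint k) : A.T (zeroPart π q) (zeroPart π v) =
    (2 * c.z * v.p 0 - c.s 0 * v.p 1 + c.t 0 * v.p 3) * q.p 0 + 2 * v.p 2 * q.p 2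
    + (-(c.s 0 * v.p 0) + 2 * (c.s 2 ^ 2 - c.s 1 * c.s 3) * v.p 1
        + (c.s 3 * c.t 1 - 2 * c.s 2 * c.t 2 + c.s 1 * c.t 3) * v.p 3) * q.p 1
    + (c.t 0 * v.p 0 + (c.s 3 * c.t 1 - 2 * c.s 2 * c.t 2 + c.s 1 * c.t 3) * v.p 1
        + 2 * (c.t 2 ^ 2 - c.t 1 * c.t 3) * v.p 3) * q.p 3 := by
  have h00 : A.T (π 0) (π 0) = 2 * c.z := by
    rw [T_traceless h2 hυ hπ.mem_zero, QuadraticMap.polar_self, hc.z]; simp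
  have h01 : A.T (π 0) (π 1) = -c.s 0 := by rw [T_traceless h2 hυ hπ.mem_zero, hc.s1]
  have h03 : A.T (π 0) (π 3) = c.t 0 := by rw [T_traceless h2 hυ hπ.mem_zero, hc.t1]
  have h11 : A.T (π 1) (π 1) = 2 * (c.s 2 ^ 2 - c.s 1 * c.s 3) := by
    rw [T_traceless h2 hυ hπ.mem_one, QuadraticMap.polar_self, S_one h2 hυ hπ hψ hc hψ0, two_nsmul]
    ring
  have h13 : A.T (π 1) (π 3) = c.s 3 * c.t 1 - 2 * c.s 2 * c.t 2 + c.s 1 * c.t 3 := by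
    rw [T_traceless h2 hυ hπ.mem_one, polar_S_one_three h2 hυ hπ hψ hc hψ0, neg_neg]
  have h33 : A.T (π 3) (π 3) = 2 * (c.t 2 ^ 2 - c.t 1 * c.t 3) := by
    rw [T_traceless h2 hυ hπ.mem_three, QuadraticMap.polar_self, S_three h2 hυ hπ hψ hc hψ0,
      two_nsmul]
    ring
  have h22 : A.T (π 2) (π 2) = 2 := by rw [hπ.pi3, T_compl_self h2 hυ]
  have hw : ∀ w ∈ A.tracelessZero υ, A.T (π 2) w = 0 := fun w hw => by
    rw [hπ.pi3, T_compl_traceless h2 hυ hw]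
  rw [zeroPart_eq, zeroPart_eq]
  simp only [map_add, map_smul, LinearMap.add_apply, LinearMap.smul_apply, h00, h01, h03, h11,
    h13, h33, h22, A.T_comm (π 1) (π 0), A.T_comm (π 3) (π 0), A.T_comm (π 3) (π 1),
    A.T_comm _ (π 2), hw _ hπ.mem_zero, hw _ hπ.mem_one, hw _ hπ.mem_three, smul_eq_mul]
  ring

/-- Both sides lie in J_0, where T is nondegenerate, so it suffices to compare T with J_0. On the
left T(x♯,p) = ½T(p♯x,x) is known from the table and the normalized values; on the right stands the
Gram matrix `T_zeroPart`. -/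
lemma sharp_halfPart (hA : A.IsNondegenerate) (hN : A.IsNormalized π ψ c) (v : UpsilonPoint k) :
    A.sharp (A.halfPart π ψ v) = Upsilon.halfSharp c v 0 • π 0 + Upsilon.halfSharp c v 1 • π 1
      + Upsilon.halfSharp c v 2 • π 2 + Upsilon.halfSharp c v 3 • π 3 := by
  have hχ := chi_mem h2 hυ hπ hψ
  have hx := halfPart_mem h2 hυ hπ hψ v
  have hπ2 : ∀ x ∈ A.peirceHalf υ, A.sharpMul (π 2) x = -x := fun x hx => by
    rw [hπ.pi3, sharpMul_compl_half h2 hυ hx]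
  let q : UpsilonPoint k := ⟨0, Upsilon.halfSharp c v, 0, 0⟩
  have hq : Upsilon.halfSharp c v 0 • π 0 + Upsilon.halfSharp c v 1 • π 1
      + Upsilon.halfSharp c v 2 • π 2 + Upsilon.halfSharp c v 3 • π 3 = zeroPart π q :=
    (zeroPart_eq π q).symm
  have key : ∀ w : UpsilonPoint k,
      A.T (A.sharp (A.halfPart π ψ v)) (zeroPart π w) = A.T (zeroPart π q) (zeroPart π w) := by
    intro w
    have h10 : A.T (A.chi π ψ 1) (ψ 0) = 2 * Upsilon.ST c 0 2 := by rw [T_chi_comm, hN.chi01]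
    rw [T_zeroPart h2 hυ hπ hc hψ hψ0, T_sharp_left h2]
    apply mul_left_cancel₀ h2
    rw [mul_inv_cancel_left₀ h2, zeroPart_eq, halfPart_eq]
    simp only [map_add, map_smul, LinearMap.add_apply, LinearMap.smul_apply, hπ2 _ (hψ _),
      hπ2 _ (hχ _), sharpMul_zero_psi, sharpMul_zero_chi h2 hυ hπ hψ hc, hc.pi2_psi1, hc.pi2_psi2,
      hc.pi4_psi1, hc.pi4_psi2, sharpMul_one_chi0 h2 hυ hπ hψ hc,
      sharpMul_one_chi1 h2 hυ hπ hψ hc, sharpMul_three_chi0 h2 hυ hπ hψ hc,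
      sharpMul_three_chi1 h2 hυ hπ hψ hc, map_neg, map_sub, LinearMap.neg_apply,
      LinearMap.sub_apply, A.T_comm (ψ _) (A.chi π ψ _), T_chi_chi h2 hυ hπ hψ hc,
      A.T_comm (ψ 1) (ψ 0), hN.psi00, hN.psi01, hN.psi11, hN.chi00, hN.chi01, hN.chi11, h10,
      smul_eq_mul, q, Upsilon.halfSharp, Upsilon.ST, Matrix.cons_val_zero, Matrix.cons_val_one,
      Matrix.cons_val]
    ring
  rw [hq, ← sub_eq_zero]
  apply eq_zero_of_mem_zero h2 hυ hA (sub_mem (sharp_half_mem h2 hυ hx) (zeroPart_mem h2 hυ hπ q))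
  · obtain ⟨w, hw⟩ := exists_zeroPart h2 hυ hπ (compl_mem_peirceZero h2 hυ)
    rw [hw, map_sub, LinearMap.sub_apply, key, sub_self]
  · intro y hy
    obtain ⟨w, hw⟩ := exists_zeroPart h2 hυ hπ hy.1
    rw [hw, map_sub, LinearMap.sub_apply, key, sub_self]

lemma sharp_halfPart_add (hA : A.IsNondegenerate) (hN : A.IsNormalized π ψ c)
    (v : UpsilonPoint k) : A.sharp (A.halfPart π ψ v) + v.u • A.sharpMul υ (zeroPart π v) =
      zeroPart π (Upsilon.sharp c v) := by
  rw [sharp_halfPart h2 hυ hπ hc hψ hψ0 hA hN, sharpMul_idem_zeroPart h2 hυ hπ,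
    zeroPart_eq π (Upsilon.sharp c v), Upsilon.sharp_p0, Upsilon.sharp_p1, Upsilon.sharp_p2,
    Upsilon.sharp_p3]
  module

lemma sharp_element (hA : A.IsNondegenerate) (hN : A.IsNormalized π ψ c) (v : UpsilonPoint k) :
    A.sharp (A.element υ π ψ v) = A.element υ π ψ (Upsilon.sharp c v) := by
  have hx := halfPart_mem h2 hυ hπ hψ v
  rw [element, element, sharp_add, sharp_add, sharp_smul, hυ.sharp_eq,
    sharp_zeroPart h2 hυ hπ, S_zeroPart h2 hυ hπ hc hψ hψ0, map_add, LinearMap.add_apply, map_smul,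
    LinearMap.smul_apply, LinearMap.smul_apply, ((mem_peirceHalf h2 hυ).1 hx).1,
    sharpMul_zeroPart_halfPart h2 hυ hπ hc hψ, ← sharp_halfPart_add h2 hυ hπ hc hψ hψ0 hA hN]
  module

/-- N vanishes at υ, on J_0 and on H, and Peirce orthogonality leaves only u S(σ_0) + T(σ_{1/2}♯,
σ_0) in the expansion. -/
lemma N_element (hA : A.IsNondegenerate) (hN : A.IsNormalized π ψ c) (v : UpsilonPoint k) :
    A.N (A.element υ π ψ v) = Upsilon.cubicN c v := by
  have hx := halfPart_mem h2 hυ hπ hψ v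
  have hp := zeroPart_mem h2 hυ hπ v
  have hN0 : ∀ x : J, A.sharp (A.sharp x) = 0 → A.N x = 0 := by
    intro x h
    rw [A.sharp_sharp'] at h
    rcases smul_eq_zero.1 h with h | rfl
    · exact h
    · simpa using A.N_smul 0 0
  have hsx := sharp_half_mem h2 hυ hx
  -- Since x♯ is in J_0, x♯♯ is a multiple of υ; it also equals N(x)x in H, so it is zero.
  have hNx : A.N (A.halfPart π ψ v) = 0 := by
    apply hN0
    obtain ⟨w, hw⟩ := exists_zeroPart h2 hυ hπ hsx
    have h := A.sharp_sharp' (A.halfPart π ψ v)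
    rw [hw, sharp_zeroPart h2 hυ hπ] at h ⊢
    have h3 := congrArg (A.T υ) h
    rw [map_smul, map_smul, T_idem_self h2 hυ, ((mem_peirceHalf h2 hυ).1 hx).2.1] at h3
    have h4 : A.S (zeroPart π w) = 0 := by simpa using h3
    rw [h4, zero_smul]
  have hNp : A.N (zeroPart π v) = 0 := by
    apply hN0
    rw [sharp_zeroPart h2 hυ hπ, sharp_smul, hυ.sharp_eq, smul_zero]
  have hNυ : A.N υ = 0 := by
    apply hN0
    rw [hυ.sharp_eq]; simp
  have hυp : A.sharpMul υ (zeroPart π v) ∈ A.peirceZero υ := by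
    rw [(mem_peirceZero h2 hυ).1 hp]
    exact sub_mem (Submodule.smul_mem _ _ (compl_mem_peirceZero h2 hυ)) hp
  have hT : A.T (A.sharp (A.halfPart π ψ v)) (zeroPart π v) =
      A.T (zeroPart π ⟨0, Upsilon.halfSharp c v, 0, 0⟩) (zeroPart π v) := by
    rw [sharp_halfPart h2 hυ hπ hc hψ hψ0 hA hN, zeroPart_eq π ⟨0, _, 0, 0⟩]
  rw [T_zeroPart h2 hυ hπ hc hψ hψ0] at hT
  rw [element, N_add, N_add, sharp_add, sharp_smul, hυ.sharp_eq, sharp_zeroPart h2 hυ hπ, N_smul,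
    hNυ, hNp, hNx]
  simp only [map_add, map_smul, LinearMap.add_apply, LinearMap.smul_apply, smul_zero, map_zero,
    LinearMap.zero_apply, T_idem_self h2 hυ, ((mem_peirceHalf h2 hυ).1 hx).2.1,
    T_peirceZero_half h2 hυ hυp hx, A.T_comm _ υ, T_idem_peirceZero h2 hυ hsx, hT, smul_eq_mul]
  rw [S_zeroPart h2 hυ hπ hc hψ hψ0, Upsilon.cubicN]
  ring

end Psi

omit hc

omit h2 hυ hπ in
/-- Every element of `J_{1/2}` has coordinates with respect to a basis of a good plane. -/
lemma exists_halfPart {V : Submodule k J} (hV : A.IsGoodPlane υ π V)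
    (hspan : Submodule.span k (Set.range ψ) = V) {x : J} (hx : x ∈ A.peirceHalf υ) :
    ∃ v : UpsilonPoint k, x = A.halfPart π ψ v := by
  obtain ⟨y, hy, w, hw, rfl⟩ := hV.exists_eq x hx
  rw [← hspan, Submodule.mem_span_range_iff_exists_fun] at hy hw
  obtain ⟨p, rfl⟩ := hy
  obtain ⟨q, rfl⟩ := hw
  -- The sign comes from χ_i = −π₁♯ψ_i.
  refine ⟨⟨0, 0, -q, p⟩, ?_⟩
  simp only [halfPart_eq, Fin.sum_univ_two, map_add, map_smul, sharpMul_zero_psi, Pi.neg_apply]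
  module

lemma isAdaptedBasis (hdim : Module.finrank k J = 9) (hψ : ∀ i, ψ i ∈ A.peirceHalf υ)
    (hH : ∀ x ∈ A.peirceHalf υ, ∃ v : UpsilonPoint k, x = A.halfPart π ψ v) :
    A.IsAdaptedBasis υ π ψ := by
  have hχ := chi_mem h2 hυ hπ hψ
  have hspan : Submodule.span k (Set.range
      ![υ, π 0, π 1, π 2, π 3, ψ 0, ψ 1, A.chi π ψ 0, A.chi π ψ 1]) = ⊤ := by
    rw [eq_top_iff]
    intro x _
    obtain ⟨a, b, w, hw, y, hy, rfl⟩ := exists_peirce h2 hυ x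
    obtain ⟨p, q, r, rfl⟩ := hπ.exists_eq hw
    obtain ⟨v, rfl⟩ := hH y hy
    rw [Submodule.mem_span_range_iff_exists_fun]
    refine ⟨![a, p, q, b, r, v.y 0, v.y 1, v.x 0, v.x 1], ?_⟩
    rw [halfPart_eq, ← hπ.pi3]
    simp [Fin.sum_univ_succ]
    abel
  refine ⟨linearIndependent_of_top_le_span_of_card_eq_finrank hspan.ge (by simp [hdim]), hspan,
    (peirceOne_eq h2 hυ).symm, ?_, ?_⟩
  · apply le_antisymm
    · rw [Submodule.span_le]
      rintro _ ⟨i, rfl⟩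
      fin_cases i
      · exact hπ.mem_zero.1
      · exact hπ.mem_one.1
      · change π 2 ∈ A.peirceZero υ
        rw [hπ.pi3]
        exact compl_mem_peirceZero h2 hυ
      · exact hπ.mem_three.1
    · intro x hx
      obtain ⟨v, rfl⟩ := exists_zeroPart h2 hυ hπ hx
      exact Submodule.sum_mem _ fun i _ =>
        Submodule.smul_mem _ _ (Submodule.subset_span ⟨i, rfl⟩)
  · apply le_antisymm
    · rw [Submodule.span_le]
      rintro _ (⟨i, rfl⟩ | ⟨i, rfl⟩)
      · exact hψ i
      · exact hχ i
    · intro x hx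
      obtain ⟨v, rfl⟩ := hH x hx
      exact add_mem
        (Submodule.sum_mem _ fun i _ =>
          Submodule.smul_mem _ _ (Submodule.subset_span (Or.inr ⟨i, rfl⟩)))
        (Submodule.sum_mem _ fun i _ =>
          Submodule.smul_mem _ _ (Submodule.subset_span (Or.inl ⟨i, rfl⟩)))

end Formulas
end CubicJordanAlgebra

/-! ### The theorem -/

theorem mainTheorem4 {k J : Type*} [Field k] [IsAlgClosed k] (h2 : (2 : k) ≠ 0)
    [AddCommGroup J] [Module k J] (hdim : Module.finrank k J = 9)
    (A : CubicJordanAlgebra k J) (hA : A.IsNondegenerate) (hsimple : A.IsSimple)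
    (υ : J) (hυ : A.IsPrimitiveIdempotent υ) :
    -- `N_Υ` has integer coefficients
    ∃ NΥ : MvPolynomial Upsilon.Var ℤ,
      3 * NΥ = Upsilon.threeN Upsilon.genericParam Upsilon.genericPoint ∧
      -- the choices leading to the coordinates are possible
      (∃ π, A.IsZeroFrame υ π ∧ A.S (π 1) ≠ 0 ∧ A.S (π 3) ≠ 0) ∧
      (∀ π, A.IsZeroFrame υ π → ∃ V, A.IsGoodPlane υ π V) ∧
      (∀ π V, A.IsZeroFrame υ π → A.IsGoodPlane υ π V → A.S (π 1) ≠ 0 → A.S (π 3) ≠ 0 →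
        ∃ (ψ : Fin 2 → J) (c : UpsilonParam k), LinearIndependent k ψ ∧
          Submodule.span k (Set.range ψ) = V ∧ A.IsParameters π ψ c ∧ c.AllNonzero) ∧
      (∀ π V (ψ : Fin 2 → J), A.IsZeroFrame υ π → A.IsGoodPlane υ π V →
        LinearIndependent k ψ → Submodule.span k (Set.range ψ) = V →
        ∃! c : UpsilonParam k, A.IsParameters π ψ c) ∧
      -- for all such choices the formulas hold, once `ψ₁` and `ψ₂` are suitably rescaled
      (∀ π V (ψ : Fin 2 → J) (c : UpsilonParam k), A.IsZeroFrame υ π → A.IsGoodPlane υ π V →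
        LinearIndependent k ψ → Submodule.span k (Set.range ψ) = V →
        A.IsParameters π ψ c → A.S (π 1) ≠ 0 → A.S (π 3) ≠ 0 → c.AllNonzero →
        ∃ (γ δ : k) (ψ' : Fin 2 → J) (c' : UpsilonParam k), γ ≠ 0 ∧ δ ≠ 0 ∧
          ψ' = ![γ • ψ 0, δ • ψ 1] ∧ A.IsParameters π ψ' c' ∧ c'.AllNonzero ∧
          A.IsAdaptedBasis υ π ψ' ∧
          ∀ v : UpsilonPoint k,
            A.S (CubicJordanAlgebra.zeroPart π v) = (Upsilon.sharp c' v).u ∧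
            A.sharp (A.halfPart π ψ' v) +
                v.u • A.sharpMul υ (CubicJordanAlgebra.zeroPart π v) =
              CubicJordanAlgebra.zeroPart π (Upsilon.sharp c' v) ∧
            A.sharpMul (CubicJordanAlgebra.zeroPart π v) (A.halfPart π ψ' v) =
              A.halfPart π ψ' (Upsilon.sharp c' v) ∧
            A.sharp (A.element υ π ψ' v) = A.element υ π ψ' (Upsilon.sharp c' v) ∧
            A.N (A.element υ π ψ' v) = MvPolynomial.aeval (Upsilon.assign c' v) NΥ) := by
  refine ⟨Upsilon.cubicN Upsilon.genericParam Upsilon.genericPoint,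
    Upsilon.three_mul_cubicN _ _, CubicJordanAlgebra.exists_zeroFrame h2 hυ hdim hA hsimple,
    fun π hπ => CubicJordanAlgebra.exists_goodPlane h2 hυ hdim hA hsimple hπ,
    fun π V hπ hV hS1 hS3 => CubicJordanAlgebra.exists_allNonzero h2 hυ hA hπ hV hS1 hS3,
    fun π V ψ hπ hV hψ hspan => CubicJordanAlgebra.exists_parameters h2 hυ hA hπ hV hψ hspan, ?_⟩
  intro π V ψ c hπ hV hψ hspan hc hS1 hS3 hnz
  have hmem : ∀ i, ψ i ∈ A.peirceHalf υ := fun i =>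
    hV.le (hspan ▸ Submodule.subset_span ⟨i, rfl⟩)
  have hψ0 := hψ.ne_zero 0
  have hH := fun x hx =>
    CubicJordanAlgebra.exists_halfPart (A := A) (υ := υ) (x := x) hV hspan hx
  obtain ⟨κ, hκ, h00, h01, h11, g00, g01, g11⟩ := CubicJordanAlgebra.exists_normalization h2 hυ hπ
    hmem hc hψ0 hA (hnz.1 1 (by decide)) hH
  -- Scaling both ψ_i by γ multiplies the values of T by γ² and keeps the parameters c, so γ² = κ⁻¹
  -- normalizes the basis and one may take δ = γ.
  obtain ⟨γ, hγ⟩ := IsAlgClosed.exists_eq_mul_self κ⁻¹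
  have hγ0 : γ ≠ 0 := by
    rintro rfl
    exact inv_ne_zero hκ (by simpa using hγ)
  have hγκ : γ * γ * κ = 1 := by rw [← hγ, inv_mul_cancel₀ hκ]
  have hc' := hc.smul γ
  have hmem' : ∀ i, ![γ • ψ 0, γ • ψ 1] i ∈ A.peirceHalf υ := by
    intro i
    fin_cases i <;> exact Submodule.smul_mem _ _ (hmem _)
  have hψ0' : ![γ • ψ 0, γ • ψ 1] 0 ≠ 0 := smul_ne_zero hγ0 hψ0
  have hχ : ∀ i, A.chi π ![γ • ψ 0, γ • ψ 1] i = γ • A.chi π ψ i := by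
    intro i
    fin_cases i <;> simp [CubicJordanAlgebra.chi]
  have hN : A.IsNormalized π ![γ • ψ 0, γ • ψ 1] c := by
    constructor <;>
      simp only [hχ, Matrix.cons_val_zero, Matrix.cons_val_one, map_smul, LinearMap.smul_apply,
        smul_eq_mul, h00, h01, h11, g00, g01, g11, ← mul_assoc, hγκ, one_mul]
  have hH' : ∀ x ∈ A.peirceHalf υ, ∃ v : UpsilonPoint k,
      x = A.halfPart π ![γ • ψ 0, γ • ψ 1] v := by
    intro x hx
    obtain ⟨v, rfl⟩ := hH x hx
    refine ⟨⟨0, 0, γ⁻¹ • v.x, γ⁻¹ • v.y⟩, ?_⟩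
    simp only [CubicJordanAlgebra.halfPart_eq, hχ, Matrix.cons_val_zero, Matrix.cons_val_one,
      Pi.smul_apply, smul_smul, smul_eq_mul, mul_right_comm, inv_mul_cancel₀ hγ0, one_mul]
  refine ⟨γ, γ, _, c, hγ0, hγ0, rfl, hc', hnz,
    CubicJordanAlgebra.isAdaptedBasis h2 hυ hπ hdim hmem' hH', fun v => ⟨?_, ?_, ?_, ?_, ?_⟩⟩
  · exact CubicJordanAlgebra.S_zeroPart h2 hυ hπ hc' hmem' hψ0' v
  · exact CubicJordanAlgebra.sharp_halfPart_add h2 hυ hπ hc' hmem' hψ0' hA hN v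
  · exact CubicJordanAlgebra.sharpMul_zeroPart_halfPart h2 hυ hπ hc' hmem' v
  · exact CubicJordanAlgebra.sharp_element h2 hυ hπ hc' hmem' hψ0' hA hN v
  · rw [Upsilon.aeval_cubicN]
    exact CubicJordanAlgebra.N_element h2 hυ hπ hc' hmem' hψ0' hA hN v
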